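/- **Setting.** Write $e(t)=e^{2\pi i t}$. For $\delta>0$ let $\mathcal N(\delta)=\{(x,x^2+t): x\in[0,1],\ t\in[0,\delta]\}\subset\mathbb R^2$. Functions $F:\mathbb R^2\to\mathbb C$ are assumed to have an integrable function $\widehat F$ as Fourier transform, i.e. $F(x)=\int\widehat F(\xi)e(x\cdot\xi)\,d\xi$ for almost every $x$. For an interval $I\subset\mathbb R$, $\mathcal P_IF$ denotes the function with $\widehat{\mathcal P_IF}=\widehat F\,\mathbf 1_{I\times\mathbb R}$. For $\sigma\in\mathbb N$ and an interval $I\subseteq[0,1]$, $\mathbb I_\sigma(I)$ is the set of dyadic intervals of length $2^{-\sigma}$ contained in $I$, and $\mathbb I_\sigma=\mathbb I_\sigma([0,1])$. For $n\in\mathbb N$ and $p\ge2$ let $\mathrm D(n,p)$ be the smallest constant such that $$\|F\|_{L^p(\mathbb R^2)}\le \mathrm D(n,p)\Big(\sum_{I\in\mathbb I_n}\|\mathcal P_IF\|_{L^p(\mathbb R^2)}^2\Big)^{1/2}$$ for all $F$ with $\operatorname{supp}\widehat F\subseteq\mathcal N(4^{-n})$. For an axis-parallel square $Q$ with centre $c_Q$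 and side length $L$ put $w_Q(x)=(1+|x-c_Q|/L)^{-200}$ and $\|G\|_{L^q_\#(w_Q)}=\big(\tfrac1{|Q|}\int|G|^qw_Q\big)^{1/q}$. Let $I_1,I_2$ be dyadic subintervals of $[0,1]$, let $Q^R$ be an axis-parallel square of side length $2^R$, $R\in\mathbb N$, and for $r\le R$ let $\mathcal Q_r(Q^R)$ be its partition into squares of side length $2^r$. Define $$M_{p,q}(r,\sigma)=\Big[\frac1{|\mathcal Q_r(Q^R)|}\sum_{Q\in\mathcal Q_r(Q^R)}\prod_{i=1}^2\Big(\sum_{I\in\mathbb I_\sigma(I_i)}\|\mathcal P_IF\|_{L^q_\#(w_Q)}^2\Big)^{p/4}\Big]^{1/p}.$$ **Theorem.** Let $4\le p<\infty$, $\kappa_p=\frac{p-4}{p-2}$, $c>0$ and $\varepsilon>0$. (i) (Two-scale inequality) There is a constant $C$, depending only on $p,c,\varepsilon$, such that for all dyadic $I_1,I_2\subseteq[0,1]$ with $\operatorname{dist}(I_1,I_2)\ge c$, all $m,r\in\mathbb N$ with $m\le r$, all squares $Q^R$ with $R=2r$, and all $F$ with $\operatorname{supp}\widehat F\subseteq\mathcal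 N(4^{-m})$, $$M_{p,2}(m,m)\le C\,2^{m\varepsilon}\,M_{p,2}(2m,2m)^{1-\kappa_p}\,M_{p,p}(2r,m)^{\kappa_p}.$$ (ii) (Multiscale inequality) For every $s\in\mathbb N$ there is a constant $C$, depending only on $p,c,\varepsilon,s$, such that for all dyadic $I_1,I_2\subseteq[0,1]$ with $\operatorname{dist}(I_1,I_2)\ge c$, all $n=2^u$ with $u\in\mathbb N$, $u\ge s$, all squares $Q^R$ with $R=2n$, and all $F$ with $\operatorname{supp}\widehat F\subseteq\mathcal N(4^{-n})$, $$M_{p,2}\Big(\frac n{2^s},\frac n{2^s}\Big)\le C\,2^{sn\varepsilon}\,M_{p,p}(2n,n)\prod_{l=1}^s\mathrm D\Big(n-\frac n{2^l},p\Big)^{\kappa_p(1-\kappa_p)^{s-l}}.$$ (Here $0\in\mathbb N$ and $0^0=1$.) -/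

import Mathlib

open MeasureTheory Set
open scoped ENNReal NNReal FourierTransform

noncomputable section

namespace Decoupling

/-- The Euclidean plane, used both as physical and as frequency space. -/
abbrev Plane : Type := EuclideanSpace ℝ (Fin 2)

/-- `Fhat` is the Fourier transform of `F` and is an integrable function: `F` is (almost everywhere)
the inverse Fourier transform `x ↦ ∫ Fhat ξ * exp (2 π i x · ξ) dξ` of `Fhat`. A locally integrable
Fourier transform with bounded support is integrable, so this covers every `F` whose Fourier
transform is a function supported in a bounded set. -/
def HasFourierTransform (F Fhat : Plane → ℂ) : Prop :=
  Integrable Fhat ∧ F =ᵐ[volume] 𝓕⁻ Fhat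

/-- The vertical `δ`-neighbourhood `{(x, x² + t) : x ∈ [0,1], t ∈ [0,δ]}` of the truncated
parabola. -/
def parabolaNhd (δ : ℝ) : Set Plane :=
  {ξ | ξ 0 ∈ Icc (0 : ℝ) 1 ∧ ξ 1 - ξ 0 ^ 2 ∈ Icc 0 δ}

/-- The function `Fhat` vanishes (almost everywhere) outside `S`. -/
def SupportedIn (Fhat : Plane → ℂ) (S : Set Plane) : Prop :=
  ∀ᵐ ξ, ξ ∉ S → Fhat ξ = 0

/-- The dyadic interval `[j 2⁻ᵏ, (j+1) 2⁻ᵏ]`. -/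
def dyadicInterval (k j : ℕ) : Set ℝ :=
  Icc ((j : ℝ) / 2 ^ k) (((j : ℝ) + 1) / 2 ^ k)

/-- `I` is a dyadic subinterval of `[0,1]`. -/
def IsDyadic (I : Set ℝ) : Prop :=
  ∃ k j : ℕ, j < 2 ^ k ∧ I = dyadicInterval k j

open Classical in
/-- The dyadic intervals of length `2^(-σ)` contained in `I ⊆ [0,1]`, given by their indices:
`j` stands for `dyadicInterval σ j`. -/
def dyadicParts (σ : ℕ) (I : Set ℝ) : Finset ℕ :=
  (Finset.range (2 ^ σ)).filter fun j => dyadicInterval σ j ⊆ I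

/-- The Fourier projection of `F` onto the strip `I × ℝ`, in terms of the Fourier transform `Fhat`
of `F`: the function with Fourier transform `Fhat · 1_{I × ℝ}`. -/
def fourierProj (I : Set ℝ) (Fhat : Plane → ℂ) : Plane → ℂ :=
  𝓕⁻ (indicator {ξ : Plane | ξ 0 ∈ I} Fhat)

/-- The linear decoupling constant `D(n,p)`: the smallest constant such that
`‖F‖_p ≤ D(n,p) (∑_I ‖P_I F‖_p²)^(1/2)`, the sum being over the `2ⁿ` dyadic intervals `I ⊆ [0,1]`
of length `2⁻ⁿ`, for all `F` with Fourier support in the vertical `4⁻ⁿ`-neighbourhood of the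
parabola. -/
def decouplingConst (n : ℕ) (p : ℝ) : ℝ≥0∞ :=
  sInf {D : ℝ≥0∞ | ∀ F Fhat : Plane → ℂ, HasFourierTransform F Fhat →
    SupportedIn Fhat (parabolaNhd ((4 : ℝ) ^ n)⁻¹) →
    eLpNorm F (ENNReal.ofReal p) volume ≤
      D * (∑ j ∈ Finset.range (2 ^ n),
        eLpNorm (fourierProj (dyadicInterval n j) Fhat) (ENNReal.ofReal p) volume ^ 2)
          ^ (1 / 2 : ℝ)}

/-- The weight `(1 + |x - c| / L)^(-100 d)`, `d = 2`, adapted to the square with centre `c` and side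
length `L`. -/
def weight (c : Plane) (L : ℝ) (x : Plane) : ℝ :=
  1 / (1 + ‖x - c‖ / L) ^ (100 * 2)

/-- The measure `|Q|⁻¹ w_Q(x) dx` for the square `Q` with centre `c` and side length `L`. -/
def weightMeasure (c : Plane) (L : ℝ) : Measure Plane :=
  (ENNReal.ofReal (L ^ 2))⁻¹ • volume.withDensity fun x => ENNReal.ofReal (weight c L x)

/-- The weighted `L^q` average `(|Q|⁻¹ ∫ |G|^q w_Q)^(1/q)` for the square `Q` with centre `c` and
side length `L`. -/
def weightedAvg (q : ℝ) (c : Plane) (L : ℝ) (G : Plane → ℂ) : ℝ≥0∞ :=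
  eLpNorm G (ENNReal.ofReal q) (weightMeasure c L)

/-- The square with lower left corner `a` and side length `2^R` is partitioned, for `r ≤ R`, into
the squares with side length `2^r` and lower left corners `a + 2^r j`, `j ∈ {0, …, 2^(R-r) - 1}²`.
This is the index set of that partition. -/
abbrev SubsquareIndex (R r : ℕ) : Type := Fin 2 → Fin (2 ^ (R - r))

/-- The centre of the square with index `j` in that partition. -/
def subsquareCenter (a : Plane) (R r : ℕ) (j : SubsquareIndex R r) : Plane :=
  WithLp.toLp 2 fun i => a i + 2 ^ r * (((j i : ℕ) : ℝ) + 1 / 2)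

/-- The multiscale quantity `M_{p,q}(r,σ)` of `F` (given by its Fourier transform `Fhat`), for the
intervals `I 0`, `I 1` and the square with lower left corner `a` and side length `2^R`. -/
def multiscaleM (I : Fin 2 → Set ℝ) (a : Plane) (R : ℕ) (Fhat : Plane → ℂ)
    (p q : ℝ) (r σ : ℕ) : ℝ≥0∞ :=
  ((Fintype.card (SubsquareIndex R r) : ℝ≥0∞)⁻¹ *
    ∑ j : SubsquareIndex R r, ∏ i : Fin 2,
      (∑ k ∈ dyadicParts σ (I i),
        weightedAvg q (subsquareCenter a R r j) (2 ^ r)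
          (fourierProj (dyadicInterval σ k) Fhat) ^ 2) ^ (p / 4)) ^ (1 / p)

/-- The exponent `κ_p = (p - 4) / (p - 2)`. -/
def kappa (p : ℝ) : ℝ := (p - 4) / (p - 2)

end Decoupling

end

open scoped Convolution


noncomputable section

namespace Decoupling

/-! ### Integrals over the plane -/

/-! The two-scale inequality is a chain of four moves, put together in `exists_two_scale`. Hölder
raises the inner exponent from 2 to p/2. Ball inflation then replaces squares of side 2^m by squares
of side 2^(2m), keeping the intervals: for |I| = 2^(-m) the function |P_I F|^(p/2) is essentially
constant on translates of a 2^m × 2^(2m) tube, tubes coming from the separated I₁ and I₂ are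
transversal, and bilinear Kakeya bounds the average of a product by the product of averages.
Interpolation, with 2/p = (1-κ)/2 + κ/p, produces an L² factor and an L^p factor. In the former,
squares of side 2^(2m) resolve frequencies at scale 2^(-2m), so local orthogonality refines the
intervals; in the latter, the squares are enlarged to the whole of Q^R because the weights of a
partition add up.

No pigeonholing is needed. Kakeya for one pair of arcs loses only a constant
(`exists_bilinear_inflation`), and since p/4 ≥ 1, Minkowski in ℓ^(p/4) sums over all pairs
(`exists_ball_inflation`). The chain has no ε-loss; the factor 2^(mε) ≥ 1 is inserted at the end.

The multiscale inequality is an induction on s. The two-scale inequality at m = n/2^(s+1) leaves an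
L² factor, treated by the induction hypothesis, and the L^p factor M(2n, m). Parabolic rescaling
decouples the latter from length 2^(-m) down to 2^(-n) at the cost of D(n-m, p). The powers 1-κ and
κ of M(2n, n) recombine to a single one.

Two devices make this rigorous. The weights are not band-limited, but each is comparable to its
convolution with a nonnegative band-limited function (`exists_bandlimited_weight`); multiplying by
the result blurs Fourier supports only by the inverse side length, which orthogonality of
nonadjacent pieces tolerates and the rescaling absorbs (`parabolicMap_add_mem`). "Essentially
constant" becomes a reproducing formula (`fourierInv_eq_integral_translates`), through which
averaging along a tube is moved onto the weight. -/

theorem lintegral_plane_mul {f g : ℝ → ℝ≥0∞} (hf : Measurable f) (hg : Measurable g) :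
    ∫⁻ z : Plane, f (z 0) * g (z 1) = (∫⁻ t, f t) * ∫⁻ t, g t := by
  have h1 : MeasurePreserving (fun z : Plane => ((z 0, z 1) : ℝ × ℝ)) :=
    (volume_preserving_finTwoArrow ℝ).comp (PiLp.volume_preserving_ofLp (Fin 2))
  have h2 : Measurable fun y : ℝ × ℝ => f y.1 * g y.2 := by fun_prop
  rw [← lintegral_prod_mul hf.aemeasurable hg.aemeasurable, ← Measure.volume_eq_prod,
    ← h1.lintegral_comp h2]

theorem abs_coord_le_norm (z : Plane) (i : Fin 2) : |z i| ≤ ‖z‖ := by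
  simpa using PiLp.norm_apply_le z i

theorem norm_le_abs_add_abs (z : Plane) : ‖z‖ ≤ |z 0| + |z 1| := by
  rw [EuclideanSpace.norm_eq, Fin.sum_univ_two]
  refine Real.sqrt_le_iff.2 ⟨by positivity, ?_⟩
  simp only [Real.norm_eq_abs]
  nlinarith [abs_nonneg (z 0), abs_nonneg (z 1)]

theorem one_add_norm_add_le {E : Type*} [SeminormedAddCommGroup E] (x y : E) :
    1 + ‖x + y‖ ≤ (1 + ‖x‖) * (1 + ‖y‖) := by
  nlinarith [norm_add_le x y, norm_nonneg x, norm_nonneg y]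

theorem one_add_norm_le_mul_add {E : Type*} [SeminormedAddCommGroup E] (x y : E) :
    1 + ‖x‖ ≤ (1 + ‖x + y‖) * (1 + ‖y‖) := by
  have h := one_add_norm_add_le (x + y) (-y)
  rwa [add_neg_cancel_right, norm_neg] at h

/-! ### Sums over grids -/

theorem exists_sum_inv_sq_le : ∃ C : ℝ, 0 < C ∧ ∀ (t : ℝ) (N : ℕ),
    ∑ j ∈ Finset.range N, ((1 + |t - j|) ^ 2)⁻¹ ≤ C := by
  have hs : Summable fun k : ℤ => ((1 + |(k : ℝ)|) ^ 2)⁻¹ := by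
    have h0 : Summable fun n : ℕ => ((1 + |((n : ℤ) : ℝ)|) ^ 2)⁻¹ := by
      have h := (summable_nat_add_iff 1).2 (Real.summable_nat_pow_inv.2 (by norm_num : 1 < 2))
      refine h.congr fun n => ?_
      push_cast
      rw [abs_of_nonneg (by positivity : (0 : ℝ) ≤ n), add_comm]
    refine Summable.of_nat_of_neg h0 (h0.congr fun n => ?_)
    push_cast
    rw [abs_neg]
  refine ⟨4 * ∑' k : ℤ, ((1 + |(k : ℝ)|) ^ 2)⁻¹, ?_, fun t N => ?_⟩
  · have := hs.tsum_pos (fun k => by positivity) 0 (by simp)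
    linarith
  · have h1 : ∀ j : ℕ, ((1 + |t - j|) ^ 2)⁻¹ ≤ 4 * ((1 + |((⌊t⌋ - (j : ℤ) : ℤ) : ℝ)|) ^ 2)⁻¹ := by
      intro j
      have h2 : |(⌊t⌋ : ℝ) - j| ≤ |t - j| + 1 := by
        have h3 := Int.floor_le t
        have h4 := Int.lt_floor_add_one t
        have h5 := abs_sub_abs_le_abs_sub ((⌊t⌋ : ℝ) - j) (t - j)
        have h6 : |(⌊t⌋ : ℝ) - j - (t - j)| ≤ 1 := by
          rw [abs_le]; constructor <;> linarith
        linarith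
      push_cast
      rw [← div_eq_mul_inv, inv_eq_one_div, div_le_div_iff₀ (by positivity) (by positivity)]
      nlinarith [abs_nonneg (t - j), abs_nonneg ((⌊t⌋ : ℝ) - j)]
    refine (Finset.sum_le_sum fun j _ => h1 j).trans ?_
    rw [← Finset.mul_sum]
    gcongr
    have hinj : Function.Injective fun j : ℕ => ⌊t⌋ - (j : ℤ) := fun i j h => by
      simpa using h
    have h2 := (hs.comp_injective hinj).sum_le_tsum (Finset.range N) fun j _ => by
      simp only [Function.comp_apply]
      positivity
    exact h2.trans (tsum_comp_le_tsum_of_inj hs (fun k => by positivity) hinj)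

theorem exists_sum_inv_sq_mul_le : ∃ C : ℝ, 0 < C ∧ ∀ (b t : ℝ) (N : ℕ), b ≠ 0 →
    ∑ j ∈ Finset.range N, ((1 + |t - b * j|) ^ 2)⁻¹ ≤ C * (1 + |b|⁻¹) ^ 2 := by
  obtain ⟨C, hC, h⟩ := exists_sum_inv_sq_le
  refine ⟨C, hC, fun b t N hb => ?_⟩
  have hb' : 0 < |b| := abs_pos.2 hb
  have h1 : ∀ j : ℕ, ((1 + |t - b * j|) ^ 2)⁻¹ ≤ ((1 + |t / b - j|) ^ 2)⁻¹ * (1 + |b|⁻¹) ^ 2 := by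
    intro j
    have h2 : |t / b - j| = |b|⁻¹ * |t - b * j| := by
      rw [← abs_inv, ← abs_mul]; congr 1; field_simp
    rw [inv_mul_eq_div, inv_eq_one_div, div_le_div_iff₀ (by positivity) (by positivity), one_mul,
      ← mul_pow, h2]
    have h3 : 0 ≤ |b|⁻¹ := by positivity
    gcongr
    nlinarith [abs_nonneg (t - b * j)]
  refine (Finset.sum_le_sum fun j _ => h1 j).trans ?_
  rw [← Finset.sum_mul]
  gcongr
  exact h _ _

/-- The bilinear Kakeya estimate on a grid: two families of parallel strips with transversal
directions `(2a₁, -1)`, `(2a₂, -1)`. -/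
theorem exists_sum_transversal_le {c : ℝ} (hc : 0 < c) : ∃ C : ℝ, 0 < C ∧
    ∀ (a₁ a₂ s₁ s₂ : ℝ) (N : ℕ), c ≤ |a₁ - a₂| →
      ∑ i ∈ Finset.range N, ∑ j ∈ Finset.range N,
        ((1 + |s₁ - (i + 2 * a₁ * j)|) ^ 4)⁻¹ * ((1 + |s₂ - (i + 2 * a₂ * j)|) ^ 4)⁻¹ ≤ C := by
  obtain ⟨C₁, hC₁, h₁⟩ := exists_sum_inv_sq_le
  obtain ⟨C₂, hC₂, h₂⟩ := exists_sum_inv_sq_mul_le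
  refine ⟨C₁ * (C₂ * (1 + (2 * c)⁻¹) ^ 2), by positivity, fun a₁ a₂ s₁ s₂ N ha => ?_⟩
  have ha' : 2 * c ≤ |2 * (a₁ - a₂)| := by rw [abs_mul, abs_two]; linarith
  -- With u, v the two arguments, u - v does not depend on i, so after this bound the i-sum can be
  -- done first. Two of the four powers of each factor pay for 1 + |u - v| ≤ (1 + |u|)(1 + |v|).
  have key : ∀ i j : ℕ,
      ((1 + |s₁ - (i + 2 * a₁ * j)|) ^ 4)⁻¹ * ((1 + |s₂ - (i + 2 * a₂ * j)|) ^ 4)⁻¹ ≤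
      ((1 + |(s₁ - 2 * a₁ * j) - i|) ^ 2)⁻¹ *
        ((1 + |(s₁ - s₂) - 2 * (a₁ - a₂) * j|) ^ 2)⁻¹ := by
    intro i j
    set α := s₁ - (i + 2 * a₁ * j)
    set β := s₂ - (i + 2 * a₂ * j)
    have e1 : (s₁ - 2 * a₁ * j) - i = α := by simp only [α]; ring
    have e2 : (s₁ - s₂) - 2 * (a₁ - a₂) * j = α + -β := by simp only [α, β]; ring
    rw [e1, e2, ← mul_inv, ← mul_inv]
    refine inv_anti₀ (by positivity) ?_
    have h3 := one_add_norm_add_le α (-β)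
    simp only [Real.norm_eq_abs, abs_neg] at h3
    have hα : 1 ≤ 1 + |α| := by linarith [abs_nonneg α]
    have hβ : 1 ≤ 1 + |β| := by linarith [abs_nonneg β]
    calc (1 + |α|) ^ 2 * (1 + |α + -β|) ^ 2
        ≤ (1 + |α|) ^ 2 * ((1 + |α|) * (1 + |β|)) ^ 2 := by gcongr
      _ = (1 + |α|) ^ 4 * (1 + |β|) ^ 2 := by ring
      _ ≤ (1 + |α|) ^ 4 * (1 + |β|) ^ 4 := by
          gcongr
          norm_num
  have hne : 2 * (a₁ - a₂) ≠ 0 := abs_pos.1 (by linarith)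
  calc _ ≤ ∑ i ∈ Finset.range N, ∑ j ∈ Finset.range N,
      ((1 + |(s₁ - 2 * a₁ * j) - i|) ^ 2)⁻¹ *
        ((1 + |(s₁ - s₂) - 2 * (a₁ - a₂) * j|) ^ 2)⁻¹ :=
        Finset.sum_le_sum fun i _ => Finset.sum_le_sum fun j _ => key i j
    _ = ∑ j ∈ Finset.range N, (∑ i ∈ Finset.range N, ((1 + |(s₁ - 2 * a₁ * j) - i|) ^ 2)⁻¹) *
        ((1 + |(s₁ - s₂) - 2 * (a₁ - a₂) * j|) ^ 2)⁻¹ := by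
        rw [Finset.sum_comm]; simp_rw [Finset.sum_mul]
    _ ≤ ∑ j ∈ Finset.range N, C₁ * ((1 + |(s₁ - s₂) - 2 * (a₁ - a₂) * j|) ^ 2)⁻¹ := by
        gcongr with j _
        exact h₁ _ _
    _ = C₁ * ∑ j ∈ Finset.range N, ((1 + |(s₁ - s₂) - 2 * (a₁ - a₂) * j|) ^ 2)⁻¹ := by
        rw [Finset.mul_sum]
    _ ≤ C₁ * (C₂ * (1 + |2 * (a₁ - a₂)|⁻¹) ^ 2) := by
        gcongr
        exact h₂ _ _ _ hne
    _ ≤ C₁ * (C₂ * (1 + (2 * c)⁻¹) ^ 2) := by gcongr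

theorem exists_sum_grid_le : ∃ C : ℝ, 0 < C ∧ ∀ (s₁ s₂ : ℝ) (N : ℕ),
    ∑ i ∈ Finset.range N, ∑ j ∈ Finset.range N,
      ((1 + |s₁ - i|) ^ 2)⁻¹ * ((1 + |s₂ - j|) ^ 2)⁻¹ ≤ C := by
  obtain ⟨C, hC, h⟩ := exists_sum_inv_sq_le
  refine ⟨C * C, by positivity, fun s₁ s₂ N => ?_⟩
  rw [← Finset.sum_mul_sum]
  exact mul_le_mul (h _ _) (h _ _) (Finset.sum_nonneg fun _ _ => by positivity) hC.le

/-! ### Weights -/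

theorem weight_eq (c : Plane) (L : ℝ) (x : Plane) :
    weight c L x = ((1 + ‖x - c‖ / L) ^ 200)⁻¹ := by
  rw [weight, one_div]

theorem weight_pos (c : Plane) {L : ℝ} (hL : 0 < L) (x : Plane) : 0 < weight c L x := by
  rw [weight_eq]; positivity

theorem continuous_weight (c : Plane) {L : ℝ} (hL : 0 < L) : Continuous (weight c L) := by
  have h : weight c L = fun x => ((1 + ‖x - c‖ / L) ^ 200)⁻¹ := funext (weight_eq c L)
  rw [h]
  refine Continuous.inv₀ (by fun_prop) fun x => ?_
  positivity

theorem weight_add_le (c : Plane) {L : ℝ} (hL : 0 < L) (x y : Plane) :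
    weight c L (x + y) ≤ weight c L x * (1 + ‖y‖ / L) ^ 200 := by
  rw [weight_eq, weight_eq, inv_mul_eq_div, inv_eq_one_div,
    div_le_div_iff₀ (by positivity) (by positivity), one_mul, ← mul_pow]
  gcongr
  have h1 : ‖x - c‖ ≤ ‖x + y - c‖ + ‖y‖ := by
    have := norm_sub_le (x + y - c) y
    rwa [show x + y - c - y = x - c by abel] at this
  have h2 : ‖x - c‖ / L ≤ ‖x + y - c‖ / L + ‖y‖ / L := by rw [← add_div]; gcongr
  have h3 : 0 ≤ ‖x + y - c‖ / L := by positivity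
  have h4 : 0 ≤ ‖y‖ / L := by positivity
  nlinarith

theorem lintegral_weightMeasure (c : Plane) {L : ℝ} (hL : 0 < L) (f : Plane → ℝ≥0∞) :
    ∫⁻ x, f x ∂weightMeasure c L =
      (ENNReal.ofReal (L ^ 2))⁻¹ * ∫⁻ x, ENNReal.ofReal (weight c L x) * f x := by
  rw [weightMeasure, lintegral_smul_measure, smul_eq_mul,
    lintegral_withDensity_eq_lintegral_mul_non_measurable _
      ((continuous_weight c hL).measurable.ennreal_ofReal) (by simp)]
  rfl

/-- The centre of the square of side length `ℓ` with index `(i, j)` in the grid of mesh `ℓ` with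
corner `a`. -/
def gridCenter (a : Plane) (ℓ : ℝ) (i j : ℕ) : Plane :=
  !₂[a 0 + ℓ * (i + 1 / 2), a 1 + ℓ * (j + 1 / 2)]

@[simp] theorem gridCenter_zero (a : Plane) (ℓ : ℝ) (i j : ℕ) :
    gridCenter a ℓ i j 0 = a 0 + ℓ * (i + 1 / 2) := rfl

@[simp] theorem gridCenter_one (a : Plane) (ℓ : ℝ) (i j : ℕ) :
    gridCenter a ℓ i j 1 = a 1 + ℓ * (j + 1 / 2) := rfl

/-- The large square is the cell (0, 0) of the grid of mesh N ℓ with the same corner, so `gridCenter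
a (N * ℓ) 0 0` is its centre. -/
theorem norm_gridCenter_sub_le (a : Plane) {ℓ : ℝ} (hℓ : 0 < ℓ) {N i j : ℕ} (hi : i < N)
    (hj : j < N) : ‖gridCenter a ℓ i j - gridCenter a (N * ℓ) 0 0‖ ≤ N * ℓ := by
  have key : ∀ k : ℕ, k < N → |ℓ * (k + 1 / 2) - N * ℓ * (1 / 2)| ≤ N * ℓ / 2 := by
    intro k hk
    have hk' : (k : ℝ) + 1 ≤ N := by exact_mod_cast hk
    have hk0 : (0 : ℝ) ≤ k := by positivity
    rw [abs_le]; constructor <;> nlinarith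
  refine (norm_le_abs_add_abs _).trans ?_
  have e0 : (gridCenter a ℓ i j - gridCenter a (N * ℓ) 0 0) 0 =
      ℓ * (i + 1 / 2) - N * ℓ * (1 / 2) := by simp
  have e1 : (gridCenter a ℓ i j - gridCenter a (N * ℓ) 0 0) 1 =
      ℓ * (j + 1 / 2) - N * ℓ * (1 / 2) := by simp
  rw [e0, e1]
  linarith [key i hi, key j hj]

/-- The weight of a small square is dominated by the weight of a large one, with a gain. -/
theorem weight_gridCenter_le (a : Plane) {ℓ : ℝ} (hℓ : 0 < ℓ) {N i j : ℕ} (hi : i < N)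
    (hj : j < N) (x : Plane) :
    weight (gridCenter a ℓ i j) ℓ x ≤ (2 ^ 200 * 2 ^ 200) * weight (gridCenter a (N * ℓ) 0 0) (N * ℓ) x *
      (((N : ℝ)⁻¹) ^ 200 + ((1 + ‖x - gridCenter a ℓ i j‖ / ℓ) ^ 200)⁻¹) := by
  have hN : (0 : ℝ) < N := by exact_mod_cast (Nat.zero_le i).trans_lt hi
  set s := ‖x - gridCenter a ℓ i j‖ / ℓ with hs
  have hs0 : 0 ≤ s := by positivity
  set S := ‖x - gridCenter a (N * ℓ) 0 0‖ / (N * ℓ) with hS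
  have hS0 : 0 ≤ S := by positivity
  have h1 : S ≤ s / N + 1 := by
    rw [hS, hs, div_div, mul_comm ℓ (N : ℝ), div_le_iff₀ (by positivity), add_mul,
      div_mul_cancel₀ _ (by positivity), one_mul]
    have := norm_add_le (x - gridCenter a ℓ i j) (gridCenter a ℓ i j - gridCenter a (N * ℓ) 0 0)
    rw [sub_add_sub_cancel] at this
    linarith [norm_gridCenter_sub_le a hℓ hi hj]
  -- The ratio of the two weights is the 200th power of this quotient: either x is far away and the
  -- quotient is about 1/N, or the decay of the small weight remains.
  have h2 : (1 + S) / (1 + s) ≤ 2 * ((N : ℝ)⁻¹ + (1 + s)⁻¹) := by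
    rw [div_le_iff₀ (by positivity), mul_assoc, add_mul, inv_mul_cancel₀ (by positivity)]
    have h3 : s / N = (N : ℝ)⁻¹ * s := by rw [div_eq_inv_mul]
    have h4 : 0 ≤ (N : ℝ)⁻¹ := by positivity
    have h5 : 0 ≤ (N : ℝ)⁻¹ * s := by positivity
    nlinarith
  have h3 : ((1 + S) / (1 + s)) ^ 200 ≤
      (2 ^ 200 * 2 ^ 200) * (((N : ℝ)⁻¹) ^ 200 + ((1 + s) ^ 200)⁻¹) := by
    calc ((1 + S) / (1 + s)) ^ 200 ≤ (2 * ((N : ℝ)⁻¹ + (1 + s)⁻¹)) ^ 200 := by gcongr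
      _ = 2 ^ 200 * ((N : ℝ)⁻¹ + (1 + s)⁻¹) ^ 200 := mul_pow _ _ _
      _ ≤ 2 ^ 200 * (2 ^ (200 - 1) * (((N : ℝ)⁻¹) ^ 200 + ((1 + s)⁻¹) ^ 200)) := by
          gcongr
          exact add_pow_le (by positivity) (by positivity) _
      _ ≤ 2 ^ 200 * (2 ^ 200 * (((N : ℝ)⁻¹) ^ 200 + ((1 + s)⁻¹) ^ 200)) := by
          gcongr <;> norm_num
      _ = _ := by rw [← mul_assoc, inv_pow (1 + s)]
  rw [weight_eq, weight_eq, ← hs, ← hS]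
  calc ((1 + s) ^ 200)⁻¹ = ((1 + S) ^ 200)⁻¹ * ((1 + S) / (1 + s)) ^ 200 := by
        rw [div_pow, div_eq_mul_inv, inv_mul_cancel_left₀ (by positivity)]
    _ ≤ ((1 + S) ^ 200)⁻¹ * ((2 ^ 200 * 2 ^ 200) * (((N : ℝ)⁻¹) ^ 200 + ((1 + s) ^ 200)⁻¹)) := by gcongr
    _ = _ := by rw [mul_left_comm, ← mul_assoc]

theorem inv_one_add_norm_pow_le (z : Plane) (k : ℕ) (hk : 4 ≤ k) :
    ((1 + ‖z‖) ^ k)⁻¹ ≤ ((1 + |z 0|) ^ 2)⁻¹ * ((1 + |z 1|) ^ 2)⁻¹ := by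
  rw [← mul_inv]
  refine inv_anti₀ (by positivity) ?_
  have h0 := abs_coord_le_norm z 0
  have h1 := abs_coord_le_norm z 1
  calc (1 + |z 0|) ^ 2 * (1 + |z 1|) ^ 2 ≤ (1 + ‖z‖) ^ 2 * (1 + ‖z‖) ^ 2 := by gcongr
    _ = (1 + ‖z‖) ^ 4 := by ring
    _ ≤ (1 + ‖z‖) ^ k := pow_le_pow_right₀ (by linarith [norm_nonneg z]) hk

/-- The weights of the squares of a partition add up to at most a multiple of the weight of the
large square. -/
theorem exists_sum_weight_le : ∃ C : ℝ, 0 < C ∧ ∀ (a : Plane) (ℓ : ℝ) (N : ℕ), 0 < ℓ → 0 < N →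
    ∀ x : Plane, ∑ i ∈ Finset.range N, ∑ j ∈ Finset.range N, weight (gridCenter a ℓ i j) ℓ x ≤
      C * weight (gridCenter a (N * ℓ) 0 0) (N * ℓ) x := by
  obtain ⟨C, hC, h⟩ := exists_sum_grid_le
  refine ⟨(2 ^ 200 * 2 ^ 200) * (1 + C), by positivity, fun a ℓ N hℓ hN x => ?_⟩
  have hN' : (1 : ℝ) ≤ N := by exact_mod_cast hN
  have hw := weight_pos (gridCenter a (N * ℓ) 0 0) (mul_pos (by linarith : (0 : ℝ) < N) hℓ) x
  set w := weight (gridCenter a (N * ℓ) 0 0) (N * ℓ) x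
  have key : ∀ i ∈ Finset.range N, ∀ j ∈ Finset.range N, weight (gridCenter a ℓ i j) ℓ x ≤
      (2 ^ 200 * 2 ^ 200) * w * (((N : ℝ) ^ 2)⁻¹ + ((1 + |((x 0 - a 0) / ℓ - 1 / 2) - i|) ^ 2)⁻¹ *
        ((1 + |((x 1 - a 1) / ℓ - 1 / 2) - j|) ^ 2)⁻¹) := by
    intro i hi j hj
    refine (weight_gridCenter_le a hℓ (Finset.mem_range.1 hi) (Finset.mem_range.1 hj) x).trans ?_
    gcongr
    · rw [inv_pow]
      refine inv_anti₀ (by positivity) (pow_le_pow_right₀ hN' (by norm_num))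
    · have e : ‖x - gridCenter a ℓ i j‖ / ℓ = ‖ℓ⁻¹ • (x - gridCenter a ℓ i j)‖ := by
        rw [norm_smul, norm_inv, Real.norm_of_nonneg hℓ.le, div_eq_inv_mul]
      rw [e]
      refine (inv_one_add_norm_pow_le _ 200 (by norm_num)).trans (le_of_eq ?_)
      congr 5 <;> simp <;> field_simp <;> ring_nf
  refine (Finset.sum_le_sum fun i hi => Finset.sum_le_sum fun j hj => key i hi j hj).trans ?_
  simp_rw [← Finset.mul_sum, Finset.sum_add_distrib]
  -- The far contributions need only N^(-2) per square, as there are N² squares.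
  have h1 : ∑ _i ∈ Finset.range N, ∑ _j ∈ Finset.range N, ((N : ℝ) ^ 2)⁻¹ = 1 := by
    simp only [Finset.sum_const, Finset.card_range, nsmul_eq_mul]
    field_simp
  rw [h1]
  have h2 := h ((x 0 - a 0) / ℓ - 1 / 2) ((x 1 - a 1) / ℓ - 1 / 2) N
  calc (2 ^ 200 * 2 ^ 200) * w * (1 + _) ≤ (2 ^ 200 * 2 ^ 200) * w * (1 + C) := by gcongr
    _ = _ := mul_right_comm _ _ _

/-! ### Mass of the weights -/

theorem exists_lintegral_inv_sq_le : ∃ J : ℝ≥0, ∀ s b : ℝ, 0 < b →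
    ∫⁻ t, ENNReal.ofReal (((1 + |s + b * t|) ^ 2)⁻¹) ≤ ENNReal.ofReal b⁻¹ * J := by
  have hi : Integrable fun t : ℝ => ((1 + |t|) ^ 2)⁻¹ := by
    have h := integrable_one_add_norm (E := ℝ) (μ := volume) (r := 2) (by simp)
    refine h.congr (Filter.Eventually.of_forall fun t => ?_)
    simp only [Real.norm_eq_abs]
    rw [Real.rpow_neg (by positivity)]
    norm_cast
  refine ⟨(∫ t : ℝ, ((1 + |t|) ^ 2)⁻¹).toNNReal, fun s b hb => ?_⟩
  have h1 : Integrable fun t : ℝ => ((1 + |s + b * t|) ^ 2)⁻¹ :=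
    (hi.comp_add_left s).comp_mul_left' hb.ne'
  rw [← ofReal_integral_eq_lintegral_ofReal h1 (Filter.Eventually.of_forall fun t => by positivity),
    Measure.integral_comp_mul_left (fun t => ((1 + |s + t|) ^ 2)⁻¹) b,
    integral_add_left_eq_self (fun t : ℝ => ((1 + |t|) ^ 2)⁻¹) s, smul_eq_mul,
    abs_of_pos (by positivity), ENNReal.ofReal_mul (by positivity)]
  rfl

theorem exists_weightMeasure_univ_le : ∃ C : ℝ≥0, ∀ (c : Plane) (L : ℝ), 0 < L →
    weightMeasure c L univ ≤ C := by
  obtain ⟨J, hJ⟩ := exists_lintegral_inv_sq_le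
  refine ⟨J * J, fun c L hL => ?_⟩
  have h0 := lintegral_weightMeasure c hL 1
  simp only [Pi.one_apply, lintegral_one, mul_one] at h0
  have hg : ∀ i : Fin 2, Measurable fun t : ℝ =>
      ENNReal.ofReal (((1 + |-(c i / L) + L⁻¹ * t|) ^ 2)⁻¹) := fun i => by fun_prop
  have h1 : ∀ x : Plane, ENNReal.ofReal (weight c L x) ≤
      ENNReal.ofReal (((1 + |-(c 0 / L) + L⁻¹ * x 0|) ^ 2)⁻¹) *
        ENNReal.ofReal (((1 + |-(c 1 / L) + L⁻¹ * x 1|) ^ 2)⁻¹) := by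
    intro x
    rw [← ENNReal.ofReal_mul (by positivity)]
    refine ENNReal.ofReal_le_ofReal ?_
    have e : ‖x - c‖ / L = ‖L⁻¹ • (x - c)‖ := by
      rw [norm_smul, norm_inv, Real.norm_of_nonneg hL.le, div_eq_inv_mul]
    rw [weight_eq, e]
    refine (inv_one_add_norm_pow_le _ 200 (by norm_num)).trans (le_of_eq ?_)
    congr 5 <;> simp <;> ring
  rw [h0]
  calc _ ≤ (ENNReal.ofReal (L ^ 2))⁻¹ * ((ENNReal.ofReal L⁻¹⁻¹ * J) * (ENNReal.ofReal L⁻¹⁻¹ * J)) := by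
        gcongr
        refine (lintegral_mono h1).trans ?_
        rw [lintegral_plane_mul (hg 0) (hg 1)]
        gcongr <;> exact hJ _ _ (by positivity)
    _ = (ENNReal.ofReal (L ^ 2))⁻¹ * ENNReal.ofReal (L ^ 2) * (J * J) := by
        rw [inv_inv, sq L, ENNReal.ofReal_mul hL.le]; ring
    _ = ((J * J : ℝ≥0) : ℝ≥0∞) := by
        rw [ENNReal.inv_mul_cancel (by simpa using by positivity) ENNReal.ofReal_ne_top, one_mul,
          ENNReal.coe_mul]

/-- The factor N² is the number of small squares: it disappears when the left side is averaged
instead of summed. -/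
theorem exists_sum_lintegral_weightMeasure_le : ∃ C : ℝ≥0, ∀ (a : Plane) (ℓ : ℝ) (N : ℕ),
    0 < ℓ → 0 < N → ∀ f : Plane → ℝ≥0∞, Measurable f →
      ∑ i ∈ Finset.range N, ∑ j ∈ Finset.range N, ∫⁻ x, f x ∂weightMeasure (gridCenter a ℓ i j) ℓ ≤
        C * (N : ℝ≥0∞) ^ 2 * ∫⁻ x, f x ∂weightMeasure (gridCenter a (N * ℓ) 0 0) (N * ℓ) := by
  obtain ⟨C, hC, h⟩ := exists_sum_weight_le
  refine ⟨C.toNNReal, fun a ℓ N hℓ hN f hf => ?_⟩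
  have hN' : (0 : ℝ) < N := by exact_mod_cast hN
  have hL : 0 < N * ℓ := by positivity
  simp_rw [lintegral_weightMeasure _ hℓ, lintegral_weightMeasure _ hL, ← Finset.mul_sum]
  have hm : ∀ i j : ℕ, Measurable fun x =>
      ENNReal.ofReal (weight (gridCenter a ℓ i j) ℓ x) * f x := fun i j =>
    ((continuous_weight _ hℓ).measurable.ennreal_ofReal).mul hf
  have h1 : ∑ i ∈ Finset.range N, ∑ j ∈ Finset.range N,
      ∫⁻ x, ENNReal.ofReal (weight (gridCenter a ℓ i j) ℓ x) * f x ≤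
      ENNReal.ofReal C *
        ∫⁻ x, ENNReal.ofReal (weight (gridCenter a (N * ℓ) 0 0) (N * ℓ) x) * f x := by
    rw [← lintegral_const_mul' _ _ ENNReal.ofReal_ne_top]
    simp_rw [← lintegral_finsetSum _ fun j _ => hm _ j]
    rw [← lintegral_finsetSum _ fun i _ => Finset.measurable_sum _ fun j _ => hm i j]
    refine lintegral_mono fun x => ?_
    simp_rw [← Finset.sum_mul]
    rw [← mul_assoc, ← ENNReal.ofReal_mul hC.le]
    gcongr
    calc _ = ENNReal.ofReal (∑ i ∈ Finset.range N, ∑ j ∈ Finset.range N,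
          weight (gridCenter a ℓ i j) ℓ x) := by
          rw [ENNReal.ofReal_sum_of_nonneg fun i _ => Finset.sum_nonneg fun j _ =>
            (weight_pos _ hℓ x).le]
          refine Finset.sum_congr rfl fun i _ => ?_
          rw [ENNReal.ofReal_sum_of_nonneg fun j _ => (weight_pos _ hℓ x).le]
      _ ≤ _ := ENNReal.ofReal_le_ofReal (h a ℓ N hℓ hN x)
  have h2 : (ENNReal.ofReal (ℓ ^ 2))⁻¹ = (N : ℝ≥0∞) ^ 2 * (ENNReal.ofReal ((N * ℓ) ^ 2))⁻¹ := by
    rw [mul_pow, ENNReal.ofReal_mul (by positivity), ENNReal.mul_inv (by simp) (by simp),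
      ENNReal.ofReal_pow hN'.le, ENNReal.ofReal_natCast, ← mul_assoc,
      ENNReal.mul_inv_cancel (by positivity) (by finiteness), one_mul]
  rw [h2]
  calc _ ≤ (N : ℝ≥0∞) ^ 2 * (ENNReal.ofReal ((N * ℓ) ^ 2))⁻¹ * (ENNReal.ofReal C *
        ∫⁻ x, ENNReal.ofReal (weight (gridCenter a (N * ℓ) 0 0) (N * ℓ) x) * f x) := by gcongr
    _ = _ := by rw [show ((C.toNNReal : ℝ≥0) : ℝ≥0∞) = ENNReal.ofReal C from rfl]; ring

/-! ### Mollified weights -/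

theorem exists_schwartz_decay (ψ : SchwartzMap Plane ℂ) (k : ℕ) : ∃ C : ℝ, 0 < C ∧
    ∀ x, ‖ψ x‖ ≤ C * ((1 + ‖x‖) ^ k)⁻¹ := by
  have h := SchwartzMap.one_add_le_sup_seminorm_apply (𝕜 := ℝ) (m := (k, 0)) le_rfl le_rfl ψ
  set A := 2 ^ k * (Finset.Iic (k, 0)).sup (fun m => SchwartzMap.seminorm ℝ m.1 m.2) ψ with hA
  have hA0 : 0 ≤ A := by positivity
  refine ⟨A + 1, by linarith, fun x => ?_⟩
  have h1 := h x
  rw [norm_iteratedFDeriv_zero] at h1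
  rw [← div_eq_mul_inv, le_div_iff₀ (by positivity), mul_comm]
  linarith

theorem integrable_inv_one_add_norm_pow {k : ℕ} (hk : 4 ≤ k) :
    Integrable fun x : Plane => ((1 + ‖x‖) ^ k)⁻¹ := by
  have h := integrable_one_add_norm (E := Plane) (μ := volume) (r := k) (by
    simp only [finrank_euclideanSpace, Fintype.card_fin]
    have : (4 : ℝ) ≤ k := by exact_mod_cast hk
    push_cast
    linarith)
  refine h.congr (Filter.Eventually.of_forall fun t => ?_)
  dsimp only
  rw [Real.rpow_neg (by positivity), Real.rpow_natCast]

theorem integrable_schwartz_mul_pow (ψ : SchwartzMap Plane ℂ) (k : ℕ) :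
    Integrable fun x => ‖ψ x‖ * (1 + ‖x‖) ^ k := by
  obtain ⟨C, hC, h⟩ := exists_schwartz_decay ψ (k + 4)
  refine ((integrable_inv_one_add_norm_pow le_rfl).const_mul C).mono'
    (by have := ψ.continuous; fun_prop) (Filter.Eventually.of_forall fun x => ?_)
  rw [Real.norm_of_nonneg (by positivity)]
  calc ‖ψ x‖ * (1 + ‖x‖) ^ k ≤ C * ((1 + ‖x‖) ^ (k + 4))⁻¹ * (1 + ‖x‖) ^ k := by
        gcongr; exact h x
    _ = C * ((1 + ‖x‖) ^ 4)⁻¹ := by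
        rw [pow_add]; field_simp

/-- A nonnegative Schwartz function, not identically zero, whose Fourier transform is supported in
the unit ball. -/
theorem exists_nonneg_bandlimited : ∃ (θ : SchwartzMap Plane ℂ) (ρ : Plane → ℝ),
    (∀ x, θ x = ρ x) ∧ (∀ x, 0 ≤ ρ x) ∧ 0 < ρ 0 ∧ ∀ ξ, 1 ≤ ‖ξ‖ → 𝓕 θ ξ = 0 := by
  let b₀ : ContDiffBump (0 : Plane) := ⟨1 / 4, 1 / 2, by norm_num, by norm_num⟩
  have hcs : HasCompactSupport fun x : Plane => (b₀ x : ℂ) :=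
    b₀.hasCompactSupport.comp_left (g := fun t : ℝ => (t : ℂ)) (by simp)
  have hcd : ContDiff ℝ (⊤ : ℕ∞) fun x : Plane => (b₀ x : ℂ) :=
    Complex.ofRealCLM.contDiff.comp b₀.contDiff
  let b : SchwartzMap Plane ℂ := hcs.toSchwartzMap hcd
  have hb : ∀ x, b x = (b₀ x : ℂ) := fun x => rfl
  -- The bump is even and real, so its transform is real, and the transform of its self-convolution
  -- is a square, hence nonnegative.
  have hreal : ∀ x, (starRingEnd ℂ) (𝓕 b x) = 𝓕 b x := by
    intro x
    rw [SchwartzMap.fourier_coe, Real.fourier_eq', ← integral_conj, ← integral_neg_eq_self]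
    congr 1
    ext v
    rw [hb, hb, b₀.neg, smul_eq_mul, smul_eq_mul, map_mul, Complex.conj_ofReal, ← Complex.exp_conj,
      map_mul, Complex.conj_ofReal, Complex.conj_I, inner_neg_left]
    congr 2
    push_cast
    ring
  let B := SchwartzMap.convolution (ContinuousLinearMap.mul ℂ ℂ) b b
  have hB : ∀ x, 𝓕 B x = 𝓕 b x * 𝓕 b x := fun x => by
    simp [B, SchwartzMap.fourier_convolution]
  refine ⟨𝓕 B, fun x => (𝓕 b x).re ^ 2, fun x => ?_, fun x => by positivity, ?_, fun ξ hξ => ?_⟩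
  · rw [hB]
    have h1 := Complex.conj_eq_iff_re.1 (hreal x)
    rw [Complex.ofReal_pow, h1, sq]
  · have h1 : 𝓕 b 0 = ((∫ x, b₀ x : ℝ) : ℂ) := by
      rw [SchwartzMap.fourier_coe, Real.fourier_eq', ← integral_complex_ofReal]
      congr 1
      ext v
      simp [hb]
    dsimp only
    rw [h1, Complex.ofReal_re]
    have := b₀.integral_pos (μ := volume)
    positivity
  -- Fourier inversion returns the self-convolution, supported in the sum of two balls of radius
  -- 1/2.
  · have h1 : 𝓕 (𝓕 B) ξ = B (-ξ) := by
      have h2 : 𝓕⁻ (𝓕 B) (-ξ) = B (-ξ) := by rw [FourierTransform.fourierInv_fourier_eq]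
      rw [← h2, SchwartzMap.fourierInv_coe, Real.fourierInv_eq_fourier_neg, neg_neg,
        SchwartzMap.fourier_coe]
    rw [h1, SchwartzMap.convolution_apply]
    by_contra hne
    obtain ⟨y, hy, z, hz, hyz⟩ := Set.mem_add.1
      (support_convolution_subset (ContinuousLinearMap.mul ℂ ℂ) (Function.mem_support.2 hne))
    have hsupp : ∀ w ∈ Function.support (b : Plane → ℂ), ‖w‖ < 1 / 2 := by
      intro w hw
      have h3 : w ∈ Function.support b₀ := by
        simpa [hb] using hw
      rw [b₀.support_eq] at h3
      exact mem_ball_zero_iff.1 h3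
    have h4 := norm_add_le y z
    rw [hyz, norm_neg] at h4
    linarith [hsupp y hy, hsupp z hz]


/-- A slowly varying weight is comparable to a function with Fourier transform supported in the
unit ball. -/
theorem exists_bandlimited_weight (k : ℕ) : ∃ C : ℝ, 0 < C ∧ ∀ v : Plane → ℝ, Continuous v →
    Integrable v → (∀ x, 0 < v x) → (∀ x, v x ≤ 1) →
    (∀ x y, v (x + y) ≤ v x * (1 + ‖y‖) ^ k) →
    ∃ (η : Plane → ℝ) (κ : Plane → ℂ), Continuous κ ∧ Integrable κ ∧
      (∀ ξ, 1 ≤ ‖ξ‖ → κ ξ = 0) ∧ Integrable η ∧ Continuous η ∧ (∀ x, 𝓕⁻ κ x = η x) ∧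
      ∀ x, v x ≤ C * η x ∧ η x ≤ C * v x := by
  obtain ⟨θ, ρ, hθρ, hρ, hρ0, hθ⟩ := exists_nonneg_bandlimited
  have hnorm : ∀ x, ‖θ x‖ = ρ x := fun x => by
    rw [hθρ, Complex.norm_real, Real.norm_of_nonneg (hρ x)]
  have hρc : Continuous ρ := by
    have : ρ = fun x => ‖θ x‖ := funext fun x => (hnorm x).symm
    rw [this]; exact θ.continuous.norm
  have hi1 : Integrable fun y => ρ y * (1 + ‖y‖) ^ k := by
    simpa only [hnorm] using integrable_schwartz_mul_pow θ k
  have hi0 : Integrable ρ := by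
    simpa only [hnorm, pow_zero, mul_one] using integrable_schwartz_mul_pow θ 0
  have hi2 : Integrable fun y => ρ y * ((1 + ‖y‖) ^ k)⁻¹ := by
    refine hi0.mono' (Continuous.aestronglyMeasurable
      (hρc.mul (Continuous.inv₀ (by fun_prop) fun y => by positivity)))
      (Filter.Eventually.of_forall fun y => ?_)
    rw [Real.norm_of_nonneg (mul_nonneg (hρ y) (by positivity))]
    exact mul_le_of_le_one_right (hρ y)
      (inv_le_one_of_one_le₀ (one_le_pow₀ (by linarith [norm_nonneg y])))
  -- Slow variation of v, used at x - y and at x, gives c₁ v ≤ ρ * v ≤ c₂ v; c₁ > 0 because ρ is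
  -- continuous and ρ 0 > 0.
  set c₁ := ∫ y, ρ y * ((1 + ‖y‖) ^ k)⁻¹ with hc₁
  set c₂ := ∫ y, ρ y * (1 + ‖y‖) ^ k with hc₂
  have hc₁pos : 0 < c₁ := by
    have hcont : Continuous fun y : Plane => ρ y * ((1 + ‖y‖) ^ k)⁻¹ :=
      hρc.mul (Continuous.inv₀ (by fun_prop) fun y => by positivity)
    refine (integral_pos_iff_support_of_nonneg
      (fun y => mul_nonneg (hρ y) (by positivity)) hi2).2 ?_
    refine (hcont.isOpen_support).measure_pos _ ⟨0, ?_⟩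
    simp [hρ0.ne']
  have hc₂0 : 0 ≤ c₂ := integral_nonneg fun y => mul_nonneg (hρ y) (by positivity)
  refine ⟨c₁⁻¹ + c₂, by positivity, fun v hvc hvi hv0 hv1 hv => ?_⟩
  let vc : Plane → ℂ := fun x => (v x : ℂ)
  have hvci : Integrable vc := hvi.ofReal
  have hbdd : BddAbove (range fun x => ‖vc x‖) := by
    refine ⟨1, ?_⟩
    rintro _ ⟨x, rfl⟩
    simp only [vc, Complex.norm_real, Real.norm_of_nonneg (hv0 x).le]
    exact hv1 x
  let E : Plane → ℂ := (θ : Plane → ℂ) ⋆[ContinuousLinearMap.mul ℂ ℂ] vc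
  have hEc : Continuous E := BddAbove.continuous_convolution_right_of_integrable
    (ContinuousLinearMap.mul ℂ ℂ) hbdd θ.integrable (Complex.continuous_ofReal.comp hvc)
  have hEi : Integrable E := θ.integrable.integrable_convolution _ hvci
  let η : Plane → ℝ := fun x => ∫ y, ρ y * v (x - y)
  have hEη : ∀ x, E x = η x := by
    intro x
    simp only [E, η]
    rw [convolution_def, ← integral_complex_ofReal]
    congr 1
    ext y
    simp [vc, hθρ]
  have hFE : ∀ ξ, 𝓕 E ξ = 𝓕 θ ξ * 𝓕 vc ξ := fun ξ => by
    rw [SchwartzMap.fourier_coe]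
    exact Real.fourier_mul_convolution_eq θ.integrable hvci ξ
  have hFvc : Continuous (𝓕 vc) := VectorFourier.fourierIntegral_continuous Real.continuous_fourierChar
    (by exact continuous_inner) hvci
  have hFEc : Continuous (𝓕 E) := VectorFourier.fourierIntegral_continuous Real.continuous_fourierChar
    (by exact continuous_inner) hEi
  have hFEi : Integrable (𝓕 E) := by
    have h1 : 𝓕 E = fun ξ => 𝓕 θ ξ * 𝓕 vc ξ := funext hFE
    rw [h1]
    refine (𝓕 θ).integrable.mul_bdd (c := ∫ x, ‖vc x‖) hFvc.aestronglyMeasurable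
      (Filter.Eventually.of_forall fun ξ => ?_)
    exact VectorFourier.norm_fourierIntegral_le_integral_norm _ _ _ _ _
  have hprod : ∀ x, Integrable fun y => ρ y * v (x - y) := fun x => by
    refine hi0.mul_bdd (c := 1) (by fun_prop) (Filter.Eventually.of_forall fun y => ?_)
    rw [Real.norm_of_nonneg (hv0 _).le]
    exact hv1 _
  have hη0 : ∀ x, 0 ≤ η x := fun x => integral_nonneg fun y => mul_nonneg (hρ y) (hv0 _).le
  refine ⟨η, 𝓕 E, hFEc, hFEi, fun ξ hξ => by rw [hFE, hθ ξ hξ, zero_mul], ?_, ?_, fun x => ?_,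
    fun x => ⟨?_, ?_⟩⟩
  · have : Integrable fun x => (E x).re := hEi.re
    simpa only [hEη, Complex.ofReal_re] using this
  · have : Continuous fun x => (E x).re := Complex.continuous_re.comp hEc
    simpa only [hEη, Complex.ofReal_re] using this
  · rw [Continuous.fourierInv_fourier_eq hEc hEi hFEi, hEη]
  · have h1 : v x * c₁ ≤ η x := by
      rw [hc₁, ← integral_const_mul]
      refine integral_mono (hi2.const_mul _) (hprod x) fun y => ?_
      have h2 := hv (x - y) y
      rw [sub_add_cancel] at h2
      dsimp only
      rw [mul_left_comm]
      refine mul_le_mul_of_nonneg_left ?_ (hρ y)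
      rw [← div_eq_mul_inv, div_le_iff₀ (by positivity)]
      exact h2
    have h3 : v x ≤ c₁⁻¹ * η x := by
      rw [← div_eq_inv_mul, le_div_iff₀ hc₁pos]; exact h1
    have h4 : 0 ≤ c₂ * η x := mul_nonneg hc₂0 (hη0 x)
    linarith
  · have h1 : η x ≤ v x * c₂ := by
      rw [hc₂, ← integral_const_mul]
      refine integral_mono (hprod x) (hi1.const_mul _) fun y => ?_
      have h2 := hv x (-y)
      rw [norm_neg, ← sub_eq_add_neg] at h2
      dsimp only
      rw [mul_left_comm]
      exact mul_le_mul_of_nonneg_left h2 (hρ y)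
    have h3 : 0 ≤ c₁⁻¹ * v x := mul_nonneg (by positivity) (hv0 x).le
    linarith

theorem fourierInv_rescale (κ : Plane → ℂ) (c : Plane) {L : ℝ} (hL : 0 < L) (x : Plane) :
    𝓕⁻ (fun ξ => ((L : ℂ) ^ 2 * ((𝐞 (-inner ℝ ξ c) : Circle) : ℂ)) * κ (L • ξ)) x =
      𝓕⁻ κ (L⁻¹ • (x - c)) := by
  rw [Real.fourierInv_eq, Real.fourierInv_eq]
  have h := Measure.integral_comp_smul (volume : Measure Plane)
    (fun ζ => (𝐞 (inner ℝ ζ (L⁻¹ • (x - c)))) • κ ζ) L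
  rw [finrank_euclideanSpace, Fintype.card_fin, abs_of_pos (by positivity)] at h
  have h2 : ∫ ζ, (𝐞 (inner ℝ ζ (L⁻¹ • (x - c)))) • κ ζ =
      (L ^ 2) • ∫ ζ, (𝐞 (inner ℝ (L • ζ) (L⁻¹ • (x - c)))) • κ (L • ζ) := by
    rw [h, smul_smul, mul_inv_cancel₀ (by positivity), one_smul]
  rw [h2, ← integral_smul]
  congr 1
  ext ξ
  rw [inner_smul_left, inner_smul_right, inner_sub_right]
  simp only [conj_trivial]
  rw [← mul_assoc, mul_inv_cancel₀ hL.ne', one_mul, sub_eq_add_neg, AddChar.map_add_eq_mul]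
  simp only [Circle.smul_def, smul_eq_mul, Circle.coe_mul, Complex.real_smul]
  push_cast
  ring

theorem exists_bandlimited_weight_scaled (k : ℕ) : ∃ C : ℝ, 0 < C ∧ ∀ v : Plane → ℝ,
    Continuous v → Integrable v → (∀ x, 0 < v x) → (∀ x, v x ≤ 1) →
    (∀ x y, v (x + y) ≤ v x * (1 + ‖y‖) ^ k) → ∀ (c : Plane) (L : ℝ), 0 < L →
    ∃ (η : Plane → ℝ) (κ : Plane → ℂ), Continuous κ ∧ Integrable κ ∧
      (∀ ξ, L⁻¹ ≤ ‖ξ‖ → κ ξ = 0) ∧ Integrable η ∧ Continuous η ∧ (∀ x, 𝓕⁻ κ x = η x) ∧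
      ∀ x, v (L⁻¹ • (x - c)) ≤ C * η x ∧ η x ≤ C * v (L⁻¹ • (x - c)) := by
  obtain ⟨C, hC, h⟩ := exists_bandlimited_weight k
  refine ⟨C, hC, fun v hvc hvi hv0 hv1 hv c L hL => ?_⟩
  obtain ⟨η, κ, h1, h2, h3, h4, h5, h6, h7⟩ := h v hvc hvi hv0 hv1 hv
  have hchar : Continuous fun ξ : Plane => (L : ℂ) ^ 2 * ((𝐞 (-inner ℝ ξ c) : Circle) : ℂ) := by
    have := Real.continuous_fourierChar
    fun_prop
  refine ⟨fun x => η (L⁻¹ • (x - c)),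
    fun ξ => ((L : ℂ) ^ 2 * ((𝐞 (-inner ℝ ξ c) : Circle) : ℂ)) * κ (L • ξ), ?_, ?_, fun ξ hξ => ?_, ?_, ?_,
    fun x => ?_, fun x => h7 _⟩
  · exact hchar.mul (h1.comp (by fun_prop))
  · refine (h2.comp_smul hL.ne').bdd_mul (c := L ^ 2) hchar.aestronglyMeasurable
      (Filter.Eventually.of_forall fun ξ => ?_)
    rw [norm_mul, norm_pow, Complex.norm_real, Real.norm_of_nonneg hL.le]
    exact (mul_one _).le.trans' (mul_le_mul_of_nonneg_left (Circle.norm_coe _).le (by positivity))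
  · dsimp only
    rw [h3, mul_zero]
    rw [norm_smul, Real.norm_of_nonneg hL.le]
    rwa [inv_le_iff_one_le_mul₀' hL] at hξ
  · exact (h4.comp_smul (inv_ne_zero hL.ne')).comp_sub_right c
  · exact h5.comp (by fun_prop)
  · rw [fourierInv_rescale _ _ hL, h6]

/-! ### The inverse Fourier transform of integrable functions -/

theorem continuous_fourierInv {f : Plane → ℂ} (hf : Integrable f) : Continuous (𝓕⁻ f) :=
  VectorFourier.fourierIntegral_continuous Real.continuous_fourierChar
    (by
      change Continuous fun p : Plane × Plane => -inner ℝ p.1 p.2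
      exact continuous_inner.neg) hf

theorem norm_fourierInv_le {f : Plane → ℂ} (x : Plane) : ‖𝓕⁻ f x‖ ≤ ∫ ξ, ‖f ξ‖ :=
  VectorFourier.norm_fourierIntegral_le_integral_norm _ _ _ _ _

theorem fourierInv_finset_sum {ι : Type*} (s : Finset ι) {g : ι → Plane → ℂ}
    (hg : ∀ j ∈ s, Integrable (g j)) (x : Plane) :
    𝓕⁻ (fun ξ => ∑ j ∈ s, g j ξ) x = ∑ j ∈ s, 𝓕⁻ (g j) x := by
  simp_rw [Real.fourierInv_eq, Finset.smul_sum]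
  refine integral_finsetSum _ fun j hj => ?_
  have h := (Real.fourierIntegral_convergent_iff (-x)).2 (hg j hj)
  simpa using h

theorem fourierInv_convolution {f κ : Plane → ℂ} (hf : Integrable f) (hκ : Integrable κ)
    (x : Plane) :
    𝓕⁻ (f ⋆[ContinuousLinearMap.mul ℂ ℂ] κ) x = 𝓕⁻ f x * 𝓕⁻ κ x := by
  simp_rw [Real.fourierInv_eq_fourier_neg]
  exact Real.fourier_mul_convolution_eq hf hκ (-x)

/-- Parseval by Fubini, for functions that are only integrable; nothing is assumed to be in L². -/
theorem integral_conj_fourierInv_mul {f H : Plane → ℂ} (hf : Integrable f) (hH : Integrable H) :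
    ∫ x, (starRingEnd ℂ) (𝓕⁻ f x) * H x = ∫ ξ, (starRingEnd ℂ) (f ξ) * 𝓕 H ξ := by
  have h := VectorFourier.integral_sesq_fourierIntegral_eq_neg_flip (μ := volume) (ν := volume)
    (e := Real.fourierChar) (L := -innerₗ Plane) (f := f) (g := H) (innerSL ℂ)
    Real.continuous_fourierChar
    (by
      change Continuous fun p : Plane × Plane => -inner ℝ p.1 p.2
      exact continuous_inner.neg) hf hH
  have e1 : -(-innerₗ Plane).flip = innerₗ Plane := by
    ext x y
    simp [real_inner_comm]
  rw [e1] at h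
  simp only [innerSL_apply_apply, RCLike.inner_apply'] at h
  exact h

/-! ### Almost orthogonality with respect to a weight -/

theorem hasCompactSupport_of_norm {κ : Plane → ℂ} {r : ℝ} (hκ : ∀ ξ, r ≤ ‖ξ‖ → κ ξ = 0) :
    HasCompactSupport κ := by
  refine HasCompactSupport.intro (isCompact_closedBall (0 : Plane) r) fun ξ hξ => hκ ξ ?_
  simp only [Metric.mem_closedBall, dist_zero_right, not_le] at hξ
  exact hξ.le

theorem integrable_fourierInv_mul {f : Plane → ℂ} (hf : Integrable f) {E : Plane → ℂ}
    (hE : Integrable E) : Integrable fun x => 𝓕⁻ f x * E x :=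
  hE.bdd_mul (continuous_fourierInv hf).aestronglyMeasurable
    (Filter.Eventually.of_forall fun x => norm_fourierInv_le x)

/-- Multiplication by 𝓕⁻ κ convolves g with κ, which spreads its support by less than r. The result
is still disjoint from the support of f, and Parseval gives zero. -/
theorem integral_conj_mul_eq_zero {f g κ : Plane → ℂ} (hf : Integrable f) (hg : Integrable g)
    {r : ℝ} (hκc : Continuous κ) (hκi : Integrable κ) (hκ : ∀ ξ, r ≤ ‖ξ‖ → κ ξ = 0)
    (hE : Integrable (𝓕⁻ κ)) (hfg : ∀ ξ ζ, f ξ ≠ 0 → g ζ ≠ 0 → r ≤ ‖ξ - ζ‖) :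
    ∫ x, (starRingEnd ℂ) (𝓕⁻ f x) * (𝓕⁻ g x * 𝓕⁻ κ x) = 0 := by
  set h := g ⋆[ContinuousLinearMap.mul ℂ ℂ] κ with hh
  have hhi : Integrable h := hg.integrable_convolution _ hκi
  have hhc : Continuous h := (hasCompactSupport_of_norm hκ).continuous_convolution_right _
    hg.locallyIntegrable hκc
  have hH : 𝓕⁻ h = fun x => 𝓕⁻ g x * 𝓕⁻ κ x := funext fun x => fourierInv_convolution hg hκi x
  have hHi : Integrable (𝓕⁻ h) := by rw [hH]; exact integrable_fourierInv_mul hg hE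
  have hFh : Integrable (𝓕 h) := by
    have h1 : 𝓕 h = fun x => 𝓕⁻ h (-x) := funext fun x => by
      rw [Real.fourierInv_eq_fourier_neg, neg_neg]
    rw [h1]
    exact hHi.comp_neg
  rw [show (fun x => (starRingEnd ℂ) (𝓕⁻ f x) * (𝓕⁻ g x * 𝓕⁻ κ x)) =
    fun x => (starRingEnd ℂ) (𝓕⁻ f x) * 𝓕⁻ h x by rw [hH],
    integral_conj_fourierInv_mul hf hHi, Continuous.fourier_fourierInv_eq hhc hhi hFh]
  refine integral_eq_zero_of_ae (Filter.Eventually.of_forall fun ξ => ?_)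
  by_contra hne
  have hne' := mul_ne_zero_iff.1 hne
  obtain ⟨y, hy, z, hz, hyz⟩ := Set.mem_add.1
    (support_convolution_subset (ContinuousLinearMap.mul ℂ ℂ) (Function.mem_support.2 hne'.2))
  refine hz (hκ z ?_)
  have h1 := hfg ξ y (by simpa using hne'.1) hy
  rwa [← hyz, add_sub_cancel_left] at h1

theorem integral_normSq_sum_eq {ι : Type*} (s : Finset ι) {g : ι → Plane → ℂ} {κ : Plane → ℂ}
    {η : Plane → ℝ} {r : ℝ} (hg : ∀ j ∈ s, Integrable (g j)) (hκc : Continuous κ)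
    (hκi : Integrable κ) (hκ : ∀ ξ, r ≤ ‖ξ‖ → κ ξ = 0) (hη : Integrable η)
    (hκη : ∀ x, 𝓕⁻ κ x = η x)
    (hsep : ∀ i ∈ s, ∀ j ∈ s, i ≠ j → ∀ ξ ζ, g i ξ ≠ 0 → g j ζ ≠ 0 → r ≤ ‖ξ - ζ‖) :
    ∫ x, ‖∑ j ∈ s, 𝓕⁻ (g j) x‖ ^ 2 * η x = ∑ j ∈ s, ∫ x, ‖𝓕⁻ (g j) x‖ ^ 2 * η x := by
  have hE : Integrable (𝓕⁻ κ) := by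
    rw [show 𝓕⁻ κ = fun x => (η x : ℂ) from funext hκη]; exact hη.ofReal
  have hsq : ∀ z : ℂ, ∀ t : ℝ, ((‖z‖ ^ 2 * t : ℝ) : ℂ) = (starRingEnd ℂ) z * (z * t) := by
    intro z t
    rw [← mul_assoc, Complex.conj_mul']
    push_cast
    rfl
  have hint : ∀ i ∈ s, ∀ j ∈ s,
      Integrable fun x => (starRingEnd ℂ) (𝓕⁻ (g i) x) * (𝓕⁻ (g j) x * 𝓕⁻ κ x) := by
    intro i hi j hj
    refine (integrable_fourierInv_mul (hg j hj) hE).bdd_mul (c := ∫ ξ, ‖g i ξ‖)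
      (Complex.continuous_conj.comp (continuous_fourierInv (hg i hi))).aestronglyMeasurable
      (Filter.Eventually.of_forall fun x => ?_)
    rw [RCLike.norm_conj]
    exact norm_fourierInv_le x
  have key : ∫ x, (starRingEnd ℂ) (∑ i ∈ s, 𝓕⁻ (g i) x) * ((∑ j ∈ s, 𝓕⁻ (g j) x) * 𝓕⁻ κ x) =
      ∑ j ∈ s, ∫ x, (starRingEnd ℂ) (𝓕⁻ (g j) x) * (𝓕⁻ (g j) x * 𝓕⁻ κ x) := by
    simp_rw [map_sum, Finset.sum_mul, Finset.mul_sum]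
    rw [integral_finsetSum _ fun i hi => integrable_finsetSum _ fun j hj => hint i hi j hj]
    refine Finset.sum_congr rfl fun i hi => ?_
    rw [integral_finsetSum _ fun j hj => hint i hi j hj]
    refine Finset.sum_eq_single i (fun j hj hji => ?_) (fun h => absurd hi h)
    exact integral_conj_mul_eq_zero (hg i hi) (hg j hj) hκc hκi hκ hE
      (hsep i hi j hj (Ne.symm hji))
  have e : ∀ G : Plane → ℂ, ((∫ x, ‖G x‖ ^ 2 * η x : ℝ) : ℂ) =
      ∫ x, (starRingEnd ℂ) (G x) * (G x * 𝓕⁻ κ x) := by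
    intro G
    rw [← integral_complex_ofReal]
    simp_rw [hsq, hκη]
  apply Complex.ofReal_injective
  rw [e, key, Complex.ofReal_sum]
  exact Finset.sum_congr rfl fun j _ => (e _).symm

/-- Almost orthogonality in weighted `L²` for functions with Fourier supports in consecutive
pieces, where nonadjacent pieces are separated by the inverse of the side length. -/
theorem exists_weighted_orthogonality : ∃ C : ℝ≥0, ∀ (N : ℕ) (g : ℕ → Plane → ℂ) (c : Plane)
    (L : ℝ), 0 < L → (∀ j, Integrable (g j)) →
    (∀ i j, i + 2 ≤ j → ∀ ξ ζ, g i ξ ≠ 0 → g j ζ ≠ 0 → L⁻¹ ≤ ‖ξ - ζ‖) →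
    ∫⁻ x, ‖∑ j ∈ Finset.range N, 𝓕⁻ (g j) x‖ₑ ^ 2 ∂weightMeasure c L ≤
      C * ∑ j ∈ Finset.range N, ∫⁻ x, ‖𝓕⁻ (g j) x‖ₑ ^ 2 ∂weightMeasure c L := by
  obtain ⟨C, hC, hw⟩ := exists_bandlimited_weight_scaled 200
  refine ⟨(2 * (C * C)).toNNReal, fun N g c L hL hg hsep => ?_⟩
  have hvc : Continuous fun x : Plane => ((1 + ‖x‖) ^ 200)⁻¹ :=
    Continuous.inv₀ (by fun_prop) fun x => by positivity
  obtain ⟨η, κ, hκc, hκi, hκ, hηi, hηc, hκη, hcomp⟩ := hw (fun x => ((1 + ‖x‖) ^ 200)⁻¹) hvc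
    (integrable_inv_one_add_norm_pow (by norm_num)) (fun x => by positivity)
    (fun x => inv_le_one_of_one_le₀ (one_le_pow₀ (by linarith [norm_nonneg x])))
    (fun x y => by
      rw [inv_mul_eq_div, inv_eq_one_div, div_le_div_iff₀ (by positivity) (by positivity), one_mul,
        ← mul_pow]
      gcongr
      rw [mul_comm]
      exact one_add_norm_le_mul_add x y) c L hL
  have hcomp' : ∀ x, weight c L x ≤ C * η x ∧ η x ≤ C * weight c L x := by
    intro x
    have e : ‖x - c‖ / L = ‖L⁻¹ • (x - c)‖ := by
      rw [norm_smul, norm_inv, Real.norm_of_nonneg hL.le, div_eq_inv_mul]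
    rw [weight_eq, e]
    exact hcomp x
  have hη0 : ∀ x, 0 ≤ η x := fun x =>
    (pos_of_mul_pos_right ((weight_pos c hL x).trans_le (hcomp' x).1) hC.le).le
  have hGc : ∀ j, Continuous (𝓕⁻ (g j)) := fun j => continuous_fourierInv (hg j)
  have hbd : ∀ (s : Finset ℕ), Integrable fun x => ‖∑ j ∈ s, 𝓕⁻ (g j) x‖ ^ 2 * η x := by
    intro s
    have hcont : Continuous fun x => ‖∑ j ∈ s, 𝓕⁻ (g j) x‖ ^ 2 := by fun_prop
    refine hηi.bdd_mul (c := (∑ j ∈ s, ∫ ξ, ‖g j ξ‖) ^ 2) hcont.aestronglyMeasurable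
      (Filter.Eventually.of_forall fun x => ?_)
    rw [norm_pow, norm_norm]
    gcongr
    exact (norm_sum_le _ _).trans (Finset.sum_le_sum fun j _ => norm_fourierInv_le x)
  have horth : ∀ s : Finset ℕ, (∀ i ∈ s, ∀ j ∈ s, i < j → i + 2 ≤ j) →
      ∫ x, ‖∑ j ∈ s, 𝓕⁻ (g j) x‖ ^ 2 * η x = ∑ j ∈ s, ∫ x, ‖𝓕⁻ (g j) x‖ ^ 2 * η x := by
    intro s hs
    refine integral_normSq_sum_eq s (fun j _ => hg j) hκc hκi hκ hηi hκη
      fun i hi j hj hij ξ ζ hξ hζ => ?_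
    rcases lt_or_gt_of_ne hij with h | h
    · exact hsep i j (hs i hi j hj h) ξ ζ hξ hζ
    · rw [norm_sub_rev]
      exact hsep j i (hs j hj i hi h) ζ ξ hζ hξ
  -- Adjacent pieces are not separated, so even and odd indices are treated apart; the 2 is from (a
  -- + b)² ≤ 2 (a² + b²).
  have hreal : ∫ x, ‖∑ j ∈ Finset.range N, 𝓕⁻ (g j) x‖ ^ 2 * η x ≤
      2 * ∑ j ∈ Finset.range N, ∫ x, ‖𝓕⁻ (g j) x‖ ^ 2 * η x := by
    set s₀ := (Finset.range N).filter Even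
    set s₁ := (Finset.range N).filter fun j => ¬ Even j
    have hs₀ : ∀ i ∈ s₀, ∀ j ∈ s₀, i < j → i + 2 ≤ j := by
      intro i hi j hj hij
      obtain ⟨a, ha⟩ := (Finset.mem_filter.1 hi).2
      obtain ⟨b, hb⟩ := (Finset.mem_filter.1 hj).2
      omega
    have hs₁ : ∀ i ∈ s₁, ∀ j ∈ s₁, i < j → i + 2 ≤ j := by
      intro i hi j hj hij
      obtain ⟨a, ha⟩ := Nat.not_even_iff_odd.1 (Finset.mem_filter.1 hi).2
      obtain ⟨b, hb⟩ := Nat.not_even_iff_odd.1 (Finset.mem_filter.1 hj).2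
      omega
    have hsplit : ∀ φ : ℕ → ℝ, ∑ j ∈ s₀, φ j + ∑ j ∈ s₁, φ j = ∑ j ∈ Finset.range N, φ j :=
      fun φ => Finset.sum_filter_add_sum_filter_not _ _ _
    rw [← hsplit, ← horth s₀ hs₀, ← horth s₁ hs₁, ← integral_add (hbd s₀) (hbd s₁),
      ← integral_const_mul]
    refine integral_mono (hbd _) (((hbd s₀).add (hbd s₁)).const_mul 2) fun x => ?_
    have h1 : ∑ j ∈ Finset.range N, 𝓕⁻ (g j) x =
        ∑ j ∈ s₀, 𝓕⁻ (g j) x + ∑ j ∈ s₁, 𝓕⁻ (g j) x :=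
      (Finset.sum_filter_add_sum_filter_not _ _ _).symm
    dsimp only
    rw [h1, ← add_mul, ← mul_assoc]
    refine mul_le_mul_of_nonneg_right ?_ (hη0 x)
    have h2 := norm_add_le (∑ j ∈ s₀, 𝓕⁻ (g j) x) (∑ j ∈ s₁, 𝓕⁻ (g j) x)
    have h3 : ‖∑ j ∈ s₀, 𝓕⁻ (g j) x + ∑ j ∈ s₁, 𝓕⁻ (g j) x‖ ^ 2 ≤
        (‖∑ j ∈ s₀, 𝓕⁻ (g j) x‖ + ‖∑ j ∈ s₁, 𝓕⁻ (g j) x‖) ^ 2 := by gcongr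
    nlinarith [sq_nonneg (‖∑ j ∈ s₀, 𝓕⁻ (g j) x‖ - ‖∑ j ∈ s₁, 𝓕⁻ (g j) x‖)]
  have hen : ∀ (z : ℂ) (t : ℝ), 0 ≤ t → ENNReal.ofReal t * ‖z‖ₑ ^ 2 = ENNReal.ofReal (‖z‖ ^ 2 * t) := by
    intro z t ht
    rw [mul_comm, ENNReal.ofReal_mul (by positivity), ENNReal.ofReal_pow (norm_nonneg _),
      ofReal_norm]
  have hup : ∀ s : Finset ℕ, ∫⁻ x, ENNReal.ofReal (weight c L x) * ‖∑ j ∈ s, 𝓕⁻ (g j) x‖ₑ ^ 2 ≤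
      ENNReal.ofReal (C * ∫ x, ‖∑ j ∈ s, 𝓕⁻ (g j) x‖ ^ 2 * η x) := by
    intro s
    rw [← integral_const_mul, ofReal_integral_eq_lintegral_ofReal ((hbd s).const_mul C)
      (Filter.Eventually.of_forall fun x => by have := hη0 x; positivity)]
    refine lintegral_mono fun x => ?_
    rw [hen _ _ (weight_pos c hL x).le]
    refine ENNReal.ofReal_le_ofReal ?_
    rw [mul_left_comm]
    exact mul_le_mul_of_nonneg_left (hcomp' x).1 (by positivity)
  have hlow : ∀ j, ENNReal.ofReal (∫ x, ‖𝓕⁻ (g j) x‖ ^ 2 * η x) ≤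
      ENNReal.ofReal C * ∫⁻ x, ENNReal.ofReal (weight c L x) * ‖𝓕⁻ (g j) x‖ₑ ^ 2 := by
    intro j
    have h1 := hbd {j}
    simp only [Finset.sum_singleton] at h1
    rw [ofReal_integral_eq_lintegral_ofReal h1
      (Filter.Eventually.of_forall fun x => by have := hη0 x; positivity),
      ← lintegral_const_mul' _ _ ENNReal.ofReal_ne_top]
    refine lintegral_mono fun x => ?_
    rw [hen _ _ (weight_pos c hL x).le, ← ENNReal.ofReal_mul hC.le]
    refine ENNReal.ofReal_le_ofReal ?_
    rw [mul_left_comm]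
    exact mul_le_mul_of_nonneg_left (hcomp' x).2 (by positivity)
  have hpos : ∀ j, 0 ≤ ∫ x, ‖𝓕⁻ (g j) x‖ ^ 2 * η x := fun j =>
    integral_nonneg fun x => mul_nonneg (by positivity) (hη0 x)
  simp_rw [lintegral_weightMeasure c hL, ← Finset.mul_sum]
  rw [mul_left_comm]
  gcongr
  calc _ ≤ ENNReal.ofReal (C * ∫ x, ‖∑ j ∈ Finset.range N, 𝓕⁻ (g j) x‖ ^ 2 * η x) := hup _
    _ ≤ ENNReal.ofReal (C * (2 * ∑ j ∈ Finset.range N, ∫ x, ‖𝓕⁻ (g j) x‖ ^ 2 * η x)) := by gcongr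
    _ = ENNReal.ofReal (C * 2) *
          ∑ j ∈ Finset.range N, ENNReal.ofReal (∫ x, ‖𝓕⁻ (g j) x‖ ^ 2 * η x) := by
        rw [← mul_assoc, ENNReal.ofReal_mul (by positivity),
          ENNReal.ofReal_sum_of_nonneg fun j _ => hpos j]
    _ ≤ ENNReal.ofReal (C * 2) * ∑ j ∈ Finset.range N,
          ENNReal.ofReal C * ∫⁻ x, ENNReal.ofReal (weight c L x) * ‖𝓕⁻ (g j) x‖ₑ ^ 2 := by
        gcongr with j _
        exact hlow j
    _ = _ := by
        rw [← Finset.mul_sum, ← mul_assoc, ← ENNReal.ofReal_mul (by positivity),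
          show C * 2 * C = 2 * (C * C) by ring]
        rfl

/-! ### Dyadic pieces -/

/-- The vertical strip over the half-open dyadic interval `[k 2^(-σ), (k+1) 2^(-σ))`. -/
def strip (σ k : ℕ) : Set Plane :=
  {ξ | (k : ℝ) / 2 ^ σ ≤ ξ 0 ∧ ξ 0 < ((k : ℝ) + 1) / 2 ^ σ}

theorem measurableSet_strip (σ k : ℕ) : MeasurableSet (strip σ k) := by
  have h : Measurable fun ξ : Plane => ξ 0 := by fun_prop
  exact h (measurableSet_Ico (a := (k : ℝ) / 2 ^ σ) (b := ((k : ℝ) + 1) / 2 ^ σ))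

theorem volume_vertical_line (t : ℝ) : volume {ξ : Plane | ξ 0 = t} = 0 := by
  have h1 : MeasurePreserving (fun z : Plane => ((z 0, z 1) : ℝ × ℝ)) :=
    (volume_preserving_finTwoArrow ℝ).comp (PiLp.volume_preserving_ofLp (Fin 2))
  have h2 := (Measure.quasiMeasurePreserving_fst (μ := (volume : Measure ℝ))
    (ν := (volume : Measure ℝ))).comp h1.quasiMeasurePreserving
  exact h2.preimage_null (Real.volume_singleton (a := t))

/-- Closed dyadic intervals overlap at endpoints, half-open ones partition exactly; the difference
is a null line. The projection sees only the almost everywhere class of the transform, which later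
permits changing it on a null set. -/
theorem fourierProj_eq_strip {f g : Plane → ℂ} (hfg : f =ᵐ[volume] g) (σ k : ℕ) :
    fourierProj (dyadicInterval σ k) f = 𝓕⁻ (indicator (strip σ k) g) := by
  refine funext fun x => Real.fourierInv_congr_ae ?_ x
  have h := volume_vertical_line (((k : ℝ) + 1) / 2 ^ σ)
  filter_upwards [hfg, (compl_mem_ae_iff.2 h)] with ξ h1 h2
  have h2' : ξ 0 ≠ ((k : ℝ) + 1) / 2 ^ σ := h2
  have h3 : ξ ∈ {ξ : Plane | ξ 0 ∈ dyadicInterval σ k} ↔ ξ ∈ strip σ k :=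
    ⟨fun h => ⟨h.1, lt_of_le_of_ne h.2 h2'⟩, fun h => ⟨h.1, h.2.le⟩⟩
  by_cases h4 : ξ ∈ strip σ k
  · rw [indicator_of_mem h4, indicator_of_mem (h3.2 h4), h1]
  · rw [indicator_of_notMem h4, indicator_of_notMem fun h => h4 (h3.1 h)]

theorem strip_index_unique {σ i j : ℕ} {ξ : Plane} (hi : ξ ∈ strip σ i) (hj : ξ ∈ strip σ j) :
    i = j := by
  have hp : (0 : ℝ) < 2 ^ σ := by positivity
  have h1 := hi.1.trans_lt hj.2
  have h2 := hj.1.trans_lt hi.2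
  rw [div_lt_div_iff_of_pos_right hp] at h1 h2
  have h1' : i < j + 1 := by exact_mod_cast h1
  have h2' : j < i + 1 := by exact_mod_cast h2
  omega

theorem indicator_strip_eq_sum (σ n k : ℕ) (g : Plane → ℂ) (ξ : Plane) :
    indicator (strip σ k) g ξ =
      ∑ j ∈ Finset.range (2 ^ n), indicator (strip (σ + n) (k * 2 ^ n + j)) g ξ := by
  have hp : (0 : ℝ) < 2 ^ σ := by positivity
  have hq : (0 : ℝ) < 2 ^ n := by positivity
  by_cases h : ξ ∈ strip σ k
  · rw [indicator_of_mem h]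
    have h1 : (k : ℝ) * 2 ^ n ≤ ξ 0 * 2 ^ (σ + n) := by
      have := (div_le_iff₀ hp).1 h.1
      rw [pow_add, ← mul_assoc]; gcongr
    have h2 : ξ 0 * 2 ^ (σ + n) < ((k : ℝ) + 1) * 2 ^ n := by
      have := (lt_div_iff₀ hp).1 h.2
      rw [pow_add, ← mul_assoc]; gcongr
    have h0 : 0 ≤ ξ 0 * 2 ^ (σ + n) := le_trans (by positivity) h1
    -- The index of the fine strip containing ξ is the integer part of ξ₀ 2^(σ+n).
    have h3 : k * 2 ^ n ≤ ⌊ξ 0 * 2 ^ (σ + n)⌋₊ := Nat.le_floor (by push_cast; exact h1)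
    have h4 : ⌊ξ 0 * 2 ^ (σ + n)⌋₊ < (k + 1) * 2 ^ n :=
      (Nat.floor_lt h0).2 (by push_cast; exact h2)
    rw [add_mul, one_mul] at h4
    obtain ⟨j, hj⟩ := Nat.exists_eq_add_of_le h3
    have hmem : ξ ∈ strip (σ + n) (k * 2 ^ n + j) := by
      rw [← hj]
      exact ⟨(div_le_iff₀ (by positivity)).2 (Nat.floor_le h0),
        (lt_div_iff₀ (by positivity)).2 (Nat.lt_floor_add_one _)⟩
    rw [Finset.sum_eq_single j, indicator_of_mem hmem]
    · intro i _ hij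
      refine indicator_of_notMem (fun hi => hij ?_) _
      have := strip_index_unique hi hmem
      omega
    · intro hj'
      refine absurd (Finset.mem_range.2 ?_) hj'
      omega
  · rw [indicator_of_notMem h, Finset.sum_eq_zero]
    intro j hj
    refine indicator_of_notMem (fun hmem => h ?_) _
    have hj' : (j : ℝ) + 1 ≤ 2 ^ n := by exact_mod_cast Finset.mem_range.1 hj
    have h1 := (div_le_iff₀ (by positivity)).1 hmem.1
    have h2 := (lt_div_iff₀ (by positivity)).1 hmem.2
    push_cast at h1 h2
    rw [pow_add, ← mul_assoc] at h1 h2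
    constructor
    · rw [div_le_iff₀ hp]
      have : (0 : ℝ) ≤ j := by positivity
      exact le_of_mul_le_mul_right (by linarith) hq
    · rw [lt_div_iff₀ hp]
      refine lt_of_mul_lt_mul_right (a := (2 : ℝ) ^ n) ?_ hq.le
      linarith

theorem fourierProj_eq_sum {f : Plane → ℂ} (hf : Integrable f) (σ n k : ℕ) (x : Plane) :
    fourierProj (dyadicInterval σ k) f x =
      ∑ j ∈ Finset.range (2 ^ n), fourierProj (dyadicInterval (σ + n) (k * 2 ^ n + j)) f x := by
  simp_rw [fourierProj_eq_strip (Filter.EventuallyEq.refl _ f)]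
  rw [← fourierInv_finset_sum _ fun j _ => hf.indicator (measurableSet_strip _ _)]
  exact congrArg (fun h : Plane → ℂ => 𝓕⁻ h x) (funext fun ξ => indicator_strip_eq_sum σ n k f ξ)

/-- Only an inequality: if I is shorter than 2^(-σ) the left side is empty while the right side need
not be. This is the direction used when intervals are refined. -/
theorem sum_dyadicParts_le (σ n : ℕ) (I : Set ℝ) (φ : ℕ → ℝ≥0∞) :
    ∑ k ∈ dyadicParts σ I, ∑ j ∈ Finset.range (2 ^ n), φ (k * 2 ^ n + j) ≤
      ∑ k ∈ dyadicParts (σ + n) I, φ k := by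
  classical
  have hinj : Set.InjOn (fun q : ℕ × ℕ => q.1 * 2 ^ n + q.2)
      (dyadicParts σ I ×ˢ Finset.range (2 ^ n) : Finset (ℕ × ℕ)) := by
    rintro ⟨k, j⟩ h ⟨k', j'⟩ h' heq
    simp only [Finset.coe_product, Set.mem_prod, Finset.mem_coe, Finset.mem_range] at h h' heq
    have e1 : k = k' := by
      have := congrArg (· / 2 ^ n) heq
      rwa [mul_comm k, mul_comm k', Nat.mul_add_div (by positivity),
        Nat.mul_add_div (by positivity), Nat.div_eq_of_lt h.2, Nat.div_eq_of_lt h'.2] at this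
    subst e1
    simpa using heq
  rw [← Finset.sum_product', ← Finset.sum_image (f := φ) hinj]
  refine Finset.sum_le_sum_of_subset fun i hi => ?_
  obtain ⟨⟨k, j⟩, hkj, rfl⟩ := Finset.mem_image.1 hi
  obtain ⟨hk, hj⟩ := Finset.mem_product.1 hkj
  obtain ⟨hk1, hk2⟩ := Finset.mem_filter.1 hk
  rw [Finset.mem_range] at hk1 hj
  refine Finset.mem_filter.2 ⟨Finset.mem_range.2 ?_, subset_trans ?_ hk2⟩
  · dsimp only at *
    calc k * 2 ^ n + j < k * 2 ^ n + 2 ^ n := by omega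
      _ = (k + 1) * 2 ^ n := by ring
      _ ≤ 2 ^ σ * 2 ^ n := Nat.mul_le_mul_right _ hk1
      _ = 2 ^ (σ + n) := (pow_add _ _ _).symm
  · dsimp only at *
    have hj' : (j : ℝ) + 1 ≤ 2 ^ n := by exact_mod_cast hj
    have hj0 : (0 : ℝ) ≤ j := by positivity
    refine Icc_subset_Icc ?_ ?_
    · rw [div_le_div_iff₀ (by positivity) (by positivity), pow_add]
      push_cast
      have : (0 : ℝ) ≤ j * 2 ^ σ := by positivity
      nlinarith
    · rw [div_le_div_iff₀ (by positivity) (by positivity), pow_add]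
      push_cast
      have : ((j : ℝ) + 1) * 2 ^ σ ≤ 2 ^ n * 2 ^ σ := by gcongr
      nlinarith

/-! ### Weighted averages and local orthogonality -/

theorem weightedAvg_rpow {q : ℝ} (hq : 0 < q) (c : Plane) (L : ℝ) (G : Plane → ℂ) :
    weightedAvg q c L G ^ q = ∫⁻ x, ‖G x‖ₑ ^ q ∂weightMeasure c L := by
  rw [weightedAvg, eLpNorm_eq_lintegral_rpow_enorm_toReal (by simpa using hq) ENNReal.ofReal_ne_top,
    ENNReal.toReal_ofReal hq.le, ← ENNReal.rpow_mul, one_div, inv_mul_cancel₀ hq.ne',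
    ENNReal.rpow_one]

theorem weightedAvg_eq {q : ℝ} (hq : 0 < q) (c : Plane) (L : ℝ) (G : Plane → ℂ) :
    weightedAvg q c L G = (∫⁻ x, ‖G x‖ₑ ^ q ∂weightMeasure c L) ^ (1 / q) := by
  rw [weightedAvg, eLpNorm_eq_lintegral_rpow_enorm_toReal (by simpa using hq) ENNReal.ofReal_ne_top,
    ENNReal.toReal_ofReal hq.le]

theorem weightedAvg_two_sq (c : Plane) (L : ℝ) (G : Plane → ℂ) :
    weightedAvg 2 c L G ^ 2 = ∫⁻ x, ‖G x‖ₑ ^ 2 ∂weightMeasure c L := by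
  have h := weightedAvg_rpow two_pos c L G
  simpa only [ENNReal.rpow_two] using h

/-- Local `L²` orthogonality. -/
theorem exists_local_orthogonality : ∃ C : ℝ≥0, ∀ (m : ℕ) (f : Plane → ℂ), Integrable f →
    ∀ (I : Set ℝ) (c : Plane),
    ∑ k ∈ dyadicParts m I, weightedAvg 2 c (2 ^ (m + m)) (fourierProj (dyadicInterval m k) f) ^ 2 ≤
      C * ∑ k ∈ dyadicParts (m + m) I,
        weightedAvg 2 c (2 ^ (m + m)) (fourierProj (dyadicInterval (m + m) k) f) ^ 2 := by
  obtain ⟨C, h⟩ := exists_weighted_orthogonality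
  refine ⟨C, fun m f hf I c => ?_⟩
  refine le_trans ?_ (mul_le_mul_right (sum_dyadicParts_le m m I _) _)
  rw [Finset.mul_sum]
  refine Finset.sum_le_sum fun k _ => ?_
  simp_rw [weightedAvg_two_sq, fourierProj_eq_sum hf m m k,
    fourierProj_eq_strip (Filter.EventuallyEq.refl _ f)]
  refine h (2 ^ m) (fun j => indicator (strip (m + m) (k * 2 ^ m + j)) f) c _ (by positivity)
    (fun j => hf.indicator (measurableSet_strip _ _)) fun i j hij ξ ζ hξ hζ => ?_
  have h1 := mem_of_indicator_ne_zero hξ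
  have h2 := mem_of_indicator_ne_zero hζ
  -- Pieces whose indices differ by at least 2 have a full interval of length 2^(-2m) between them,
  -- the inverse side length of the square.
  have h3 : ((2 : ℝ) ^ (m + m))⁻¹ ≤ ζ 0 - ξ 0 := by
    have h4 := h1.2
    have h5 := h2.1
    have h6 : ((i : ℝ) + 2) ≤ j := by exact_mod_cast hij
    have h7 : ((2 : ℝ) ^ (m + m))⁻¹ + (((k * 2 ^ m + i : ℕ) : ℝ) + 1) / 2 ^ (m + m) ≤
        ((k * 2 ^ m + j : ℕ) : ℝ) / 2 ^ (m + m) := by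
      rw [inv_eq_one_div, ← add_div]
      gcongr
      push_cast
      linarith
    linarith
  have h4 := abs_coord_le_norm (ξ - ζ) 0
  rw [PiLp.sub_apply, abs_sub_comm] at h4
  exact h3.trans ((le_abs_self _).trans h4)

/-! ### Reproducing formula -/

theorem exists_schwartz_fourier_eq_one (r : ℝ) (hr : 0 < r) : ∃ ψ : SchwartzMap Plane ℂ,
    ∀ ξ, ‖ξ‖ ≤ r → 𝓕 ψ ξ = 1 := by
  let b₀ : ContDiffBump (0 : Plane) := ⟨r, r + 1, hr, by linarith⟩
  have hcs : HasCompactSupport fun x : Plane => (b₀ x : ℂ) :=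
    b₀.hasCompactSupport.comp_left (g := fun t : ℝ => (t : ℂ)) (by simp)
  have hcd : ContDiff ℝ (⊤ : ℕ∞) fun x : Plane => (b₀ x : ℂ) :=
    Complex.ofRealCLM.contDiff.comp b₀.contDiff
  refine ⟨𝓕⁻ (hcs.toSchwartzMap hcd), fun ξ hξ => ?_⟩
  rw [FourierTransform.fourier_fourierInv_eq]
  have h1 : b₀ ξ = 1 := b₀.one_of_mem_closedBall (by simpa using hξ)
  change ((b₀ ξ : ℝ) : ℂ) = 1
  rw [h1, Complex.ofReal_one]

/-- Integrating in z first turns the kernel into 𝓕 ψ (B' (ξ - ξ₀)), which is 1 wherever f lives. The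
modulation recentres the frequency support at ξ₀. -/
theorem fourierInv_eq_integral_translates {f : Plane → ℂ} (hf : Integrable f)
    {ψ : SchwartzMap Plane ℂ} {B B' : Plane → Plane} {r : ℝ} {ξ₀ : Plane}
    (hψ : ∀ ξ, ‖ξ‖ ≤ r → 𝓕 ψ ξ = 1) (hB : Continuous B)
    (hBB' : ∀ z ξ, inner ℝ (B z) ξ = inner ℝ z (B' ξ))
    (hsupp : ∀ ξ, f ξ ≠ 0 → ‖B' (ξ - ξ₀)‖ ≤ r) (x : Plane) :
    𝓕⁻ f x = ∫ z, (((𝐞 (inner ℝ (B z) ξ₀) : Circle) : ℂ) * ψ z) * 𝓕⁻ f (x - B z) := by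
  have hc := Real.continuous_fourierChar
  have hint : Integrable (fun q : Plane × Plane =>
      (((𝐞 (inner ℝ (B q.1) ξ₀ + inner ℝ q.2 (x - B q.1)) : Circle) : ℂ)) *
        (ψ q.1 * f q.2)) (volume.prod volume) := by
    refine (ψ.integrable.mul_prod hf).bdd_mul (c := 1) (Continuous.aestronglyMeasurable ?_)
      (Filter.Eventually.of_forall fun q => (Circle.norm_coe _).le)
    fun_prop
  have e1 : ∀ z, (((𝐞 (inner ℝ (B z) ξ₀) : Circle) : ℂ) * ψ z) * 𝓕⁻ f (x - B z) =
      ∫ ξ, (((𝐞 (inner ℝ (B z) ξ₀ + inner ℝ ξ (x - B z)) : Circle) : ℂ)) * (ψ z * f ξ) := by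
    intro z
    rw [Real.fourierInv_eq, ← integral_const_mul]
    congr 1
    ext ξ
    rw [AddChar.map_add_eq_mul, Circle.coe_mul, Circle.smul_def, smul_eq_mul]
    ring
  simp_rw [e1]
  rw [integral_integral_swap hint, Real.fourierInv_eq]
  congr 1
  ext ξ
  by_cases hξ : f ξ = 0
  · simp [hξ]
  · have h1 := hψ _ (hsupp ξ hξ)
    rw [SchwartzMap.fourier_coe, Real.fourier_eq] at h1
    have e2 : ∀ z, (((𝐞 (inner ℝ (B z) ξ₀ + inner ℝ ξ (x - B z)) : Circle) : ℂ)) * (ψ z * f ξ) =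
        (((𝐞 (inner ℝ ξ x) : Circle) : ℂ) * f ξ) * (𝐞 (-inner ℝ z (B' (ξ - ξ₀))) • ψ z) := by
      intro z
      have e3 : inner ℝ (B z) ξ₀ + inner ℝ ξ (x - B z) =
          inner ℝ ξ x + -inner ℝ z (B' (ξ - ξ₀)) := by
        rw [← hBB', inner_sub_right, inner_sub_right, real_inner_comm ξ (B z)]
        ring
      rw [e3, AddChar.map_add_eq_mul, Circle.coe_mul, Circle.smul_def, smul_eq_mul]
      ring
    simp_rw [e2]
    rw [integral_const_mul, h1, mul_one, Circle.smul_def, smul_eq_mul]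

/-- Jensen for the measure with density w, not normalised: Hölder with w = w^(1 - 1/q) w^(1/q). -/
theorem lintegral_mul_rpow_le {α : Type*} [MeasurableSpace α] {μ : Measure α} {q : ℝ} (hq : 1 ≤ q)
    {w g : α → ℝ≥0∞} (hw : AEMeasurable w μ) (hg : AEMeasurable g μ) :
    (∫⁻ x, w x * g x ∂μ) ^ q ≤ (∫⁻ x, w x ∂μ) ^ (q - 1) * ∫⁻ x, w x * g x ^ q ∂μ := by
  have hq0 : 0 < q := by linarith
  have h := ENNReal.lintegral_mul_norm_pow_le (μ := μ) hw (hw.mul (hg.pow_const q))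
    (p := 1 - 1 / q) (q := 1 / q)
    (by rw [sub_nonneg, div_le_one hq0]; exact hq) (by positivity) (by ring)
  have e : ∀ x, w x ^ (1 - 1 / q) * (w x * g x ^ q) ^ (1 / q) = w x * g x := by
    intro x
    rw [ENNReal.mul_rpow_of_nonneg _ _ (by positivity), ← mul_assoc,
      ← ENNReal.rpow_add_of_nonneg _ _ (by rw [sub_nonneg, div_le_one hq0]; exact hq)
        (by positivity), sub_add_cancel, ENNReal.rpow_one, ← ENNReal.rpow_mul, mul_one_div_cancel
        hq0.ne', ENNReal.rpow_one]
  simp only [Pi.mul_apply, e] at h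
  calc (∫⁻ x, w x * g x ∂μ) ^ q ≤
      ((∫⁻ x, w x ∂μ) ^ (1 - 1 / q) * (∫⁻ x, w x * g x ^ q ∂μ) ^ (1 / q)) ^ q := by gcongr
    _ = _ := by
      rw [ENNReal.mul_rpow_of_nonneg _ _ hq0.le, ← ENNReal.rpow_mul, ← ENNReal.rpow_mul,
        one_div_mul_cancel hq0.ne', ENNReal.rpow_one, sub_mul, one_mul, one_div_mul_cancel hq0.ne']

/-! ### Wave packet directions -/

/-- The linear map taking the unit square to the `N × N²` tube dual to the `N⁻¹`-arc of the
parabola above `α`. -/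
def tubeMap (α : ℝ) (N : ℝ) (z : Plane) : Plane :=
  !₂[N * z 0 - 2 * α * N ^ 2 * z 1, N ^ 2 * z 1]

/-- The transpose of `tubeMap`. -/
def tubeMapAdj (α : ℝ) (N : ℝ) (ξ : Plane) : Plane :=
  !₂[N * ξ 0, N ^ 2 * (ξ 1 - 2 * α * ξ 0)]

theorem continuous_tubeMap (α N : ℝ) : Continuous (tubeMap α N) := by
  unfold tubeMap
  refine (PiLp.continuous_toLp 2 _).comp (continuous_pi fun i => ?_)
  fin_cases i <;> simp <;> fun_prop

theorem inner_tubeMap (α N : ℝ) (z ξ : Plane) :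
    inner ℝ (tubeMap α N z) ξ = inner ℝ z (tubeMapAdj α N ξ) := by
  simp [tubeMap, tubeMapAdj, PiLp.inner_apply, Fin.sum_univ_two]
  ring

/-- The part of the parabola neighbourhood of width `N⁻²` above `[α, α + N⁻¹]`. -/
def arcNhd (α N : ℝ) : Set Plane :=
  {ξ | ξ 0 ∈ Icc α (α + N⁻¹) ∧ ξ 1 - ξ 0 ^ 2 ∈ Icc 0 (N ^ 2)⁻¹}

/-- The shear removes the tangent at α. What is left in the second coordinate is N² times the height
above the parabola plus (N (ξ₀ - α))², each at most 1. -/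
theorem norm_tubeMapAdj_le {α N : ℝ} (hN : 0 < N) {ξ : Plane} (hξ : ξ ∈ arcNhd α N) :
    ‖tubeMapAdj α N (ξ - !₂[α, α ^ 2])‖ ≤ 4 := by
  obtain ⟨⟨h1, h2⟩, h3, h4⟩ := hξ
  refine (norm_le_abs_add_abs _).trans ?_
  have e0 : tubeMapAdj α N (ξ - !₂[α, α ^ 2]) 0 = N * (ξ 0 - α) := by simp [tubeMapAdj]
  have e1 : tubeMapAdj α N (ξ - !₂[α, α ^ 2]) 1 =
      N ^ 2 * (ξ 1 - ξ 0 ^ 2) + (N * (ξ 0 - α)) ^ 2 := by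
    simp [tubeMapAdj]; ring
  have h5 : N * (ξ 0 - α) ≤ 1 := by
    calc N * (ξ 0 - α) ≤ N * N⁻¹ := by gcongr; linarith
      _ = 1 := mul_inv_cancel₀ hN.ne'
  have h6 : 0 ≤ N * (ξ 0 - α) := mul_nonneg hN.le (by linarith)
  have h7 : N ^ 2 * (ξ 1 - ξ 0 ^ 2) ≤ 1 := by
    calc N ^ 2 * (ξ 1 - ξ 0 ^ 2) ≤ N ^ 2 * (N ^ 2)⁻¹ := by gcongr
      _ = 1 := mul_inv_cancel₀ (by positivity)
  have h8 : 0 ≤ N ^ 2 * (ξ 1 - ξ 0 ^ 2) := by positivity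
  rw [e0, e1, abs_of_nonneg h6, abs_of_nonneg (by positivity)]
  nlinarith

/-- The transversal coordinate, in units of `N`, of `x` relative to the tube direction. -/
def tubeCoord (a : Plane) (α N : ℝ) (x : Plane) : ℝ :=
  ((x 0 - a 0) / N - 1 / 2) + 2 * α * ((x 1 - a 1) / N - 1 / 2)

/-- Moving along a tube of size N × N² stays within the scale N² of the large square, so its weight
changes by a power of 1 + ‖z‖ only. Near the small square there remains decay both transversally, in
`tubeCoord`, and along the tube, in N z₁. -/
theorem weight_tube_le {α : ℝ} (hα : α ∈ Icc (0 : ℝ) 1) (a : Plane) {N i j : ℕ} (hi : i < N)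
    (hj : j < N) (x z : Plane) :
    weight (gridCenter a N i j) N (x + tubeMap α N z) ≤
      (2 ^ 200 * 2 ^ 200 * 4 ^ 200 * 3 ^ 4) * weight (gridCenter a (N * N) 0 0) (N * N) x *
        ((1 + ‖z‖) ^ 204 * (((N : ℝ)⁻¹) ^ 3 + ((1 + |tubeCoord a α N x - (i + 2 * α * j)|) ^ 4)⁻¹ *
          ((1 + |(x 1 - gridCenter a N i j 1) / N + N * z 1|) ^ 2)⁻¹)) := by
  have hN1 : (1 : ℝ) ≤ N := by exact_mod_cast (Nat.zero_le i).trans_lt hi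
  have hN : (0 : ℝ) < N := by linarith
  obtain ⟨hα0, hα1⟩ := hα
  set c := gridCenter a N i j with hc
  set w := weight (gridCenter a (N * N) 0 0) (N * N) with hw
  have hwpos : ∀ x, 0 < w x := fun x => weight_pos _ (by positivity) x
  set s := ‖x + tubeMap α N z - c‖ / N with hs
  have hs0 : 0 ≤ s := by positivity
  have hz0 : 0 ≤ ‖z‖ := norm_nonneg z
  set U := 1 + |tubeCoord a α N x - (i + 2 * α * j)| with hU
  have hUpos : 0 < U := by positivity
  set T := 1 + |(x 1 - c 1) / N + N * z 1| with hT
  have hTpos : 0 < T := by positivity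
  have h1 : w (x + tubeMap α N z) ≤ w x * (4 ^ 200 * (1 + ‖z‖) ^ 200) := by
    refine (weight_add_le _ (by positivity) x _).trans ?_
    rw [← mul_pow]
    have h2 : ‖tubeMap α N z‖ ≤ N * N * (4 * ‖z‖) := by
      refine (norm_le_abs_add_abs _).trans ?_
      have e0 : tubeMap α N z 0 = N * z 0 - 2 * α * N ^ 2 * z 1 := by simp [tubeMap]
      have e1 : tubeMap α N z 1 = N ^ 2 * z 1 := by simp [tubeMap]
      rw [e0, e1]
      have h3 : |N * z 0 - 2 * α * N ^ 2 * z 1| ≤ N * ‖z‖ + 2 * α * N ^ 2 * ‖z‖ := by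
        refine (abs_sub _ _).trans ?_
        rw [abs_mul, abs_mul, abs_of_pos hN,
          abs_of_nonneg (by positivity : (0 : ℝ) ≤ 2 * α * N ^ 2)]
        gcongr <;> exact abs_coord_le_norm z _
      have h4 : |(N : ℝ) ^ 2 * z 1| ≤ N ^ 2 * ‖z‖ := by
        rw [abs_mul, abs_of_pos (by positivity)]
        gcongr
        exact abs_coord_le_norm z _
      have h5 : (N : ℝ) * ‖z‖ ≤ N ^ 2 * ‖z‖ := by
        gcongr
        nlinarith
      have h6 : 2 * α * (N : ℝ) ^ 2 * ‖z‖ ≤ 2 * 1 * N ^ 2 * ‖z‖ := by gcongr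
      linarith
    have h7 : ‖tubeMap α N z‖ / (N * N) ≤ 4 * ‖z‖ := by
      rw [div_le_iff₀ (by positivity), mul_comm]; exact h2
    have h8 : 1 + ‖tubeMap α N z‖ / (N * N) ≤ 4 * (1 + ‖z‖) := by linarith
    gcongr
    exact (hwpos x).le
  have hcoord0 : |(x + tubeMap α N z - c) 0 / N| ≤ s := by
    rw [abs_div, abs_of_pos hN, hs]
    gcongr
    exact abs_coord_le_norm _ _
  have hcoord1 : |(x + tubeMap α N z - c) 1 / N| ≤ s := by
    rw [abs_div, abs_of_pos hN, hs]
    gcongr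
    exact abs_coord_le_norm _ _
  have hT1 : T ≤ 1 + s := by
    have e : (x + tubeMap α N z - c) 1 / N = (x 1 - c 1) / N + N * z 1 := by
      simp [tubeMap]
      field_simp
      ring
    rw [e] at hcoord1
    linarith
  have hU1 : U ≤ 3 * (1 + s) * (1 + ‖z‖) := by
    -- The shift by `tubeMap` changes `tubeCoord` by z₀ alone: the long component N² z₁ cancels.
    -- This is why the transversal decay survives averaging over the tube.
    have e : tubeCoord a α N x - (i + 2 * α * j) + z 0 =
        (x + tubeMap α N z - c) 0 / N + 2 * α * ((x + tubeMap α N z - c) 1 / N) := by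
      simp [tubeMap, tubeCoord, hc]
      field_simp
      ring
    have h2 : |tubeCoord a α N x - (i + 2 * α * j) + z 0| ≤ 3 * s := by
      rw [e]
      refine (abs_add_le _ _).trans ?_
      rw [abs_mul, abs_of_nonneg (by positivity : (0 : ℝ) ≤ 2 * α)]
      have h3 : 2 * α * |(x + tubeMap α N z - c) 1 / N| ≤ 2 * 1 * s := by gcongr
      linarith
    have h4 := one_add_norm_le_mul_add (tubeCoord a α N x - (i + 2 * α * j)) (z 0)
    simp only [Real.norm_eq_abs] at h4
    have h5 := abs_coord_le_norm z 0
    calc U ≤ _ := h4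
      _ ≤ (1 + 3 * s) * (1 + ‖z‖) := by gcongr
      _ ≤ 3 * (1 + s) * (1 + ‖z‖) := by gcongr; linarith
  have h2 : ((1 + s) ^ 200)⁻¹ ≤ (3 ^ 4 * (1 + ‖z‖) ^ 4) * ((U ^ 4)⁻¹ * (T ^ 2)⁻¹) := by
    have h3 : U ^ 4 ≤ (3 * (1 + s) * (1 + ‖z‖)) ^ 4 := by gcongr
    have h4 : T ^ 2 ≤ (1 + s) ^ 2 := by gcongr
    rw [← mul_inv, ← div_eq_mul_inv, inv_eq_one_div, div_le_div_iff₀ (by positivity) (by positivity),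
      one_mul]
    calc U ^ 4 * T ^ 2 ≤ (3 * (1 + s) * (1 + ‖z‖)) ^ 4 * (1 + s) ^ 2 := by gcongr
      _ = 3 ^ 4 * (1 + ‖z‖) ^ 4 * (1 + s) ^ 6 := by
        generalize 1 + s = b
        generalize 1 + ‖z‖ = d
        ring
      _ ≤ 3 ^ 4 * (1 + ‖z‖) ^ 4 * (1 + s) ^ 200 := by
        gcongr
        · linarith
        · norm_num
  -- Only N^(-3) of the gain is kept: N^(-1) to match the averaging along the tube, N^(-2) to sum
  -- over the N² squares.
  have h3 : ((N : ℝ)⁻¹) ^ 200 ≤ (3 ^ 4 * (1 + ‖z‖) ^ 4) * ((N : ℝ)⁻¹) ^ 3 := by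
    have h4 : ((N : ℝ)⁻¹) ^ 200 ≤ ((N : ℝ)⁻¹) ^ 3 :=
      pow_le_pow_of_le_one (by positivity) (inv_le_one_of_one_le₀ hN1) (by norm_num)
    refine h4.trans (le_mul_of_one_le_left (by positivity) ?_)
    exact one_le_mul_of_one_le_of_one_le (by norm_num) (one_le_pow₀ (by linarith))
  have hK : (0 : ℝ) ≤ 2 ^ 200 * 2 ^ 200 := by positivity
  have key := weight_gridCenter_le a hN hi hj (x + tubeMap α N z)
  rw [← hw, ← hc, ← hs] at key
  generalize (2 : ℝ) ^ 200 * 2 ^ 200 = K at *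
  refine key.trans ?_
  calc K * w (x + tubeMap α N z) * (((N : ℝ)⁻¹) ^ 200 + ((1 + s) ^ 200)⁻¹)
      ≤ K * (w x * (4 ^ 200 * (1 + ‖z‖) ^ 200)) *
        ((3 ^ 4 * (1 + ‖z‖) ^ 4) * ((N : ℝ)⁻¹) ^ 3 +
          (3 ^ 4 * (1 + ‖z‖) ^ 4) * ((U ^ 4)⁻¹ * (T ^ 2)⁻¹)) := by
        gcongr
        exact mul_nonneg hK (mul_nonneg (hwpos x).le (by positivity))
    _ = _ := by
        have h7 : (1 + ‖z‖) ^ 204 = (1 + ‖z‖) ^ 200 * (1 + ‖z‖) ^ 4 := pow_add _ 200 4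
        rw [← mul_add, h7]
        generalize (4 : ℝ) ^ 200 = K'
        generalize (1 + ‖z‖) ^ 200 = Z
        generalize 1 + ‖z‖ = d
        ring

/-- Averaging the small weight over a tube spreads it in the long direction: the factor N^(-1) is
the integral of (1 + |t + N z₁|)^(-2) in z₁, while the transversal profile persists. -/
theorem exists_lintegral_weight_tube_le (ψ : SchwartzMap Plane ℂ) : ∃ C : ℝ≥0, ∀ (α : ℝ),
    α ∈ Icc (0 : ℝ) 1 → ∀ (a : Plane) (N i j : ℕ), i < N → j < N → ∀ x : Plane,
      ∫⁻ z, ‖ψ z‖ₑ * ENNReal.ofReal (weight (gridCenter a N i j) N (x + tubeMap α N z)) ≤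
        C * ENNReal.ofReal (weight (gridCenter a (N * N) 0 0) (N * N) x) *
          ENNReal.ofReal ((N : ℝ)⁻¹ * (((N : ℝ)⁻¹) ^ 2 +
            ((1 + |tubeCoord a α N x - (i + 2 * α * j)|) ^ 4)⁻¹)) := by
  obtain ⟨J, hJ⟩ := exists_lintegral_inv_sq_le
  -- Of the 208 powers, 204 absorb the growth in `weight_tube_le` and 4 make the z-integral
  -- converge.
  obtain ⟨D, hD, hψ⟩ := exists_schwartz_decay ψ 208
  have hK0 : (0 : ℝ) < 2 ^ 200 * 2 ^ 200 * 4 ^ 200 * 3 ^ 4 := by positivity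
  have hbound := @weight_tube_le
  generalize (2 : ℝ) ^ 200 * 2 ^ 200 * 4 ^ 200 * 3 ^ 4 = K at hK0 hbound
  refine ⟨(D * K).toNNReal * (J * J), fun α hα a N i j hi hj x => ?_⟩
  have hN : (0 : ℝ) < N := by exact_mod_cast (Nat.zero_le i).trans_lt hi
  set W := weight (gridCenter a (N * N) 0 0) (N * N) x with hW
  have hW0 : 0 < W := weight_pos _ (by positivity) x
  set V := ((1 + |tubeCoord a α N x - (i + 2 * α * j)|) ^ 4)⁻¹ with hV
  have hV0 : 0 < V := by positivity
  set t := (x 1 - gridCenter a N i j 1) / N with ht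
  let ω : ℝ → ℝ≥0∞ := fun y => ENNReal.ofReal (((1 + |0 + 1 * y|) ^ 2)⁻¹)
  let ω' : ℝ → ℝ≥0∞ := fun y => ENNReal.ofReal (((1 + |t + N * y|) ^ 2)⁻¹)
  have hω : Measurable ω := by fun_prop
  have hω' : Measurable ω' := by fun_prop
  have hω1 : ∫⁻ y, ω y ≤ J := by
    have := hJ 0 1 one_pos
    rwa [inv_one, ENNReal.ofReal_one, one_mul] at this
  have hω1' : ∫⁻ y, ω' y ≤ ENNReal.ofReal (N : ℝ)⁻¹ * J := hJ t N hN
  have hpt : ∀ z, ‖ψ z‖ₑ * ENNReal.ofReal (weight (gridCenter a N i j) N (x + tubeMap α N z)) ≤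
      ENNReal.ofReal (D * K * W) * (ENNReal.ofReal (((N : ℝ)⁻¹) ^ 3) * (ω (z 0) * ω (z 1)) +
        ENNReal.ofReal V * (ω (z 0) * ω' (z 1))) := by
    intro z
    simp only [ω, ω']
    rw [← ofReal_norm, ← ENNReal.ofReal_mul (norm_nonneg _), ← ENNReal.ofReal_mul (by positivity),
      ← ENNReal.ofReal_mul (by positivity), ← ENNReal.ofReal_mul (by positivity),
      ← ENNReal.ofReal_mul (by positivity), ← ENNReal.ofReal_add (by positivity) (by positivity),
      ← ENNReal.ofReal_mul (by positivity)]
    refine ENNReal.ofReal_le_ofReal ?_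
    have h1 := hbound hα a hi hj x z
    rw [← hW, ← hV, ← ht] at h1
    have h2 := hψ z
    have h3 := inv_one_add_norm_pow_le z 4 le_rfl
    simp only [zero_add, one_mul]
    set T := ((1 + |t + N * z 1|) ^ 2)⁻¹ with hT
    have hT0 : 0 < T := by positivity
    set A := ((1 + |z 0|) ^ 2)⁻¹
    set B := ((1 + |z 1|) ^ 2)⁻¹ with hB
    have hA0 : 0 < A := by positivity
    have hB0 : 0 < B := by positivity
    have hB1 : B ≤ 1 := inv_le_one_of_one_le₀ (one_le_pow₀ (by linarith [abs_nonneg (z 1)]))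
    calc ‖ψ z‖ * weight (gridCenter a N i j) N (x + tubeMap α N z)
        ≤ D * ((1 + ‖z‖) ^ 208)⁻¹ * (K * W * ((1 + ‖z‖) ^ 204 * (((N : ℝ)⁻¹) ^ 3 + V * T))) := by
          exact mul_le_mul h2 h1 (weight_pos _ hN _).le (by positivity)
      _ = D * K * W * (((1 + ‖z‖) ^ 4)⁻¹ * (((N : ℝ)⁻¹) ^ 3 + V * T)) := by
          have h5 : ((1 + ‖z‖) ^ 208)⁻¹ * (1 + ‖z‖) ^ 204 = ((1 + ‖z‖) ^ 4)⁻¹ := by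
            have h7 : (1 + ‖z‖) ^ 208 = (1 + ‖z‖) ^ 204 * (1 + ‖z‖) ^ 4 := pow_add _ 204 4
            rw [h7, mul_inv, mul_comm, ← mul_assoc, mul_inv_cancel₀ (by positivity), one_mul]
          rw [← h5]
          generalize (1 + ‖z‖) ^ 204 = Z
          ring
      _ ≤ D * K * W * ((A * B) * (((N : ℝ)⁻¹) ^ 3 + V * T)) := by gcongr
      _ ≤ D * K * W * (((N : ℝ)⁻¹) ^ 3 * (A * B) + V * (A * T)) := by
          gcongr
          have h6 : A * B * (V * T) ≤ A * 1 * (V * T) := by gcongr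
          linarith
  refine (lintegral_mono hpt).trans ?_
  have hm0 : Measurable fun z : Plane => ω (z 0) * ω (z 1) := by fun_prop
  have hm1 : Measurable fun z : Plane => ω (z 0) * ω' (z 1) := by fun_prop
  rw [lintegral_const_mul' _ _ ENNReal.ofReal_ne_top, lintegral_add_left (hm0.const_mul _),
    lintegral_const_mul' _ _ ENNReal.ofReal_ne_top, lintegral_const_mul' _ _ ENNReal.ofReal_ne_top,
    lintegral_plane_mul hω hω, lintegral_plane_mul hω hω']
  calc _ ≤ ENNReal.ofReal (D * K * W) * (ENNReal.ofReal (((N : ℝ)⁻¹) ^ 3) * (J * J) +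
        ENNReal.ofReal V * (J * (ENNReal.ofReal (N : ℝ)⁻¹ * J))) := by gcongr
    _ = ENNReal.ofReal (D * K) * (J * J) * ENNReal.ofReal W *
        ENNReal.ofReal ((N : ℝ)⁻¹ * (((N : ℝ)⁻¹) ^ 2 + V)) := by
        rw [ENNReal.ofReal_mul (by positivity : (0 : ℝ) ≤ D * K),
          show (N : ℝ)⁻¹ * ((N : ℝ)⁻¹ ^ 2 + V) = (N : ℝ)⁻¹ ^ 3 + (N : ℝ)⁻¹ * V by ring,
          ENNReal.ofReal_add (by positivity) (by positivity),
          ENNReal.ofReal_mul (q := V) (by positivity)]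
        ring
    _ = _ := by
        rw [ENNReal.coe_mul, ENNReal.coe_mul]
        rfl

/-! ### Bilinear ball inflation -/

theorem enorm_rpow_le_lintegral_translates {f : Plane → ℂ} (hf : Integrable f)
    {ψ : SchwartzMap Plane ℂ} (hψ : ∀ ξ, ‖ξ‖ ≤ 4 → 𝓕 ψ ξ = 1) {q : ℝ} (hq : 1 ≤ q) {α N : ℝ}
    (hN : 0 < N) (hsupp : ∀ ξ, f ξ ≠ 0 → ξ ∈ arcNhd α N) (x : Plane) :
    ‖𝓕⁻ f x‖ₑ ^ q ≤ (∫⁻ z, ‖ψ z‖ₑ) ^ (q - 1) *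
      ∫⁻ z, ‖ψ z‖ₑ * ‖𝓕⁻ f (x - tubeMap α N z)‖ₑ ^ q := by
  have hc := continuous_fourierInv hf
  have hB := continuous_tubeMap α N
  have h1 : ‖𝓕⁻ f x‖ₑ ≤ ∫⁻ z, ‖ψ z‖ₑ * ‖𝓕⁻ f (x - tubeMap α N z)‖ₑ := by
    rw [fourierInv_eq_integral_translates hf hψ hB (inner_tubeMap α N)
      (fun ξ hξ => norm_tubeMapAdj_le hN (hsupp ξ hξ)) x]
    refine (enorm_integral_le_lintegral_enorm _).trans (lintegral_mono fun z => ?_)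
    rw [enorm_mul, enorm_mul]
    gcongr
    refine (mul_le_of_le_one_left (zero_le) ?_)
    rw [← ofReal_norm, Circle.norm_coe, ENNReal.ofReal_one]
  refine (ENNReal.rpow_le_rpow h1 (by linarith)).trans ?_
  refine lintegral_mul_rpow_le hq ψ.continuous.enorm.aemeasurable
    (Continuous.aemeasurable ?_)
  fun_prop

/-- Jensen in the reproducing formula bounds |𝓕⁻ f|^q by its averages over tubes; Fubini and a
translation transfer the average to the weight. -/
theorem exists_lintegral_tube_le {q : ℝ} (hq : 1 ≤ q) : ∃ C : ℝ≥0, ∀ (α : ℝ), α ∈ Icc (0 : ℝ) 1 →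
    ∀ (a : Plane) (N i j : ℕ), i < N → j < N → ∀ f : Plane → ℂ, Integrable f →
    (∀ ξ, f ξ ≠ 0 → ξ ∈ arcNhd α N) →
      ∫⁻ x, ‖𝓕⁻ f x‖ₑ ^ q ∂weightMeasure (gridCenter a N i j) N ≤
        C * (N * ∫⁻ x, ENNReal.ofReal (((N : ℝ)⁻¹) ^ 2 +
            ((1 + |tubeCoord a α N x - (i + 2 * α * j)|) ^ 4)⁻¹) * ‖𝓕⁻ f x‖ₑ ^ q
          ∂weightMeasure (gridCenter a (N * N) 0 0) (N * N)) := by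
  obtain ⟨ψ, hψ⟩ := exists_schwartz_fourier_eq_one 4 (by norm_num)
  obtain ⟨C, hC⟩ := exists_lintegral_weight_tube_le ψ
  have hK : ∫⁻ z, ‖ψ z‖ₑ ≠ ∞ := ψ.integrable.2.ne
  have hK' : (∫⁻ z, ‖ψ z‖ₑ) ^ (q - 1) ≠ ∞ := ENNReal.rpow_ne_top_of_nonneg (by linarith) hK
  refine ⟨((∫⁻ z, ‖ψ z‖ₑ) ^ (q - 1)).toNNReal * C, fun α hα a N i j hi hj f hf hsupp => ?_⟩
  have hN : (0 : ℝ) < N := by exact_mod_cast (Nat.zero_le i).trans_lt hi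
  have hc := continuous_fourierInv hf
  have hB := continuous_tubeMap α N
  have hw := continuous_weight (gridCenter a N i j) hN
  rw [lintegral_weightMeasure _ hN, lintegral_weightMeasure _ (by positivity)]
  rw [ENNReal.coe_mul, ENNReal.coe_toNNReal hK']
  set A := (∫⁻ z, ‖ψ z‖ₑ) ^ (q - 1)
  set w := weight (gridCenter a N i j) N with hwdef
  set W := weight (gridCenter a (N * N) 0 0) (N * N) with hWdef
  have h1 : ∫⁻ x, ENNReal.ofReal (w x) * ‖𝓕⁻ f x‖ₑ ^ q ≤
      A * ∫⁻ x, ‖𝓕⁻ f x‖ₑ ^ q * ∫⁻ z, ‖ψ z‖ₑ * ENNReal.ofReal (w (x + tubeMap α N z)) := by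
    calc _ ≤ ∫⁻ x, ENNReal.ofReal (w x) *
          (A * ∫⁻ z, ‖ψ z‖ₑ * ‖𝓕⁻ f (x - tubeMap α N z)‖ₑ ^ q) := by
          refine lintegral_mono fun x => ?_
          gcongr
          exact enorm_rpow_le_lintegral_translates hf hψ hq hN hsupp x
      _ = A * ∫⁻ x, ∫⁻ z, ENNReal.ofReal (w x) *
            (‖ψ z‖ₑ * ‖𝓕⁻ f (x - tubeMap α N z)‖ₑ ^ q) := by
          rw [← lintegral_const_mul' _ _ hK']
          refine lintegral_congr fun x => ?_
          rw [lintegral_const_mul' _ _ ENNReal.ofReal_ne_top]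
          ring
      _ = A * ∫⁻ z, ∫⁻ x, ENNReal.ofReal (w x) *
            (‖ψ z‖ₑ * ‖𝓕⁻ f (x - tubeMap α N z)‖ₑ ^ q) := by
          rw [lintegral_lintegral_swap]
          exact ((hw.comp continuous_fst).measurable.ennreal_ofReal.mul
            ((ψ.continuous.comp continuous_snd).enorm.measurable.mul
              ((hc.comp (continuous_fst.sub (hB.comp continuous_snd))).enorm.measurable.pow_const
                q))).aemeasurable
      _ = A * ∫⁻ z, ∫⁻ x, ‖𝓕⁻ f x‖ₑ ^ q *
            (‖ψ z‖ₑ * ENNReal.ofReal (w (x + tubeMap α N z))) := by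
          congr 1
          refine lintegral_congr fun z => ?_
          rw [← lintegral_add_right_eq_self _ (tubeMap α N z)]
          refine lintegral_congr fun x => ?_
          rw [add_sub_cancel_right]
          ring
      _ = A * ∫⁻ x, ∫⁻ z, ‖𝓕⁻ f x‖ₑ ^ q *
            (‖ψ z‖ₑ * ENNReal.ofReal (w (x + tubeMap α N z))) := by
          rw [lintegral_lintegral_swap]
          exact (((hc.comp continuous_snd).enorm.measurable.pow_const q).mul
            ((ψ.continuous.comp continuous_fst).enorm.measurable.mul
              (hw.comp (continuous_snd.add
                (hB.comp continuous_fst))).measurable.ennreal_ofReal)).aemeasurable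
      _ = _ := by
          congr 1
          refine lintegral_congr fun x => ?_
          rw [lintegral_const_mul]
          exact ψ.continuous.enorm.measurable.mul
            (hw.comp (continuous_const.add hB)).measurable.ennreal_ofReal
  have h2 : ∀ x, ‖𝓕⁻ f x‖ₑ ^ q * ∫⁻ z, ‖ψ z‖ₑ * ENNReal.ofReal (w (x + tubeMap α N z)) ≤
      (C * ENNReal.ofReal (N : ℝ)⁻¹) * (ENNReal.ofReal (W x) * (ENNReal.ofReal (((N : ℝ)⁻¹) ^ 2 +
            ((1 + |tubeCoord a α N x - (i + 2 * α * j)|) ^ 4)⁻¹) * ‖𝓕⁻ f x‖ₑ ^ q)) := by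
    intro x
    calc _ ≤ ‖𝓕⁻ f x‖ₑ ^ q * (C * ENNReal.ofReal (W x) * ENNReal.ofReal ((N : ℝ)⁻¹ *
          (((N : ℝ)⁻¹) ^ 2 + ((1 + |tubeCoord a α N x - (i + 2 * α * j)|) ^ 4)⁻¹))) := by
          gcongr
          exact hC α hα a N i j hi hj x
      _ = _ := by
          rw [ENNReal.ofReal_mul (by positivity)]
          ring
  -- N^(-3) = N · N^(-4): the large square has area N^4, and the leftover N compensates for a tube
  -- filling a 1/N part of it.
  have h3 : (ENNReal.ofReal ((N : ℝ) ^ 2))⁻¹ * ENNReal.ofReal (N : ℝ)⁻¹ =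
      N * (ENNReal.ofReal (((N : ℝ) * N) ^ 2))⁻¹ := by
    rw [← ENNReal.ofReal_inv_of_pos (by positivity), ← ENNReal.ofReal_inv_of_pos (by positivity),
      ← ENNReal.ofReal_natCast, ← ENNReal.ofReal_mul (by positivity),
      ← ENNReal.ofReal_mul (by positivity)]
    congr 1
    field_simp
  calc _ ≤ (ENNReal.ofReal ((N : ℝ) ^ 2))⁻¹ * (A * ∫⁻ x, (C * ENNReal.ofReal (N : ℝ)⁻¹) *
        (ENNReal.ofReal (W x) * (ENNReal.ofReal (((N : ℝ)⁻¹) ^ 2 +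
            ((1 + |tubeCoord a α N x - (i + 2 * α * j)|) ^ 4)⁻¹) * ‖𝓕⁻ f x‖ₑ ^ q))) := by
        gcongr
        exact h1.trans (mul_le_mul_right (lintegral_mono h2) A)
    _ = A * C * (((ENNReal.ofReal ((N : ℝ) ^ 2))⁻¹ * ENNReal.ofReal (N : ℝ)⁻¹) * ∫⁻ x, 
        (ENNReal.ofReal (W x) * (ENNReal.ofReal (((N : ℝ)⁻¹) ^ 2 +
            ((1 + |tubeCoord a α N x - (i + 2 * α * j)|) ^ 4)⁻¹) * ‖𝓕⁻ f x‖ₑ ^ q))) := by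
        rw [lintegral_const_mul' _ _ (by finiteness)]
        ring
    _ = _ := by rw [h3]; ring

theorem continuous_tubeCoord (a : Plane) (α N : ℝ) : Continuous (tubeCoord a α N) := by
  unfold tubeCoord
  fun_prop

/-- Ball inflation for a pair of arcs: a bilinear Kakeya inequality. -/
theorem exists_bilinear_inflation {q : ℝ} (hq : 1 ≤ q) {c : ℝ} (hc : 0 < c) : ∃ C : ℝ≥0,
    ∀ (α : Fin 2 → ℝ), (∀ l, α l ∈ Icc (0 : ℝ) 1) → c ≤ |α 0 - α 1| →
    ∀ (a : Plane) (N : ℕ) (f : Fin 2 → Plane → ℂ), 0 < N → (∀ l, Integrable (f l)) →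
    (∀ l ξ, f l ξ ≠ 0 → ξ ∈ arcNhd (α l) N) →
      ∑ i ∈ Finset.range N, ∑ j ∈ Finset.range N,
        ∏ l, ∫⁻ x, ‖𝓕⁻ (f l) x‖ₑ ^ q ∂weightMeasure (gridCenter a N i j) N ≤
      C * (N : ℝ≥0∞) ^ 2 *
        ∏ l, ∫⁻ x, ‖𝓕⁻ (f l) x‖ₑ ^ q ∂weightMeasure (gridCenter a (N * N) 0 0) (N * N) := by
  obtain ⟨C, hC⟩ := exists_lintegral_tube_le hq
  obtain ⟨D, hD, hsum⟩ := exists_sum_transversal_le hc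
  refine ⟨C * C * (3 + D).toNNReal, fun α hα hαc a N f hN hf hsupp => ?_⟩
  have hN1 : (1 : ℝ) ≤ N := by exact_mod_cast hN
  have hN0 : (0 : ℝ) < N := by linarith
  set μ := weightMeasure (gridCenter a (N * N) 0 0) (N * N)
  let k : Fin 2 → ℕ → ℕ → Plane → ℝ := fun l i j x => ((N : ℝ)⁻¹) ^ 2 +
    ((1 + |tubeCoord a (α l) N x - (i + 2 * α l * j)|) ^ 4)⁻¹
  have hkc : ∀ l i j, Continuous (k l i j) := fun l i j => by
    have := continuous_tubeCoord a (α l) N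
    refine continuous_const.add (Continuous.inv₀ (by fun_prop) fun x => by positivity)
  have hk0 : ∀ l i j x, 0 ≤ k l i j x := fun l i j x => by positivity
  let φ : Fin 2 → Plane → ℝ≥0∞ := fun l x => ‖𝓕⁻ (f l) x‖ₑ ^ q
  have hφ : ∀ l, Measurable (φ l) := fun l => by
    have := continuous_fourierInv (hf l)
    exact this.enorm.measurable.pow_const q
  have hm : ∀ l i j, Measurable fun x => ENNReal.ofReal (k l i j x) * φ l x := fun l i j =>
    (hkc l i j).measurable.ennreal_ofReal.mul (hφ l)
  -- Bilinear Kakeya at fixed x and y. Expanding the product, the terms containing N^(-2) are at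
  -- most 3 N^(-2) per square, hence at most 3 in total.
  have hker : ∀ x y, ∑ i ∈ Finset.range N, ∑ j ∈ Finset.range N, k 0 i j x * k 1 i j y ≤ 3 + D := by
    intro x y
    have h1 : ∀ i j : ℕ, k 0 i j x * k 1 i j y ≤ 3 * ((N : ℝ) ^ 2)⁻¹ +
        ((1 + |tubeCoord a (α 0) N x - (i + 2 * α 0 * j)|) ^ 4)⁻¹ *
        ((1 + |tubeCoord a (α 1) N y - (i + 2 * α 1 * j)|) ^ 4)⁻¹ := by
      intro i j
      simp only [k, inv_pow]
      have hA : ((1 + |tubeCoord a (α 0) N x - (i + 2 * α 0 * j)|) ^ 4)⁻¹ ≤ 1 :=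
        inv_le_one_of_one_le₀ (one_le_pow₀ (by linarith [abs_nonneg (tubeCoord a (α 0) N x - (i + 2 * α 0 * j))]))
      have hB : ((1 + |tubeCoord a (α 1) N y - (i + 2 * α 1 * j)|) ^ 4)⁻¹ ≤ 1 :=
        inv_le_one_of_one_le₀ (one_le_pow₀ (by linarith [abs_nonneg (tubeCoord a (α 1) N y - (i + 2 * α 1 * j))]))
      have hn : ((N : ℝ) ^ 2)⁻¹ ≤ 1 := inv_le_one_of_one_le₀ (one_le_pow₀ hN1)
      have hn0 : 0 ≤ ((N : ℝ) ^ 2)⁻¹ := by positivity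
      nlinarith
    refine (Finset.sum_le_sum fun i _ => Finset.sum_le_sum fun j _ => h1 i j).trans ?_
    simp_rw [Finset.sum_add_distrib]
    refine add_le_add (le_of_eq ?_) (hsum _ _ _ _ N hαc)
    simp only [Finset.sum_const, Finset.card_range, nsmul_eq_mul]
    field_simp
  -- The product of integrals is a double integral in independent x and y, so the sum over squares
  -- falls on the kernels alone.
  have hdouble : ∑ i ∈ Finset.range N, ∑ j ∈ Finset.range N,
      (∫⁻ x, ENNReal.ofReal (k 0 i j x) * φ 0 x ∂μ) *
        (∫⁻ x, ENNReal.ofReal (k 1 i j x) * φ 1 x ∂μ) ≤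
      ENNReal.ofReal (3 + D) * ((∫⁻ x, φ 0 x ∂μ) * ∫⁻ x, φ 1 x ∂μ) := by
    have e1 : ∀ i j, (∫⁻ x, ENNReal.ofReal (k 0 i j x) * φ 0 x ∂μ) *
        (∫⁻ x, ENNReal.ofReal (k 1 i j x) * φ 1 x ∂μ) =
        ∫⁻ x, ∫⁻ y, (ENNReal.ofReal (k 0 i j x) * φ 0 x) *
          (ENNReal.ofReal (k 1 i j y) * φ 1 y) ∂μ ∂μ := by
      intro i j
      rw [← lintegral_mul_const _ (hm 0 i j)]
      refine lintegral_congr fun x => ?_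
      rw [lintegral_const_mul _ (hm 1 i j)]
    have hm2 : ∀ i j, Measurable fun x => ∫⁻ y, (ENNReal.ofReal (k 0 i j x) * φ 0 x) *
          (ENNReal.ofReal (k 1 i j y) * φ 1 y) ∂μ := by
      intro i j
      simp_rw [lintegral_const_mul _ (hm 1 i j)]
      exact (hm 0 i j).mul_const _
    simp_rw [e1]
    simp_rw [← lintegral_finsetSum _ fun j _ => hm2 _ j]
    rw [← lintegral_finsetSum _ fun i _ => Finset.measurable_sum _ fun j _ => hm2 i j,
      ← lintegral_mul_const _ (hφ 0), ← lintegral_const_mul' _ _ ENNReal.ofReal_ne_top]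
    refine lintegral_mono fun x => ?_
    have hm3 : ∀ i j, Measurable fun y => (ENNReal.ofReal (k 0 i j x) * φ 0 x) *
          (ENNReal.ofReal (k 1 i j y) * φ 1 y) := fun i j => (hm 1 i j).const_mul _
    simp_rw [← lintegral_finsetSum _ fun j _ => hm3 _ j]
    rw [← lintegral_finsetSum _ fun i _ => Finset.measurable_sum _ fun j _ => hm3 i j,
      ← lintegral_const_mul _ (hφ 1), ← lintegral_const_mul' _ _ ENNReal.ofReal_ne_top]
    refine lintegral_mono fun y => ?_
    calc _ = (∑ i ∈ Finset.range N, ∑ j ∈ Finset.range N,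
          ENNReal.ofReal (k 0 i j x * k 1 i j y)) * (φ 0 x * φ 1 y) := by
          simp_rw [Finset.sum_mul]
          refine Finset.sum_congr rfl fun i _ => Finset.sum_congr rfl fun j _ => ?_
          rw [ENNReal.ofReal_mul (hk0 _ _ _ _)]
          ring
      _ = ENNReal.ofReal (∑ i ∈ Finset.range N, ∑ j ∈ Finset.range N, k 0 i j x * k 1 i j y) *
          (φ 0 x * φ 1 y) := by
          rw [ENNReal.ofReal_sum_of_nonneg fun i _ => Finset.sum_nonneg fun j _ =>
            mul_nonneg (hk0 _ _ _ _) (hk0 _ _ _ _)]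
          congr 1
          refine Finset.sum_congr rfl fun i _ => ?_
          rw [ENNReal.ofReal_sum_of_nonneg fun j _ => mul_nonneg (hk0 _ _ _ _) (hk0 _ _ _ _)]
      _ ≤ _ := by
          gcongr
          exact hker x y
  simp_rw [Fin.prod_univ_two]
  calc _ ≤ ∑ i ∈ Finset.range N, ∑ j ∈ Finset.range N,
        (C * (N * ∫⁻ x, ENNReal.ofReal (k 0 i j x) * φ 0 x ∂μ)) *
        (C * (N * ∫⁻ x, ENNReal.ofReal (k 1 i j x) * φ 1 x ∂μ)) := by
        refine Finset.sum_le_sum fun i hi => Finset.sum_le_sum fun j hj => ?_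
        rw [Finset.mem_range] at hi hj
        exact mul_le_mul' (hC _ (hα 0) a N i j hi hj _ (hf 0) (hsupp 0))
          (hC _ (hα 1) a N i j hi hj _ (hf 1) (hsupp 1))
    _ = C * C * (N : ℝ≥0∞) ^ 2 * ∑ i ∈ Finset.range N, ∑ j ∈ Finset.range N,
        (∫⁻ x, ENNReal.ofReal (k 0 i j x) * φ 0 x ∂μ) *
        (∫⁻ x, ENNReal.ofReal (k 1 i j x) * φ 1 x ∂μ) := by
        simp_rw [Finset.mul_sum]
        refine Finset.sum_congr rfl fun i _ => Finset.sum_congr rfl fun j _ => ?_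
        ring
    _ ≤ C * C * (N : ℝ≥0∞) ^ 2 *
        (ENNReal.ofReal (3 + D) * ((∫⁻ x, φ 0 x ∂μ) * ∫⁻ x, φ 1 x ∂μ)) := by gcongr
    _ = _ := by
        rw [ENNReal.coe_mul, ENNReal.coe_mul,
          show (((3 + D).toNNReal : ℝ≥0) : ℝ≥0∞) = ENNReal.ofReal (3 + D) from rfl]
        ring

/-- Minkowski's inequality for finite sums over two index sets. -/
theorem Lp_sum_le {ι κ : Type*} (s : Finset ι) (t : Finset κ) (X : κ → ι → ℝ≥0∞) {r : ℝ}
    (hr : 1 ≤ r) :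
    (∑ x ∈ s, (∑ b ∈ t, X b x) ^ r) ^ (1 / r) ≤ ∑ b ∈ t, (∑ x ∈ s, X b x ^ r) ^ (1 / r) := by
  classical
  have hr0 : 0 < r := by linarith
  induction t using Finset.induction_on with
  | empty => simp [hr0]
  | insert b t hb ih =>
    simp_rw [Finset.sum_insert hb]
    exact (ENNReal.Lp_add_le s _ _ hr).trans (add_le_add_right ih _)

theorem sum_rpow_sum_le {ι κ : Type*} (s : Finset ι) (t : Finset κ) (X : κ → ι → ℝ≥0∞)
    (Y : κ → ℝ≥0∞) {r : ℝ} (hr : 1 ≤ r) {K : ℝ≥0∞}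
    (h : ∀ b ∈ t, ∑ x ∈ s, X b x ^ r ≤ K * Y b ^ r) :
    ∑ x ∈ s, (∑ b ∈ t, X b x) ^ r ≤ K * (∑ b ∈ t, Y b) ^ r := by
  have hr0 : 0 < r := by linarith
  have h1 : (∑ x ∈ s, (∑ b ∈ t, X b x) ^ r) ^ (1 / r) ≤ K ^ (1 / r) * ∑ b ∈ t, Y b := by
    refine (Lp_sum_le s t X hr).trans ?_
    rw [Finset.mul_sum]
    refine Finset.sum_le_sum fun b hb => ?_
    calc _ ≤ (K * Y b ^ r) ^ (1 / r) := by gcongr; exact h b hb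
      _ = _ := by
        rw [ENNReal.mul_rpow_of_nonneg _ _ (by positivity), ← ENNReal.rpow_mul,
          mul_one_div_cancel hr0.ne', ENNReal.rpow_one]
  have h2 := ENNReal.rpow_le_rpow h1 hr0.le
  rwa [← ENNReal.rpow_mul, one_div_mul_cancel hr0.ne', ENNReal.rpow_one,
    ENNReal.mul_rpow_of_nonneg _ _ hr0.le, ← ENNReal.rpow_mul, one_div_mul_cancel hr0.ne',
    ENNReal.rpow_one] at h2

/-- Ball inflation. -/
theorem exists_ball_inflation {p : ℝ} (hp : 4 ≤ p) {c : ℝ} (hc : 0 < c) : ∃ C : ℝ≥0,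
    ∀ (N : ℕ) (S : Fin 2 → Finset ℕ) (α : ℕ → ℝ), 0 < N →
    (∀ l, ∀ k ∈ S l, α k ∈ Icc (0 : ℝ) 1) → (∀ k ∈ S 0, ∀ k' ∈ S 1, c ≤ |α k - α k'|) →
    ∀ (a : Plane) (f : ℕ → Plane → ℂ), (∀ k, Integrable (f k)) →
    (∀ k ξ, f k ξ ≠ 0 → ξ ∈ arcNhd (α k) N) →
      ∑ i ∈ Finset.range N, ∑ j ∈ Finset.range N,
        ∏ l, (∑ k ∈ S l, weightedAvg (p / 2) (gridCenter a N i j) N (𝓕⁻ (f k)) ^ 2) ^ (p / 4) ≤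
      C * (N : ℝ≥0∞) ^ 2 * ∏ l, (∑ k ∈ S l,
        weightedAvg (p / 2) (gridCenter a (N * N) 0 0) (N * N) (𝓕⁻ (f k)) ^ 2) ^ (p / 4) := by
  obtain ⟨C, hC⟩ := exists_bilinear_inflation (q := p / 2) (by linarith) hc
  refine ⟨C, fun N S α hN hα hαc a f hf hsupp => ?_⟩
  have hp0 : 0 < p / 2 := by linarith
  have hsq : ∀ (c : Plane) (L : ℝ) (G H : Plane → ℂ),
      (weightedAvg (p / 2) c L G ^ 2 * weightedAvg (p / 2) c L H ^ 2) ^ (p / 4) =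
        (∫⁻ x, ‖G x‖ₑ ^ (p / 2) ∂weightMeasure c L) *
          ∫⁻ x, ‖H x‖ₑ ^ (p / 2) ∂weightMeasure c L := by
    intro c L G H
    rw [← weightedAvg_rpow hp0, ← weightedAvg_rpow hp0,
      ENNReal.mul_rpow_of_nonneg _ _ (by linarith), ← ENNReal.rpow_two, ← ENNReal.rpow_two,
      ← ENNReal.rpow_mul, ← ENNReal.rpow_mul, show 2 * (p / 4) = p / 2 by ring]
  -- The product becomes an ℓ^(p/4) expression over pairs of arcs. As p/4 ≥ 1, Minkowski reduces the
  -- estimate to one pair, for which the averages are of |·|^(p/2).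
  have hprod : ∀ (A : ℕ → ℝ≥0∞), ∏ l, (∑ k ∈ S l, A k) ^ (p / 4) =
      (∑ b ∈ S 0 ×ˢ S 1, A b.1 * A b.2) ^ (p / 4) := by
    intro A
    rw [Fin.prod_univ_two, ← ENNReal.mul_rpow_of_nonneg _ _ (by linarith), Finset.sum_mul_sum,
      Finset.sum_product]
  have key := sum_rpow_sum_le (Finset.range N ×ˢ Finset.range N) (S 0 ×ˢ S 1)
    (fun b x => weightedAvg (p / 2) (gridCenter a N x.1 x.2) N (𝓕⁻ (f b.1)) ^ 2 *
      weightedAvg (p / 2) (gridCenter a N x.1 x.2) N (𝓕⁻ (f b.2)) ^ 2)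
    (fun b => weightedAvg (p / 2) (gridCenter a (N * N) 0 0) (N * N) (𝓕⁻ (f b.1)) ^ 2 *
      weightedAvg (p / 2) (gridCenter a (N * N) 0 0) (N * N) (𝓕⁻ (f b.2)) ^ 2)
    (r := p / 4) (K := C * (N : ℝ≥0∞) ^ 2) (by linarith) ?_
  · rw [Finset.sum_product] at key
    rw [hprod]
    refine le_trans (le_of_eq ?_) key
    exact Finset.sum_congr rfl fun i _ => Finset.sum_congr rfl fun j _ => hprod _
  rintro ⟨k, k'⟩ hb
  obtain ⟨hk, hk'⟩ := Finset.mem_product.1 hb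
  simp_rw [hsq]
  rw [Finset.sum_product]
  have h := hC (fun l => α (![k, k'] l)) (Fin.forall_fin_two.2 ⟨hα 0 k hk, hα 1 k' hk'⟩)
    (hαc k hk k' hk') a N (fun l => f (![k, k'] l)) hN (fun l => hf _) (fun l => hsupp _)
  simp_rw [Fin.prod_univ_two] at h
  exact h

/-! ### The decoupling constant -/

/-- `D` is an admissible constant in the decoupling inequality defining `decouplingConst n p`. -/
def IsDecouplingBound (n : ℕ) (p : ℝ) (D : ℝ≥0∞) : Prop :=
  ∀ F Fhat : Plane → ℂ, HasFourierTransform F Fhat →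
    SupportedIn Fhat (parabolaNhd ((4 : ℝ) ^ n)⁻¹) →
    eLpNorm F (ENNReal.ofReal p) volume ≤
      D * (∑ j ∈ Finset.range (2 ^ n),
        eLpNorm (fourierProj (dyadicInterval n j) Fhat) (ENNReal.ofReal p) volume ^ 2)
          ^ (1 / 2 : ℝ)

theorem decouplingConst_eq (n : ℕ) (p : ℝ) :
    decouplingConst n p = sInf {D | IsDecouplingBound n p D} := rfl

theorem measurableSet_parabolaNhd (δ : ℝ) : MeasurableSet (parabolaNhd δ) := by
  have h0 : Measurable fun ξ : Plane => ξ 0 := by fun_prop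
  have h1 : Measurable fun ξ : Plane => ξ 1 - ξ 0 ^ 2 := by fun_prop
  exact (h0 measurableSet_Icc).inter (h1 measurableSet_Icc)

theorem continuous_fourierProj {f : Plane → ℂ} (hf : Integrable f) (σ k : ℕ) :
    Continuous (fourierProj (dyadicInterval σ k) f) := by
  rw [fourierProj_eq_strip (Filter.EventuallyEq.refl _ f)]
  exact continuous_fourierInv (hf.indicator (measurableSet_strip _ _))

theorem eq_sum_fourierProj {F f : Plane → ℂ} {δ : ℝ} (hF : HasFourierTransform F f)
    (hf : SupportedIn f (parabolaNhd δ)) (n : ℕ) :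
    F =ᵐ[volume] fun x => ∑ j ∈ Finset.range (2 ^ n), fourierProj (dyadicInterval n j) f x := by
  have h0 : f =ᵐ[volume] indicator (strip 0 0) f := by
    have h := volume_vertical_line 1
    filter_upwards [hf, compl_mem_ae_iff.2 h] with ξ h1 h2
    by_cases hξ : ξ ∈ parabolaNhd δ
    · rw [indicator_of_mem]
      have h3 := hξ.1
      have h2' : ξ 0 ≠ 1 := h2
      exact ⟨by simpa using h3.1, by simpa using lt_of_le_of_ne h3.2 h2'⟩
    · rw [h1 hξ, eq_comm, indicator_apply_eq_zero]
      exact fun _ => h1 hξ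
  refine hF.2.trans (Filter.Eventually.of_forall fun x => ?_)
  have h1 := fourierProj_eq_sum hF.1 0 n 0 x
  rw [fourierProj_eq_strip (Filter.EventuallyEq.refl _ f), ← Real.fourierInv_congr_ae h0] at h1
  simpa using h1

/-- The triangle inequality, with each term bounded by the whole square function. Its role is to
make the set in the infimum nonempty. -/
theorem isDecouplingBound_two_pow (n : ℕ) {p : ℝ} (hp : 1 ≤ p) :
    IsDecouplingBound n p (2 ^ n) := by
  intro F f hF hf
  rw [eLpNorm_congr_ae (eq_sum_fourierProj hF hf n)]
  have h1 : (fun x => ∑ j ∈ Finset.range (2 ^ n), fourierProj (dyadicInterval n j) f x) =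
      ∑ j ∈ Finset.range (2 ^ n), fourierProj (dyadicInterval n j) f := by
    ext x; rw [Finset.sum_apply]
  rw [h1]
  refine (eLpNorm_sum_le (fun j _ => (continuous_fourierProj hF.1 n j).aestronglyMeasurable)
    (by simpa using hp)).trans ?_
  set a := fun j => eLpNorm (fourierProj (dyadicInterval n j) f) (ENNReal.ofReal p) volume
  have h2 : ∀ j ∈ Finset.range (2 ^ n), a j ≤
      (∑ j ∈ Finset.range (2 ^ n), a j ^ 2) ^ (1 / 2 : ℝ) := by
    intro j hj
    calc a j = (a j ^ 2) ^ (1 / 2 : ℝ) := by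
          rw [← ENNReal.rpow_two, ← ENNReal.rpow_mul]; norm_num
      _ ≤ _ := by
          gcongr
          exact Finset.single_le_sum (f := fun j => a j ^ 2) (fun _ _ => zero_le) hj
  refine (Finset.sum_le_sum h2).trans ?_
  rw [Finset.sum_const, Finset.card_range, nsmul_eq_mul]
  push_cast
  exact le_rfl

/-! ### Affine changes of variables -/

theorem exists_map_volume_eq_smul (A : Plane ≃L[ℝ] Plane) :
    ∃ t : ℝ, 0 < t ∧ (volume : Measure Plane).map A = ENNReal.ofReal t • volume := by
  have hdet : LinearMap.det ((A : Plane →L[ℝ] Plane) : Plane →ₗ[ℝ] Plane) ≠ 0 :=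
    (LinearEquiv.isUnit_det' A.toLinearEquiv).ne_zero
  exact ⟨_, abs_pos.2 (inv_ne_zero hdet), Measure.map_linearMap_addHaar_eq_smul_addHaar volume hdet⟩

theorem integrable_comp_affine (A : Plane ≃L[ℝ] Plane) (b : Plane) {φ : Plane → ℂ}
    (hφ : Integrable φ) : Integrable fun ξ => φ (A (ξ - b)) := by
  obtain ⟨t, _, hA⟩ := exists_map_volume_eq_smul A
  have h1 : Integrable (φ ∘ A) := by
    refine (A.toHomeomorph.measurableEmbedding.integrable_map_iff).1 ?_
    change Integrable φ ((volume : Measure Plane).map A)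
    rw [hA]
    exact hφ.smul_measure ENNReal.ofReal_ne_top
  exact h1.comp_sub_right b

theorem exists_fourierInv_comp_affine (A A' : Plane ≃L[ℝ] Plane) (b : Plane)
    (hA : ∀ ξ x, inner ℝ (A ξ) x = inner ℝ ξ (A' x)) : ∃ t : ℝ, 0 < t ∧ ∀ (φ : Plane → ℂ) (x : Plane),
      𝓕⁻ (fun ξ => φ (A.symm (ξ - b))) x =
        (t : ℂ) * (((𝐞 (inner ℝ b x) : Circle) : ℂ) * 𝓕⁻ φ (A' x)) := by
  obtain ⟨t, ht, hmap⟩ := exists_map_volume_eq_smul A.symm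
  refine ⟨t, ht, fun φ x => ?_⟩
  rw [Real.fourierInv_eq]
  have h1 : ∫ ξ, 𝐞 (inner ℝ ξ x) • φ (A.symm (ξ - b)) =
      ∫ ξ, 𝐞 (inner ℝ (A (A.symm ξ) + b) x) • φ (A.symm ξ) := by
    rw [← integral_sub_right_eq_self _ (-b)]
    simp only [sub_neg_eq_add, add_sub_cancel_right, ContinuousLinearEquiv.apply_symm_apply]
  rw [h1]
  refine (A.symm.toHomeomorph.measurableEmbedding.integral_map
    (fun ζ => 𝐞 (inner ℝ (A ζ + b) x) • φ ζ)).symm.trans ?_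
  change ∫ ζ, _ ∂((volume : Measure Plane).map A.symm) = _
  rw [hmap, integral_smul_measure, ENNReal.toReal_ofReal ht.le, Real.fourierInv_eq,
    Complex.real_smul, ← integral_const_mul]
  rw [← integral_const_mul, ← integral_const_mul]
  refine integral_congr_ae (Filter.Eventually.of_forall fun ζ => ?_)
  dsimp only
  rw [inner_add_left, hA, AddChar.map_add_eq_mul, Circle.smul_def, Circle.smul_def, Circle.coe_mul]
  simp only [smul_eq_mul]
  ring

theorem exists_eLpNorm_comp_linear (A : Plane ≃L[ℝ] Plane) (p : ℝ) :
    ∃ s : ℝ≥0∞, s ≠ 0 ∧ s ≠ ∞ ∧ ∀ G : Plane → ℂ, Continuous G →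
      eLpNorm (fun x => G (A x)) (ENNReal.ofReal p) volume =
        s * eLpNorm G (ENNReal.ofReal p) volume := by
  obtain ⟨t, ht, hA⟩ := exists_map_volume_eq_smul A
  refine ⟨ENNReal.ofReal t ^ (1 / ENNReal.ofReal p).toReal, ?_, ?_, fun G hG => ?_⟩
  · rw [ne_eq, ENNReal.rpow_eq_zero_iff]
    simp [ht]
  · exact ENNReal.rpow_ne_top_of_nonneg ENNReal.toReal_nonneg ENNReal.ofReal_ne_top
  · have h := eLpNorm_map_measure (p := ENNReal.ofReal p) (g := G) (f := A) (μ := volume)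
      hG.aestronglyMeasurable A.continuous.aemeasurable
    rw [hA, eLpNorm_smul_measure_of_ne_top ENNReal.ofReal_ne_top, smul_eq_mul] at h
    exact h.symm

/-- Decoupling for families of functions whose Fourier supports lie over the dyadic intervals after
an affine change of variables. -/
theorem IsDecouplingBound.affine {n : ℕ} {p : ℝ} {D : ℝ≥0∞} (hD : IsDecouplingBound n p D)
    (A A' : Plane ≃L[ℝ] Plane) (b : Plane) (hA : ∀ ξ x, inner ℝ (A ξ) x = inner ℝ ξ (A' x))
    {h : ℕ → Plane → ℂ} (hh : ∀ i, Integrable (h i))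
    (hsupp : ∀ i ∈ Finset.range (2 ^ n), ∀ ξ, h i ξ ≠ 0 →
      A ξ + b ∈ parabolaNhd ((4 : ℝ) ^ n)⁻¹ ∧ A ξ + b ∈ strip n i) :
    eLpNorm (fun x => ∑ i ∈ Finset.range (2 ^ n), 𝓕⁻ (h i) x) (ENNReal.ofReal p) volume ≤
      D * (∑ i ∈ Finset.range (2 ^ n),
        eLpNorm (𝓕⁻ (h i)) (ENNReal.ofReal p) volume ^ 2) ^ (1 / 2 : ℝ) := by
  obtain ⟨t, ht, hFt⟩ := exists_fourierInv_comp_affine A A' b hA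
  obtain ⟨s, hs0, hs, hnorm⟩ := exists_eLpNorm_comp_linear A' p
  let H : ℕ → Plane → ℂ := fun i ξ => h i (A.symm (ξ - b))
  have hH : ∀ i, Integrable (H i) := fun i => integrable_comp_affine A.symm b (hh i)
  have hHsupp : ∀ i ∈ Finset.range (2 ^ n), ∀ ξ, H i ξ ≠ 0 →
      ξ ∈ parabolaNhd ((4 : ℝ) ^ n)⁻¹ ∧ ξ ∈ strip n i := by
    intro i hi ξ hξ
    have := hsupp i hi _ hξ
    rwa [ContinuousLinearEquiv.apply_symm_apply, sub_add_cancel] at this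
  let f : Plane → ℂ := fun ξ => ∑ i ∈ Finset.range (2 ^ n), H i ξ
  have hf : Integrable f := integrable_finsetSum _ fun i _ => hH i
  have hproj : ∀ i ∈ Finset.range (2 ^ n), fourierProj (dyadicInterval n i) f = 𝓕⁻ (H i) := by
    intro i hi
    rw [fourierProj_eq_strip (Filter.EventuallyEq.refl _ f)]
    congr 1
    ext ξ
    by_cases hξ : ξ ∈ strip n i
    · rw [indicator_of_mem hξ]
      refine Finset.sum_eq_single_of_mem i hi fun j hj hji => ?_
      by_contra hne
      exact hji (strip_index_unique (hHsupp j hj ξ hne).2 hξ)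
    · rw [indicator_of_notMem hξ]
      by_contra hne
      exact hξ (hHsupp i hi ξ (Ne.symm hne)).2
  have hkey := hD (𝓕⁻ f) f ⟨hf, Filter.EventuallyEq.refl _ _⟩
    (Filter.Eventually.of_forall fun ξ hξ => Finset.sum_eq_zero fun i hi => by
      by_contra hne
      exact hξ (hHsupp i hi ξ hne).1)
  have hchar : ∀ x : Plane, ‖((𝐞 (inner ℝ b x) : Circle) : ℂ)‖ = 1 := fun x => Circle.norm_coe _
  -- The modulation is unimodular, so the affine map multiplies every norm by the same constant t s.
  -- It is finite and nonzero and cancels, so its value is irrelevant.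
  have hscale : ∀ (G G' : Plane → ℂ), Continuous G' →
      (∀ x, G x = (t : ℂ) * (((𝐞 (inner ℝ b x) : Circle) : ℂ) * G' (A' x))) →
      eLpNorm G (ENNReal.ofReal p) volume =
        ENNReal.ofReal t * s * eLpNorm G' (ENNReal.ofReal p) volume := by
    intro G G' hG' hGG'
    rw [mul_assoc, ← hnorm G' hG']
    have h1 : eLpNorm G (ENNReal.ofReal p) volume =
        eLpNorm ((t : ℂ) • fun x => G' (A' x)) (ENNReal.ofReal p) volume := by
      refine eLpNorm_congr_norm_ae (Filter.Eventually.of_forall fun x => ?_)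
      rw [hGG' x, norm_mul, norm_mul, hchar, one_mul, Pi.smul_apply, norm_smul]
    rw [h1, eLpNorm_const_smul]
    congr 1
    rw [← ofReal_norm, Complex.norm_real, Real.norm_of_nonneg ht.le]
  have hsum : ∀ x, 𝓕⁻ f x = (t : ℂ) * (((𝐞 (inner ℝ b x) : Circle) : ℂ) *
      ∑ i ∈ Finset.range (2 ^ n), 𝓕⁻ (h i) (A' x)) := by
    intro x
    rw [fourierInv_finset_sum _ fun i _ => hH i, Finset.mul_sum, Finset.mul_sum]
    exact Finset.sum_congr rfl fun i _ => hFt (h i) x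
  have hc : ∀ i, Continuous (𝓕⁻ (h i)) := fun i => continuous_fourierInv (hh i)
  have hleft := hscale (𝓕⁻ f) (fun x => ∑ i ∈ Finset.range (2 ^ n), 𝓕⁻ (h i) x)
    (continuous_finsetSum _ fun i _ => hc i) hsum
  rw [hleft] at hkey
  have hterm : ∀ i ∈ Finset.range (2 ^ n),
      eLpNorm (fourierProj (dyadicInterval n i) f) (ENNReal.ofReal p) volume ^ 2 =
        (ENNReal.ofReal t * s) ^ 2 * eLpNorm (𝓕⁻ (h i)) (ENNReal.ofReal p) volume ^ 2 := by
    intro i hi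
    rw [hproj i hi, hscale (𝓕⁻ (H i)) (𝓕⁻ (h i)) (hc i) (hFt (h i)), mul_pow]
  rw [Finset.sum_congr rfl hterm, ← Finset.mul_sum, ENNReal.mul_rpow_of_nonneg _ _ (by norm_num),
    ← ENNReal.rpow_two, ← ENNReal.rpow_mul, mul_one_div_cancel two_ne_zero, ENNReal.rpow_one,
    mul_left_comm] at hkey
  exact (ENNReal.mul_le_mul_iff_right (mul_ne_zero (by simpa using ht) hs0)
    (ENNReal.mul_ne_top ENNReal.ofReal_ne_top hs)).1 hkey

/-- The linear part of the parabolic rescaling `x ↦ λ (x - x₀)`. -/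
def parabolicMap (lam x₀ : ℝ) (hlam : lam ≠ 0) : Plane ≃L[ℝ] Plane :=
  LinearEquiv.toContinuousLinearEquiv
    { toFun := fun ξ => !₂[lam * ξ 0, lam ^ 2 * (ξ 1 - 2 * x₀ * ξ 0)]
      invFun := fun ζ => !₂[ζ 0 / lam, ζ 1 / lam ^ 2 + 2 * x₀ * (ζ 0 / lam)]
      map_add' := fun x y => by ext i; fin_cases i <;> simp <;> ring
      map_smul' := fun s x => by ext i; fin_cases i <;> simp <;> ring
      left_inv := fun x => by ext i; fin_cases i <;> simp <;> field_simp; ring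
      right_inv := fun x => by ext i; fin_cases i <;> simp <;> field_simp }

/-- The transpose of `parabolicMap`. -/
def parabolicMapAdj (lam x₀ : ℝ) (hlam : lam ≠ 0) : Plane ≃L[ℝ] Plane :=
  LinearEquiv.toContinuousLinearEquiv
    { toFun := fun x => !₂[lam * x 0 - 2 * lam ^ 2 * x₀ * x 1, lam ^ 2 * x 1]
      invFun := fun y => !₂[(y 0 + 2 * x₀ * y 1) / lam, y 1 / lam ^ 2]
      map_add' := fun x y => by ext i; fin_cases i <;> simp <;> ring
      map_smul' := fun s x => by ext i; fin_cases i <;> simp <;> ring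
      left_inv := fun x => by ext i; fin_cases i <;> simp <;> field_simp; ring
      right_inv := fun x => by ext i; fin_cases i <;> simp <;> field_simp; ring }

theorem parabolicMap_zero (lam x₀ : ℝ) (hlam : lam ≠ 0) (ξ : Plane) :
    parabolicMap lam x₀ hlam ξ 0 = lam * ξ 0 := rfl

theorem parabolicMap_one (lam x₀ : ℝ) (hlam : lam ≠ 0) (ξ : Plane) :
    parabolicMap lam x₀ hlam ξ 1 = lam ^ 2 * (ξ 1 - 2 * x₀ * ξ 0) := rfl

theorem inner_parabolicMap (lam x₀ : ℝ) (hlam : lam ≠ 0) (ξ x : Plane) :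
    inner ℝ (parabolicMap lam x₀ hlam ξ) x = inner ℝ ξ (parabolicMapAdj lam x₀ hlam x) := by
  have h0 : parabolicMapAdj lam x₀ hlam x 0 = lam * x 0 - 2 * lam ^ 2 * x₀ * x 1 := rfl
  have h1 : parabolicMapAdj lam x₀ hlam x 1 = lam ^ 2 * x 1 := rfl
  simp only [PiLp.inner_apply, Fin.sum_univ_two, parabolicMap_zero, parabolicMap_one, h0, h1,
    RCLike.inner_apply, conj_trivial]
  ring

/-! ### Weighted decoupling -/

theorem sum_range_mul_eq {M : Type*} [AddCommMonoid M] (g : ℕ → M) (A B : ℕ) :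
    ∑ j ∈ Finset.range (A * B), g j =
      ∑ i ∈ Finset.range A, ∑ r ∈ Finset.range B, g (i * B + r) := by
  induction A with
  | zero => simp
  | succ A ih => rw [Nat.succ_mul, Finset.sum_range_add, ih, Finset.sum_range_succ]

/-- The blur z moves a piece by less than its own length in ξ₀ and by a bounded multiple of
4^(-(m+n)) in height. Taking λ = 2^m/4 instead of 2^m puts every fourth piece, blur included, into
its own dyadic strip and leaves room in height. -/
theorem parabolicMap_add_mem (m n k i r : ℕ) (hi : i < 2 ^ n) {y z : Plane}
    (hy : y ∈ parabolaNhd ((4 : ℝ) ^ (m + n))⁻¹)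
    (hy' : y ∈ strip (m + n) (k * 2 ^ n + (i * 4 + r))) (hz : ‖z‖ < ((4 : ℝ) ^ (m + n))⁻¹)
    (lam x₀ : ℝ) (hlam : lam ≠ 0) (b : Plane) (hl : lam = 2 ^ m / 4)
    (hx : x₀ = k / 2 ^ m + (r - 1) / 2 ^ (m + n)) (hb0 : b 0 = -(lam * x₀))
    (hb1 : b 1 = lam ^ 2 * (x₀ ^ 2 + 4 * ((4 : ℝ) ^ (m + n))⁻¹)) :
    parabolicMap lam x₀ hlam (y + z) + b ∈ parabolaNhd ((4 : ℝ) ^ n)⁻¹ ∧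
      parabolicMap lam x₀ hlam (y + z) + b ∈ strip n i := by
  set P : ℝ := 2 ^ m with hP
  set Q : ℝ := 2 ^ n with hQ
  have hP1 : 1 ≤ P := one_le_pow₀ one_le_two
  have hQ1 : 1 ≤ Q := one_le_pow₀ one_le_two
  have hP0 : 0 < P := by positivity
  have hQ0 : 0 < Q := by positivity
  have h4n : (4 : ℝ) ^ n = Q ^ 2 := by
    rw [hQ, ← pow_mul, mul_comm, pow_mul]; norm_num
  have h4 : (4 : ℝ) ^ (m + n) = (P * Q) ^ 2 := by
    rw [hQ, hP, ← pow_add, ← pow_mul, mul_comm, pow_mul]; norm_num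
  have h2 : (2 : ℝ) ^ (m + n) = P * Q := pow_add _ _ _
  set w : ℝ := P * Q with hw
  have hw1 : 1 ≤ w := one_le_mul_of_one_le_of_one_le hP1 hQ1
  have hw0 : 0 < w := by positivity
  rw [h4] at hy hz hb1
  rw [h2] at hx
  rw [h4n]
  set δ : ℝ := (w ^ 2)⁻¹ with hδ
  have hδ0 : 0 < δ := by positivity
  have hwδ : w * δ ≤ 1 := by
    rw [hδ, pow_two, mul_inv, ← mul_assoc, mul_inv_cancel₀ hw0.ne', one_mul]
    exact inv_le_one_of_one_le₀ hw1
  have hδ1 : δ ≤ 1 := inv_le_one_of_one_le₀ (one_le_pow₀ hw1)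
  have hz0 := abs_lt.1 ((abs_coord_le_norm z 0).trans_lt hz)
  have hz1 := abs_lt.1 ((abs_coord_le_norm z 1).trans_lt hz)
  obtain ⟨⟨hy0, hy1⟩, hy2, hy3⟩ := hy
  obtain ⟨hs, hs'⟩ := hy'
  rw [h2, div_le_iff₀ hw0] at hs
  rw [h2, lt_div_iff₀ hw0] at hs'
  push_cast at hs hs'
  rw [← hQ] at hs hs'
  have ht : -1 < w * z 0 ∧ w * z 0 < 1 := by
    have h1 := mul_lt_mul_of_pos_left hz0.1 hw0
    have h2 := mul_lt_mul_of_pos_left hz0.2 hw0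
    constructor <;> linarith
  have e0 : (parabolicMap lam x₀ hlam (y + z) + b) 0 = lam * (y 0 + z 0 - x₀) := by
    simp only [PiLp.add_apply, parabolicMap_zero, hb0]; ring
  have e1 : (parabolicMap lam x₀ hlam (y + z) + b) 1 - (lam * (y 0 + z 0 - x₀)) ^ 2 =
      lam ^ 2 * ((y 1 - y 0 ^ 2) + z 1 - 2 * (y 0 * z 0) - z 0 ^ 2 + 4 * δ) := by
    simp only [PiLp.add_apply, parabolicMap_one, hb1]; ring
  -- The numerator lies strictly between 4i and 4i + 3: the -1 in x₀ makes room for the blur on the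
  -- left.
  have hu : lam * (y 0 + z 0 - x₀) = (w * y 0 + w * z 0 - (k * Q + r - 1)) / (4 * Q) := by
    rw [hl, hx, hw]; field_simp; ring
  have hu0 : (i : ℝ) / Q ≤ lam * (y 0 + z 0 - x₀) := by
    rw [hu, ← mul_div_mul_left _ _ (four_ne_zero (α := ℝ))]
    exact div_le_div_of_nonneg_right (by linarith [ht.1]) (by positivity)
  have hu1 : lam * (y 0 + z 0 - x₀) < ((i : ℝ) + 1) / Q := by
    rw [hu, ← mul_div_mul_left _ Q (four_ne_zero (α := ℝ))]
    exact div_lt_div_of_pos_right (by linarith [ht.2]) (by positivity)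
  have hi' : (i : ℝ) + 1 ≤ Q := by
    rw [hQ]; exact_mod_cast hi
  -- The height error is at least -4δ, which the upward shift by 4δ offsets; then the height is at
  -- most 8δ, and λ² · 8δ is half of Q^(-2).
  have hl2 : lam ^ 2 * (8 * δ) ≤ (Q ^ 2)⁻¹ := by
    have : lam ^ 2 * (8 * δ) = (Q ^ 2)⁻¹ / 2 := by
      rw [hl, hδ, hw]; field_simp; ring
    rw [this]
    have : 0 < (Q ^ 2)⁻¹ := by positivity
    linarith
  have hyz : |y 0 * z 0| ≤ δ := by
    rw [abs_mul, abs_of_nonneg hy0]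
    exact (mul_le_of_le_one_left (abs_nonneg _) hy1).trans (abs_le.2 ⟨hz0.1.le, hz0.2.le⟩)
  have hyz' := abs_le.1 hyz
  have hzz : z 0 ^ 2 ≤ δ :=
    (sq_le_sq' hz0.1.le hz0.2.le).trans (pow_le_of_le_one hδ0.le hδ1 two_ne_zero)
  refine ⟨⟨?_, ?_⟩, ?_, ?_⟩
  · rw [e0]
    refine ⟨le_trans (by positivity) hu0, hu1.le.trans ?_⟩
    rw [div_le_one hQ0]; exact hi'
  · rw [e0, e1]
    refine ⟨mul_nonneg (sq_nonneg _) (by linarith [hyz'.2, hz1.1]), le_trans ?_ hl2⟩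
    refine mul_le_mul_of_nonneg_left ?_ (sq_nonneg _)
    linarith [hyz'.1, hz1.2, sq_nonneg (z 0)]
  · rw [e0]; exact hu0
  · rw [e0]; exact hu1

/-- Decoupling on a strip of width `2^(-m)` for functions multiplied by a band-limited weight. -/
theorem IsDecouplingBound.strip_mul {n : ℕ} {p : ℝ} (hp : 1 ≤ p) {D : ℝ≥0∞}
    (hD : IsDecouplingBound n p D) (m k : ℕ) {f κ : Plane → ℂ} (hf : Integrable f)
    (hsupp : ∀ ξ, f ξ ≠ 0 → ξ ∈ parabolaNhd ((4 : ℝ) ^ (m + n))⁻¹) (hκi : Integrable κ)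
    (hκ : ∀ ξ, ((4 : ℝ) ^ (m + n))⁻¹ ≤ ‖ξ‖ → κ ξ = 0) :
    eLpNorm (fun x => fourierProj (dyadicInterval m k) f x * 𝓕⁻ κ x) (ENNReal.ofReal p) volume ≤
      4 * (D * (∑ j ∈ Finset.range (2 ^ n),
        eLpNorm (fun x => fourierProj (dyadicInterval (m + n) (k * 2 ^ n + j)) f x * 𝓕⁻ κ x)
          (ENNReal.ofReal p) volume ^ 2) ^ (1 / 2 : ℝ)) := by
  classical
  let g : ℕ → Plane → ℂ := fun j => indicator (strip (m + n) (k * 2 ^ n + j)) f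
  have hg : ∀ j, Integrable (g j) := fun j => hf.indicator (measurableSet_strip _ _)
  have hproj : ∀ j, fourierProj (dyadicInterval (m + n) (k * 2 ^ n + j)) f = 𝓕⁻ (g j) :=
    fun j => fourierProj_eq_strip (Filter.EventuallyEq.refl _ f) _ _
  -- Extended by zero beyond 2^n, so that each of the four residue classes mod 4 can be indexed by
  -- the full range of i < 2^n.
  let H : ℕ → Plane → ℂ := fun j =>
    if j < 2 ^ n then g j ⋆[ContinuousLinearMap.mul ℂ ℂ] κ else 0
  have hH : ∀ j, Integrable (H j) := by
    intro j
    by_cases hj : j < 2 ^ n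
    · simp only [H, if_pos hj]
      exact (hg j).integrable_convolution _ hκi
    · simp only [H, if_neg hj]
      exact integrable_zero _ _ _
  have hH1 : ∀ j, j < 2 ^ n → 𝓕⁻ (H j) = fun x => 𝓕⁻ (g j) x * 𝓕⁻ κ x := by
    intro j hj
    ext x
    simp only [H, if_pos hj]
    exact fourierInv_convolution (hg j) hκi x
  have hH0 : ∀ j, ¬ j < 2 ^ n → 𝓕⁻ (H j) = 0 := by
    intro j hj
    ext x
    simp [H, if_neg hj, Real.fourierInv_eq]
  have hlamne : (2 : ℝ) ^ m / 4 ≠ 0 := by positivity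
  have hblock : ∀ r : ℕ, eLpNorm (fun x => ∑ i ∈ Finset.range (2 ^ n), 𝓕⁻ (H (i * 4 + r)) x)
      (ENNReal.ofReal p) volume ≤ D * (∑ i ∈ Finset.range (2 ^ n),
        eLpNorm (𝓕⁻ (H (i * 4 + r))) (ENNReal.ofReal p) volume ^ 2) ^ (1 / 2 : ℝ) := by
    intro r
    set x₀ : ℝ := k / 2 ^ m + (r - 1) / 2 ^ (m + n) with hx₀
    refine hD.affine (parabolicMap _ x₀ hlamne) (parabolicMapAdj _ x₀ hlamne)
      !₂[-(2 ^ m / 4 * x₀), (2 ^ m / 4) ^ 2 * (x₀ ^ 2 + 4 * ((4 : ℝ) ^ (m + n))⁻¹)]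
      (inner_parabolicMap _ x₀ hlamne) (h := fun i => H (i * 4 + r)) (fun i => hH _) ?_
    intro i hi ξ hξ
    by_cases hj : i * 4 + r < 2 ^ n
    · have hξ' : ξ ∈ Function.support (g (i * 4 + r) ⋆[ContinuousLinearMap.mul ℂ ℂ] κ) := by
        simp only [H, if_pos hj] at hξ
        exact hξ
      obtain ⟨y, hy, z, hz, rfl⟩ := support_convolution_subset _ hξ'
      have hy1 : y ∈ strip (m + n) (k * 2 ^ n + (i * 4 + r)) := by
        by_contra hne
        exact hy (indicator_of_notMem hne _)
      have hy2 : f y ≠ 0 := by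
        intro h0
        exact hy (by simp only [g, indicator_of_mem hy1, h0])
      have hz' : ‖z‖ < ((4 : ℝ) ^ (m + n))⁻¹ := by
        by_contra hne
        exact hz (hκ z (not_lt.1 hne))
      exact parabolicMap_add_mem m n k i r (Finset.mem_range.1 hi) (hsupp y hy2) hy1 hz' _ x₀ hlamne
        _ rfl hx₀ rfl rfl
    · simp only [H, if_neg hj] at hξ
      exact absurd rfl hξ
  set N : ℕ → ℝ≥0∞ := fun j => eLpNorm (𝓕⁻ (H j)) (ENNReal.ofReal p) volume with hN
  have hle : ∀ r ∈ Finset.range 4, ∑ i ∈ Finset.range (2 ^ n), N (i * 4 + r) ^ 2 ≤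
      ∑ j ∈ Finset.range (2 ^ n), N j ^ 2 := by
    intro r hr
    calc ∑ i ∈ Finset.range (2 ^ n), N (i * 4 + r) ^ 2
        ≤ ∑ i ∈ Finset.range (2 ^ n), ∑ r ∈ Finset.range 4, N (i * 4 + r) ^ 2 :=
          Finset.sum_le_sum fun i _ => Finset.single_le_sum
            (f := fun r => N (i * 4 + r) ^ 2) (fun _ _ => zero_le) hr
      _ = ∑ j ∈ Finset.range (2 ^ n * 4), N j ^ 2 :=
          (sum_range_mul_eq (fun j => N j ^ 2) _ _).symm
      _ = _ := by
          refine (Finset.sum_subset (Finset.range_subset_range.2 (by omega)) ?_).symm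
          intro j _ hj
          simp only [hN, hH0 j (by simpa using hj), eLpNorm_zero]
          simp
  have hpt : (fun x => fourierProj (dyadicInterval m k) f x * 𝓕⁻ κ x) =
      ∑ r ∈ Finset.range 4, fun x => ∑ i ∈ Finset.range (2 ^ n), 𝓕⁻ (H (i * 4 + r)) x := by
    ext x
    rw [Finset.sum_apply, Finset.sum_comm, ← sum_range_mul_eq (fun j => 𝓕⁻ (H j) x),
      fourierProj_eq_sum hf m n k x, Finset.sum_mul]
    rw [← Finset.sum_subset (Finset.range_subset_range.2 (by omega : 2 ^ n ≤ 2 ^ n * 4))]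
    · refine Finset.sum_congr rfl fun j hj => ?_
      rw [hproj, hH1 j (Finset.mem_range.1 hj)]
    · intro j _ hj
      rw [hH0 j (by simpa using hj), Pi.zero_apply]
  have hc : ∀ j, Continuous (𝓕⁻ (H j)) := fun j => continuous_fourierInv (hH j)
  rw [hpt]
  refine (eLpNorm_sum_le (fun r _ => (continuous_finsetSum _ fun i _ =>
    hc (i * 4 + r)).aestronglyMeasurable) (by simpa using hp)).trans ?_
  have hR : ∑ j ∈ Finset.range (2 ^ n),
      eLpNorm (fun x => fourierProj (dyadicInterval (m + n) (k * 2 ^ n + j)) f x * 𝓕⁻ κ x)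
        (ENNReal.ofReal p) volume ^ 2 = ∑ j ∈ Finset.range (2 ^ n), N j ^ 2 := by
    refine Finset.sum_congr rfl fun j hj => ?_
    simp only [hN]
    rw [hproj, hH1 j (Finset.mem_range.1 hj)]
  rw [hR]
  calc _ ≤ ∑ r ∈ Finset.range 4,
        D * (∑ j ∈ Finset.range (2 ^ n), N j ^ 2) ^ (1 / 2 : ℝ) := by
        refine Finset.sum_le_sum fun r hr => (hblock r).trans ?_
        exact mul_le_mul_right (ENNReal.rpow_le_rpow (hle r hr) (by norm_num)) D
    _ = _ := by rw [Finset.sum_const, Finset.card_range, nsmul_eq_mul]; norm_num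

/-- Since v and its band-limited substitute are comparable pointwise, L^p norms may be exchanged on
both sides of the inequality; the constant depends on the growth exponent d alone. -/
theorem exists_decoupling_mul_weight (d : ℕ) : ∃ C : ℝ≥0, ∀ v : Plane → ℝ,
    Continuous v → Integrable v → (∀ x, 0 < v x) → (∀ x, v x ≤ 1) →
    (∀ x y, v (x + y) ≤ v x * (1 + ‖y‖) ^ d) →
    ∀ (p : ℝ), 1 ≤ p → ∀ (n : ℕ) (D : ℝ≥0∞), IsDecouplingBound n p D →
    ∀ (m k : ℕ) (f : Plane → ℂ), Integrable f →
    (∀ ξ, f ξ ≠ 0 → ξ ∈ parabolaNhd ((4 : ℝ) ^ (m + n))⁻¹) → ∀ c : Plane,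
    eLpNorm (fun x => fourierProj (dyadicInterval m k) f x *
        (v (((4 : ℝ) ^ (m + n))⁻¹ • (x - c)) : ℂ)) (ENNReal.ofReal p) volume ≤
      C * (D * (∑ j ∈ Finset.range (2 ^ n),
        eLpNorm (fun x => fourierProj (dyadicInterval (m + n) (k * 2 ^ n + j)) f x *
          (v (((4 : ℝ) ^ (m + n))⁻¹ • (x - c)) : ℂ)) (ENNReal.ofReal p) volume ^ 2)
            ^ (1 / 2 : ℝ)) := by
  obtain ⟨C, hC, h⟩ := exists_bandlimited_weight_scaled d
  let K : ℝ≥0 := ⟨C, hC.le⟩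
  have hK : ENNReal.ofReal C = K := ENNReal.ofReal_eq_coe_nnreal hC.le
  refine ⟨K * (4 * K), fun v hvc hvi hv0 hv1 hv p hp n D hD m k f hf hsupp c => ?_⟩
  obtain ⟨η, κ, _, hκi, hκ, _, _, hη, hcomp⟩ :=
    h v hvc hvi hv0 hv1 hv c ((4 : ℝ) ^ (m + n)) (by positivity)
  set u : Plane → ℝ := fun x => v (((4 : ℝ) ^ (m + n))⁻¹ • (x - c)) with hu
  have hu0 : ∀ x, 0 < u x := fun x => hv0 _
  have hη0 : ∀ x, 0 < η x := fun x =>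
    pos_of_mul_pos_right ((hu0 x).trans_le (hcomp x).1) hC.le
  have hup : ∀ G : Plane → ℂ, eLpNorm (fun x => G x * (u x : ℂ)) (ENNReal.ofReal p) volume ≤
      K * eLpNorm (fun x => G x * 𝓕⁻ κ x) (ENNReal.ofReal p) volume := by
    intro G
    rw [← hK]
    refine eLpNorm_le_mul_eLpNorm_of_ae_le_mul (Filter.Eventually.of_forall fun x => ?_) _
    rw [hη x, norm_mul, norm_mul, Complex.norm_real, Complex.norm_real,
      Real.norm_of_nonneg (hu0 x).le, Real.norm_of_nonneg (hη0 x).le, mul_left_comm]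
    exact mul_le_mul_of_nonneg_left (hcomp x).1 (norm_nonneg _)
  have hdown : ∀ G : Plane → ℂ, eLpNorm (fun x => G x * 𝓕⁻ κ x) (ENNReal.ofReal p) volume ≤
      K * eLpNorm (fun x => G x * (u x : ℂ)) (ENNReal.ofReal p) volume := by
    intro G
    rw [← hK]
    refine eLpNorm_le_mul_eLpNorm_of_ae_le_mul (Filter.Eventually.of_forall fun x => ?_) _
    rw [hη x, norm_mul, norm_mul, Complex.norm_real, Complex.norm_real,
      Real.norm_of_nonneg (hu0 x).le, Real.norm_of_nonneg (hη0 x).le, mul_left_comm]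
    exact mul_le_mul_of_nonneg_left (hcomp x).2 (norm_nonneg _)
  have hkey := hD.strip_mul hp m k hf hsupp hκi hκ
  have hsum : (∑ j ∈ Finset.range (2 ^ n),
      eLpNorm (fun x => fourierProj (dyadicInterval (m + n) (k * 2 ^ n + j)) f x * 𝓕⁻ κ x)
        (ENNReal.ofReal p) volume ^ 2) ^ (1 / 2 : ℝ) ≤ K * (∑ j ∈ Finset.range (2 ^ n),
      eLpNorm (fun x => fourierProj (dyadicInterval (m + n) (k * 2 ^ n + j)) f x * (u x : ℂ))
        (ENNReal.ofReal p) volume ^ 2) ^ (1 / 2 : ℝ) := by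
    have hKeq : (K : ℝ≥0∞) = ((K : ℝ≥0∞) ^ 2) ^ (1 / 2 : ℝ) := by
      rw [← ENNReal.rpow_two, ← ENNReal.rpow_mul, mul_one_div_cancel two_ne_zero, ENNReal.rpow_one]
    rw [hKeq, ← ENNReal.mul_rpow_of_nonneg _ _ (by norm_num : (0 : ℝ) ≤ 1 / 2), Finset.mul_sum]
    refine ENNReal.rpow_le_rpow (Finset.sum_le_sum fun j _ => ?_) (by norm_num)
    rw [← mul_pow]
    exact pow_le_pow_left' (hdown _) 2
  calc _ ≤ _ := hup _
    _ ≤ K * (4 * (D * (K * _))) := by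
        refine mul_le_mul_right (hkey.trans ?_) _
        refine mul_le_mul_right (mul_le_mul_right hsum _) _
    _ = _ := by push_cast; ring

/-- The `p`-th root of the weight of the unit square centred at the origin. -/
def weightRoot (p : ℝ) (y : Plane) : ℝ := ((1 + ‖y‖) ^ (200 / p))⁻¹

theorem weightRoot_pos (p : ℝ) (y : Plane) : 0 < weightRoot p y := by
  unfold weightRoot; positivity

theorem continuous_weightRoot (p : ℝ) : Continuous (weightRoot p) := by
  unfold weightRoot
  refine Continuous.inv₀ ?_ fun y => by positivity
  exact Continuous.rpow_const (by fun_prop) fun y => Or.inl (by positivity)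

theorem weightRoot_le_one {p : ℝ} (hp : 1 ≤ p) (y : Plane) : weightRoot p y ≤ 1 :=
  inv_le_one_of_one_le₀ (Real.one_le_rpow (by linarith [norm_nonneg y]) (by positivity))

theorem weightRoot_add_le {p : ℝ} (hp : 1 ≤ p) (x y : Plane) :
    weightRoot p (x + y) ≤ weightRoot p x * (1 + ‖y‖) ^ 200 := by
  have hx : 0 < 1 + ‖x‖ := by positivity
  have hy : 0 < 1 + ‖y‖ := by positivity
  have hxy : 0 < 1 + ‖x + y‖ := by positivity
  have h1 : (1 + ‖x‖) ^ (200 / p) ≤ (1 + ‖x + y‖) ^ (200 / p) * (1 + ‖y‖) ^ 200 := by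
    calc (1 + ‖x‖) ^ (200 / p) ≤ ((1 + ‖x + y‖) * (1 + ‖y‖)) ^ (200 / p) :=
          Real.rpow_le_rpow hx.le (one_add_norm_le_mul_add x y) (by positivity)
      _ = (1 + ‖x + y‖) ^ (200 / p) * (1 + ‖y‖) ^ (200 / p) :=
          Real.mul_rpow hxy.le hy.le
      _ ≤ (1 + ‖x + y‖) ^ (200 / p) * (1 + ‖y‖) ^ (200 : ℝ) := by
          refine mul_le_mul_of_nonneg_left (Real.rpow_le_rpow_of_exponent_le
            (by linarith [norm_nonneg y]) (div_le_self (by norm_num) hp)) (by positivity)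
      _ = _ := by
          congr 1
          exact_mod_cast Real.rpow_natCast (1 + ‖y‖) 200
  unfold weightRoot
  rw [inv_mul_eq_div, le_div_iff₀ (by positivity), inv_mul_le_iff₀ (by positivity)]
  exact h1

/-- A rapidly decaying modification of `weightRoot p`. -/
def weightRootCut (p τ : ℝ) (y : Plane) : ℝ := weightRoot p y * ((1 + τ * ‖y‖) ^ 4)⁻¹

theorem weightRootCut_le {p τ : ℝ} (hτ : 0 ≤ τ) (y : Plane) :
    weightRootCut p τ y ≤ weightRoot p y :=
  mul_le_of_le_one_right (weightRoot_pos p y).le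
    (inv_le_one_of_one_le₀ (one_le_pow₀ (by linarith [mul_nonneg hτ (norm_nonneg y)])))

theorem weightRootCut_pos {p τ : ℝ} (hτ : 0 ≤ τ) (y : Plane) : 0 < weightRootCut p τ y :=
  mul_pos (weightRoot_pos p y) (by positivity)

theorem continuous_weightRootCut (p : ℝ) {τ : ℝ} (hτ : 0 ≤ τ) : Continuous (weightRootCut p τ) :=
  (continuous_weightRoot p).mul (Continuous.inv₀ (by fun_prop) fun y => by positivity)

/-- The root of the weight decays like |y|^(-200/p), which is not integrable for p ≥ 100; the factor
with τ restores integrability. -/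
theorem integrable_weightRootCut {p τ : ℝ} (hp : 1 ≤ p) (hτ : 0 < τ) (hτ1 : τ ≤ 1) :
    Integrable (weightRootCut p τ) := by
  refine Integrable.mono' ((integrable_inv_one_add_norm_pow (le_refl 4)).const_mul ((τ ^ 4)⁻¹))
    (continuous_weightRootCut p hτ.le).aestronglyMeasurable (Filter.Eventually.of_forall fun y => ?_)
  rw [Real.norm_of_nonneg (weightRootCut_pos hτ.le y).le]
  refine (mul_le_of_le_one_left (by positivity) (weightRoot_le_one hp y)).trans ?_
  rw [← mul_inv, ← mul_pow]
  refine inv_anti₀ (by positivity) (pow_le_pow_left₀ (by positivity) ?_ 4)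
  linarith

/-- The exponent 204 = 200 + 4 does not depend on τ ≤ 1, so the decoupling constant is uniform as τ
→ 0. -/
theorem weightRootCut_add_le {p τ : ℝ} (hp : 1 ≤ p) (hτ : 0 < τ) (hτ1 : τ ≤ 1) (x y : Plane) :
    weightRootCut p τ (x + y) ≤ weightRootCut p τ x * (1 + ‖y‖) ^ 204 := by
  have h1 := weightRoot_add_le hp x y
  have h2 : ((1 + τ * ‖x + y‖) ^ 4)⁻¹ ≤ ((1 + τ * ‖x‖) ^ 4)⁻¹ * (1 + ‖y‖) ^ 4 := by
    rw [inv_mul_eq_div, le_div_iff₀ (by positivity), inv_mul_le_iff₀ (by positivity), ← mul_pow]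
    refine pow_le_pow_left₀ (by positivity) ?_ 4
    have h := one_add_norm_le_mul_add (τ • x) (τ • y)
    rw [← smul_add, norm_smul, norm_smul, norm_smul, Real.norm_of_nonneg hτ.le] at h
    refine h.trans (mul_le_mul_of_nonneg_left ?_ (by positivity))
    have := mul_le_of_le_one_left (norm_nonneg y) hτ1
    linarith
  have hx := (weightRoot_pos p x).le
  calc weightRootCut p τ (x + y)
      ≤ (weightRoot p x * (1 + ‖y‖) ^ 200) * (((1 + τ * ‖x‖) ^ 4)⁻¹ * (1 + ‖y‖) ^ 4) :=
        mul_le_mul h1 h2 (by positivity) (by positivity)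
    _ = _ := by unfold weightRootCut; ring

/-- Passing to the p-th root of the weight turns a weighted norm into the plain norm of a product,
to which global decoupling applies. -/
theorem weightedAvg_eq_mul_eLpNorm {p : ℝ} (hp : 1 ≤ p) (c : Plane) {L : ℝ} (hL : 0 < L)
    (G : Plane → ℂ) : weightedAvg p c L G = (ENNReal.ofReal (L ^ 2))⁻¹ ^ (1 / p) *
      eLpNorm (fun x => G x * (weightRoot p (L⁻¹ • (x - c)) : ℂ)) (ENNReal.ofReal p) volume := by
  have hp0 : 0 < p := by linarith
  rw [weightedAvg_eq hp0, lintegral_weightMeasure c hL,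
    ENNReal.mul_rpow_of_nonneg _ _ (by positivity),
    eLpNorm_eq_lintegral_rpow_enorm_toReal (by simpa using hp0) ENNReal.ofReal_ne_top,
    ENNReal.toReal_ofReal hp0.le]
  congr 3
  ext x
  have hn : ‖L⁻¹ • (x - c)‖ = ‖x - c‖ / L := by
    rw [norm_smul, norm_inv, Real.norm_of_nonneg hL.le, inv_mul_eq_div]
  have hw : weight c L x = weightRoot p (L⁻¹ • (x - c)) ^ p := by
    have hb : 0 ≤ 1 + ‖x - c‖ / L := by positivity
    rw [weight_eq, weightRoot, hn, Real.inv_rpow (by positivity), ← Real.rpow_mul hb,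
      div_mul_cancel₀ _ hp0.ne']
    congr 1
    exact_mod_cast (Real.rpow_natCast (1 + ‖x - c‖ / L) 200).symm
  rw [enorm_mul, ENNReal.mul_rpow_of_nonneg _ _ hp0.le, mul_comm, hw,
    ← ENNReal.ofReal_rpow_of_pos (weightRoot_pos p _), ← ofReal_norm (E := ℂ) (weightRoot p _ : ℂ),
    Complex.norm_real, Real.norm_of_nonneg (weightRoot_pos p _).le]

/-- Weighted decoupling on a strip of width `2^(-m)` at spatial scale `4^(m+n)`. -/
theorem exists_weighted_decoupling {p : ℝ} (hp : 1 ≤ p) : ∃ C : ℝ≥0, ∀ (n : ℕ) (D : ℝ≥0∞),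
    IsDecouplingBound n p D → ∀ (m k : ℕ) (f : Plane → ℂ), Integrable f →
    (∀ ξ, f ξ ≠ 0 → ξ ∈ parabolaNhd ((4 : ℝ) ^ (m + n))⁻¹) → ∀ c : Plane,
    weightedAvg p c ((4 : ℝ) ^ (m + n)) (fourierProj (dyadicInterval m k) f) ≤
      C * (D * (∑ j ∈ Finset.range (2 ^ n), weightedAvg p c ((4 : ℝ) ^ (m + n))
        (fourierProj (dyadicInterval (m + n) (k * 2 ^ n + j)) f) ^ 2) ^ (1 / 2 : ℝ)) := by
  obtain ⟨C, h⟩ := exists_decoupling_mul_weight 204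
  refine ⟨C, fun n D hD m k f hf hsupp c => ?_⟩
  set L : ℝ := (4 : ℝ) ^ (m + n) with hLdef
  have hL : 0 < L := by positivity
  let E : (Plane → ℝ) → (Plane → ℂ) → ℝ≥0∞ := fun v G =>
    eLpNorm (fun x => G x * (v (L⁻¹ • (x - c)) : ℂ)) (ENNReal.ofReal p) volume
  let τ : ℕ → ℝ := fun i => 1 / ((i : ℝ) + 1)
  have hτ : ∀ i, 0 < τ i := fun i => Nat.one_div_pos_of_nat
  have hτ1 : ∀ i, τ i ≤ 1 := fun i => by
    have : (0 : ℝ) ≤ i := i.cast_nonneg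
    exact div_le_one_of_le₀ (by linarith) (by linarith)
  set G := fourierProj (dyadicInterval m k) f with hG
  set g : ℕ → Plane → ℂ := fun j => fourierProj (dyadicInterval (m + n) (k * 2 ^ n + j)) f with hg
  have hcut : ∀ i, E (weightRootCut p (τ i)) G ≤
      C * (D * (∑ j ∈ Finset.range (2 ^ n), E (weightRoot p) (g j) ^ 2) ^ (1 / 2 : ℝ)) := by
    intro i
    refine (h (weightRootCut p (τ i)) (continuous_weightRootCut p (hτ i).le)
      (integrable_weightRootCut hp (hτ i) (hτ1 i)) (weightRootCut_pos (hτ i).le)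
      (fun x => (weightRootCut_le (hτ i).le x).trans (weightRoot_le_one hp x))
      (weightRootCut_add_le hp (hτ i) (hτ1 i)) p hp n D hD m k f hf hsupp c).trans ?_
    refine mul_le_mul_right (mul_le_mul_right (ENNReal.rpow_le_rpow (Finset.sum_le_sum fun j _ =>
      pow_le_pow_left' (eLpNorm_mono fun x => ?_) 2) (by norm_num)) _) _
    rw [norm_mul, norm_mul, Complex.norm_real, Complex.norm_real,
      Real.norm_of_nonneg (weightRootCut_pos (hτ i).le _).le,
      Real.norm_of_nonneg (weightRoot_pos p _).le]
    exact mul_le_mul_of_nonneg_left (weightRootCut_le (hτ i).le _) (norm_nonneg _)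
  have hmain : E (weightRoot p) G ≤
      C * (D * (∑ j ∈ Finset.range (2 ^ n), E (weightRoot p) (g j) ^ 2) ^ (1 / 2 : ℝ)) := by
    have hmeas : ∀ i, AEStronglyMeasurable
        (fun x => G x * (weightRootCut p (τ i) (L⁻¹ • (x - c)) : ℂ)) volume := fun i =>
      ((continuous_fourierProj hf m k).mul (Complex.continuous_ofReal.comp
        ((continuous_weightRootCut p (hτ i).le).comp (by fun_prop)))).aestronglyMeasurable
    have hlim : ∀ x, Filter.Tendsto
        (fun i => G x * (weightRootCut p (τ i) (L⁻¹ • (x - c)) : ℂ)) Filter.atTop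
        (nhds (G x * (weightRoot p (L⁻¹ • (x - c)) : ℂ))) := by
      intro x
      refine Filter.Tendsto.const_mul _ ((Complex.continuous_ofReal.tendsto _).comp ?_)
      have ht : Filter.Tendsto τ Filter.atTop (nhds 0) := tendsto_one_div_add_atTop_nhds_zero_nat
      have hc : ContinuousAt (fun t : ℝ => weightRoot p (L⁻¹ • (x - c)) *
          ((1 + t * ‖L⁻¹ • (x - c)‖) ^ 4)⁻¹) 0 := by
        refine ContinuousAt.mul continuousAt_const (ContinuousAt.inv₀ (by fun_prop) (by simp))
      have h2 := hc.tendsto.comp ht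
      simpa [Function.comp_def, weightRootCut] using h2
    -- Fatou as τ → 0, the bound `hcut` being uniform in i.
    refine (Lp.eLpNorm_lim_le_liminf_eLpNorm hmeas _ (Filter.Eventually.of_forall hlim)).trans ?_
    refine Filter.liminf_le_of_le (by isBoundedDefault) fun b hb => ?_
    obtain ⟨i, hi⟩ := hb.exists
    exact hi.trans (hcut i)
  rw [weightedAvg_eq_mul_eLpNorm hp c hL]
  simp only [weightedAvg_eq_mul_eLpNorm hp c hL, mul_pow]
  rw [← Finset.mul_sum, ENNReal.mul_rpow_of_nonneg _ _ (by norm_num : (0 : ℝ) ≤ 1 / 2),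
    ← ENNReal.rpow_two, ← ENNReal.rpow_mul _ 2, mul_one_div_cancel two_ne_zero, ENNReal.rpow_one]
  calc _ ≤ (ENNReal.ofReal (L ^ 2))⁻¹ ^ (1 / p) * (C * (D * (∑ j ∈ Finset.range (2 ^ n),
        E (weightRoot p) (g j) ^ 2) ^ (1 / 2 : ℝ))) := mul_le_mul_right hmain _
    _ = _ := by ring

/-! ### Elementary inequalities -/

theorem sum_rpow_mul_rpow_le {ι : Type*} (s : Finset ι) (f g : ι → ℝ≥0∞) {κ : ℝ} (h0 : 0 ≤ κ)
    (h1 : κ ≤ 1) : ∑ i ∈ s, f i ^ (1 - κ) * g i ^ κ ≤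
      (∑ i ∈ s, f i) ^ (1 - κ) * (∑ i ∈ s, g i) ^ κ := by
  let _ : MeasurableSpace s := ⊤
  have h := ENNReal.lintegral_mul_norm_pow_le (μ := (Measure.count : Measure s))
    (f := fun i => f i) (g := fun i => g i) (measurable_from_top).aemeasurable
    (measurable_from_top).aemeasurable (sub_nonneg.2 h1) h0 (by ring)
  simp only [lintegral_count, tsum_fintype] at h
  rwa [Finset.sum_coe_sort s fun i => f i ^ (1 - κ) * g i ^ κ, Finset.sum_coe_sort s f,
    Finset.sum_coe_sort s g] at h

theorem sum_mul_le_sqrt {ι : Type*} (s : Finset ι) (f g : ι → ℝ≥0∞) {t : ℝ} :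
    ∑ i ∈ s, f i ^ (t / 2) * g i ^ (t / 2) ≤
      (∑ i ∈ s, f i ^ t) ^ (1 / 2 : ℝ) * (∑ i ∈ s, g i ^ t) ^ (1 / 2 : ℝ) := by
  have h := sum_rpow_mul_rpow_le s (fun i => f i ^ t) (fun i => g i ^ t) (κ := 1 / 2) (by norm_num)
    (by norm_num)
  simp only [← ENNReal.rpow_mul] at h
  convert h using 3 <;> norm_num <;> ring_nf

theorem mul_sqrt_mul_mul_sqrt (K y z : ℝ≥0∞) (t : ℝ) :
    (K * y ^ t) ^ (1 / 2 : ℝ) * (K * z ^ t) ^ (1 / 2 : ℝ) = K * (y ^ (t / 2) * z ^ (t / 2)) := by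
  rw [ENNReal.mul_rpow_of_nonneg _ _ (by norm_num : (0 : ℝ) ≤ 1 / 2),
    ENNReal.mul_rpow_of_nonneg _ _ (by norm_num : (0 : ℝ) ≤ 1 / 2), mul_mul_mul_comm,
    ← ENNReal.rpow_add_of_nonneg _ _ (by norm_num) (by norm_num), ← ENNReal.rpow_mul,
    ← ENNReal.rpow_mul, mul_one_div, add_halves, ENNReal.rpow_one]

theorem kappa_nonneg {p : ℝ} (hp : 4 ≤ p) : 0 ≤ kappa p :=
  div_nonneg (by linarith) (by linarith)

theorem kappa_le_one {p : ℝ} (hp : 4 ≤ p) : kappa p ≤ 1 :=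
  (div_le_one (by linarith)).2 (by linarith)

/-- The origin of κ_p: it is the solution of 2/p = (1-κ)/2 + κ/p. -/
theorem weightedAvg_interpolation {p : ℝ} (hp : 4 ≤ p) (c : Plane) (L : ℝ) {G : Plane → ℂ}
    (hG : Continuous G) : weightedAvg (p / 2) c L G ≤
      weightedAvg 2 c L G ^ (1 - kappa p) * weightedAvg p c L G ^ kappa p := by
  have hp0 : 0 < p := by linarith
  have hp2 : 0 < p - 2 := by linarith
  have hp2' : p - 2 ≠ 0 := hp2.ne'
  -- `p / 2 = 2 α + p β` with `α + β = 1`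
  set β : ℝ := (p - 4) / (2 * (p - 2)) with hβ
  have hβ0 : 0 ≤ β := div_nonneg (by linarith) (by linarith)
  have hβ1 : β ≤ 1 := (div_le_one (by linarith)).2 (by linarith)
  have h := ENNReal.lintegral_mul_norm_pow_le (μ := weightMeasure c L)
    (f := fun x => ‖G x‖ₑ ^ (2 : ℝ)) (g := fun x => ‖G x‖ₑ ^ p)
    (hG.measurable.enorm.pow_const _).aemeasurable (hG.measurable.enorm.pow_const _).aemeasurable
    (sub_nonneg.2 hβ1) hβ0 (by ring)
  rw [weightedAvg_eq (by positivity), weightedAvg_eq two_pos, weightedAvg_eq hp0,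
    ← ENNReal.rpow_mul, ← ENNReal.rpow_mul]
  have hint : ∀ x, (‖G x‖ₑ ^ (2 : ℝ)) ^ (1 - β) * (‖G x‖ₑ ^ p) ^ β = ‖G x‖ₑ ^ (p / 2) := by
    intro x
    rw [← ENNReal.rpow_mul, ← ENNReal.rpow_mul, ← ENNReal.rpow_add_of_nonneg _ _
      (mul_nonneg two_pos.le (sub_nonneg.2 hβ1)) (mul_nonneg hp0.le hβ0)]
    congr 1
    rw [hβ]; field_simp; ring
  simp only [hint] at h
  have h2 := ENNReal.rpow_le_rpow h (by positivity : 0 ≤ 1 / (p / 2))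
  rw [ENNReal.mul_rpow_of_nonneg _ _ (by positivity), ← ENNReal.rpow_mul, ← ENNReal.rpow_mul] at h2
  have e1 : (1 - β) * (1 / (p / 2)) = 1 / 2 * (1 - kappa p) := by
    rw [hβ, kappa]; field_simp; ring
  have e2 : β * (1 / (p / 2)) = 1 / p * kappa p := by
    rw [hβ, kappa]; field_simp
  rwa [e1, e2] at h2

/-- Hölder, since the normalised weights have mass bounded independently of the square. -/
theorem exists_weightedAvg_mono {q q' : ℝ} (hq : 0 < q) (hqq' : q ≤ q') : ∃ C : ℝ≥0,
    ∀ (c : Plane) (L : ℝ), 0 < L → ∀ G : Plane → ℂ, Continuous G →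
      weightedAvg q c L G ≤ C * weightedAvg q' c L G := by
  obtain ⟨C, hC⟩ := exists_weightMeasure_univ_le
  have he : 0 ≤ 1 / q - 1 / q' := sub_nonneg.2 (one_div_le_one_div_of_le hq hqq')
  refine ⟨C ^ (1 / q - 1 / q'), fun c L hL G hG => ?_⟩
  have h := eLpNorm_le_eLpNorm_mul_rpow_measure_univ (μ := weightMeasure c L) (f := G)
    (ENNReal.ofReal_le_ofReal hqq') hG.aestronglyMeasurable
  rw [ENNReal.toReal_ofReal hq.le, ENNReal.toReal_ofReal (hq.le.trans hqq'), mul_comm] at h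
  refine h.trans (mul_le_mul_left ?_ _)
  rw [ENNReal.coe_rpow_of_nonneg _ he]
  exact ENNReal.rpow_le_rpow (hC c L hL) he

theorem weightedAvg_fourierProj_ne_top (q : ℝ) (c : Plane) {L : ℝ} (hL : 0 < L)
    (σ k : ℕ) (f : Plane → ℂ) : weightedAvg q c L (fourierProj (dyadicInterval σ k) f) ≠ ∞ := by
  obtain ⟨C, hC⟩ := exists_weightMeasure_univ_le
  rw [fourierProj_eq_strip (Filter.EventuallyEq.refl _ f)]
  refine ne_top_of_le_ne_top ?_ (eLpNorm_le_of_ae_bound (μ := weightMeasure c L)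
    (p := ENNReal.ofReal q) (Filter.Eventually.of_forall fun x => norm_fourierInv_le x))
  refine ENNReal.mul_ne_top (ENNReal.rpow_ne_top_of_nonneg (by positivity)
    (ne_top_of_le_ne_top ENNReal.coe_ne_top (hC c L hL))) ENNReal.ofReal_ne_top

/-! ### The multiscale quantities -/

theorem multiscaleM_congr {f g : Plane → ℂ} (hfg : f =ᵐ[volume] g) (I : Fin 2 → Set ℝ) (a : Plane)
    (R : ℕ) (p q : ℝ) (r σ : ℕ) : multiscaleM I a R f p q r σ = multiscaleM I a R g p q r σ := by
  unfold multiscaleM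
  simp only [fun k => fourierProj_eq_strip hfg σ k,
    fun k => fourierProj_eq_strip (Filter.EventuallyEq.refl _ g) σ k]

theorem multiscaleM_ne_top (I : Fin 2 → Set ℝ) (a : Plane) (R : ℕ) (f : Plane → ℂ) {p q : ℝ}
    (hp : 0 < p) (r σ : ℕ) : multiscaleM I a R f p q r σ ≠ ∞ := by
  refine ENNReal.rpow_ne_top_of_nonneg (by positivity) (ENNReal.mul_ne_top ?_ ?_)
  · rw [ENNReal.inv_ne_top, Nat.cast_ne_zero]
    exact Fintype.card_ne_zero
  · refine ENNReal.sum_ne_top.2 fun j _ => ENNReal.prod_ne_top fun i _ =>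
      ENNReal.rpow_ne_top_of_nonneg (by positivity) (ENNReal.sum_ne_top.2 fun k _ =>
        ENNReal.pow_ne_top (weightedAvg_fourierProj_ne_top q _ (by positivity) _ _ _))

/-- Comparing two multiscale quantities on each square separately. -/
theorem multiscaleM_le_mul (I : Fin 2 → Set ℝ) (a : Plane) (R : ℕ) (f : Plane → ℂ) {p q q' : ℝ}
    (hp : 0 < p) {r σ σ' : ℕ} {K : ℝ≥0∞} (h : ∀ (c : Plane) (i : Fin 2),
      ∑ k ∈ dyadicParts σ (I i), weightedAvg q c (2 ^ r) (fourierProj (dyadicInterval σ k) f) ^ 2 ≤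
        K ^ 2 * ∑ k ∈ dyadicParts σ' (I i),
          weightedAvg q' c (2 ^ r) (fourierProj (dyadicInterval σ' k) f) ^ 2) :
    multiscaleM I a R f p q r σ ≤ K * multiscaleM I a R f p q' r σ' := by
  have hK : ((K ^ 2) ^ (p / 4)) ^ 2 = K ^ p := by
    rw [← ENNReal.rpow_natCast, ← ENNReal.rpow_natCast, ← ENNReal.rpow_mul, ← ENNReal.rpow_mul]
    congr 1
    push_cast; ring
  have hK' : K = (K ^ p) ^ (1 / p) := by
    rw [← ENNReal.rpow_mul, mul_one_div_cancel hp.ne', ENNReal.rpow_one]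
  unfold multiscaleM
  rw [hK', ← ENNReal.mul_rpow_of_nonneg _ _ (by positivity : 0 ≤ 1 / p), mul_left_comm]
  refine ENNReal.rpow_le_rpow (mul_le_mul_right ?_ _) (by positivity)
  rw [Finset.mul_sum]
  refine Finset.sum_le_sum fun j _ => ?_
  rw [Fin.prod_univ_two, Fin.prod_univ_two, ← hK]
  calc _ ≤ _ := mul_le_mul' (ENNReal.rpow_le_rpow (h _ 0) (by positivity))
        (ENNReal.rpow_le_rpow (h _ 1) (by positivity))
    _ = _ := by
        rw [ENNReal.mul_rpow_of_nonneg _ _ (by positivity : 0 ≤ p / 4),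
          ENNReal.mul_rpow_of_nonneg _ _ (by positivity : 0 ≤ p / 4)]
        ring

/-- The contribution of a single square to the multiscale quantity. -/
def localProd (p q : ℝ) (f : Plane → ℂ) (I : Fin 2 → Set ℝ) (σ : ℕ) (c : Plane) (L : ℝ) : ℝ≥0∞ :=
  ∏ i : Fin 2, (∑ k ∈ dyadicParts σ (I i),
    weightedAvg q c L (fourierProj (dyadicInterval σ k) f) ^ 2) ^ (p / 4)

theorem sum_finTwoArrow_eq (φ : ℕ → ℕ → ℝ≥0∞) (N : ℕ) :
    ∑ j : Fin 2 → Fin N, φ (j 0) (j 1) =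
      ∑ i ∈ Finset.range N, ∑ j ∈ Finset.range N, φ i j := by
  rw [Finset.sum_range, ← (finTwoArrowEquiv (Fin N)).symm.sum_comp, Fintype.sum_prod_type]
  exact Finset.sum_congr rfl fun i _ => (Finset.sum_range fun j => φ i j).symm

theorem subsquareCenter_eq (a : Plane) (R r : ℕ) (j : SubsquareIndex R r) :
    subsquareCenter a R r j = gridCenter a (2 ^ r) (j 0) (j 1) := by
  ext l
  fin_cases l <;> rfl

theorem multiscaleM_eq (I : Fin 2 → Set ℝ) (a : Plane) (R : ℕ) (f : Plane → ℂ) (p q : ℝ)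
    (r σ : ℕ) : multiscaleM I a R f p q r σ = ((((2 : ℝ≥0∞) ^ (R - r)) ^ 2)⁻¹ *
      ∑ i ∈ Finset.range (2 ^ (R - r)), ∑ j ∈ Finset.range (2 ^ (R - r)),
        localProd p q f I σ (gridCenter a (2 ^ r) i j) (2 ^ r)) ^ (1 / p) := by
  have hcard : (Fintype.card (SubsquareIndex R r) : ℝ≥0∞) = ((2 : ℝ≥0∞) ^ (R - r)) ^ 2 := by
    simp [SubsquareIndex]
  unfold multiscaleM
  rw [hcard]
  simp only [subsquareCenter_eq]
  rw [← sum_finTwoArrow_eq fun i j => localProd p q f I σ (gridCenter a (2 ^ r) i j) (2 ^ r)]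
  rfl

theorem sum_sum_range_mul_eq (φ : ℕ → ℕ → ℝ≥0∞) (A B : ℕ) :
    ∑ i ∈ Finset.range (A * B), ∑ j ∈ Finset.range (A * B), φ i j =
      ∑ i ∈ Finset.range A, ∑ j ∈ Finset.range A, ∑ i' ∈ Finset.range B, ∑ j' ∈ Finset.range B,
        φ (i * B + i') (j * B + j') := by
  simp only [sum_range_mul_eq]
  exact Finset.sum_congr rfl fun i _ => Finset.sum_comm

/-- Hölder with the same exponents 1-κ and κ at three levels: the local averages, the ℓ² sums over
intervals, and the average over squares. -/
theorem multiscaleM_interpolation {p : ℝ} (hp : 4 ≤ p) (I : Fin 2 → Set ℝ) (a : Plane) (R : ℕ)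
    {f : Plane → ℂ} (hf : Integrable f) (r σ : ℕ) : multiscaleM I a R f p (p / 2) r σ ≤
      multiscaleM I a R f p 2 r σ ^ (1 - kappa p) * multiscaleM I a R f p p r σ ^ kappa p := by
  have hk0 := kappa_nonneg hp
  have hk1 := kappa_le_one hp
  have hk1' := sub_nonneg.2 hk1
  have hp0 : 0 < p := by linarith
  unfold multiscaleM
  rw [← ENNReal.rpow_mul, ← ENNReal.rpow_mul, mul_comm (1 / p), mul_comm (1 / p), ENNReal.rpow_mul,
    ENNReal.rpow_mul, ← ENNReal.mul_rpow_of_nonneg _ _ (by positivity : 0 ≤ 1 / p)]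
  refine ENNReal.rpow_le_rpow ?_ (by positivity)
  rw [ENNReal.mul_rpow_of_nonneg _ _ hk1', ENNReal.mul_rpow_of_nonneg _ _ hk0, mul_mul_mul_comm,
    ← ENNReal.rpow_add_of_nonneg _ _ hk1' hk0, sub_add_cancel, ENNReal.rpow_one]
  refine mul_le_mul_right (le_trans (Finset.sum_le_sum fun j _ => ?_)
    (sum_rpow_mul_rpow_le _ _ _ hk0 hk1)) _
  rw [← ENNReal.prod_rpow_of_nonneg hk1', ← ENNReal.prod_rpow_of_nonneg hk0,
    ← Finset.prod_mul_distrib]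
  refine Finset.prod_le_prod' fun i _ => ?_
  rw [← ENNReal.rpow_mul, ← ENNReal.rpow_mul, mul_comm (p / 4), mul_comm (p / 4), ENNReal.rpow_mul,
    ENNReal.rpow_mul, ← ENNReal.mul_rpow_of_nonneg _ _ (by positivity : 0 ≤ p / 4)]
  refine ENNReal.rpow_le_rpow (le_trans (Finset.sum_le_sum fun k _ => ?_)
    (sum_rpow_mul_rpow_le _ _ _ hk0 hk1)) (by positivity)
  refine (pow_le_pow_left' (weightedAvg_interpolation hp _ _ (continuous_fourierProj hf σ k))
    2).trans_eq ?_
  rw [mul_pow]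
  simp only [← ENNReal.rpow_natCast, ← ENNReal.rpow_mul]
  rw [mul_comm (1 - kappa p), mul_comm (kappa p)]

/-- Cauchy–Schwarz over the squares separates the two intervals, so no transversality is needed. For
each one, Minkowski in ℓ^(p/2) moves the sum over squares inside, where the weights add up. -/
theorem exists_multiscaleM_le_coarse {p : ℝ} (hp : 4 ≤ p) : ∃ C : ℝ≥0, ∀ (I : Fin 2 → Set ℝ)
    (a : Plane) (R : ℕ) (f : Plane → ℂ), Integrable f → ∀ r σ, r ≤ R →
      multiscaleM I a R f p p r σ ≤ C * multiscaleM I a R f p p R σ := by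
  obtain ⟨C, hC⟩ := exists_sum_lintegral_weightMeasure_le
  have hp0 : 0 < p := by linarith
  refine ⟨C ^ (1 / p), fun I a R f hf r σ hr => ?_⟩
  rw [multiscaleM_eq, multiscaleM_eq, ENNReal.coe_rpow_of_nonneg _ (by positivity),
    ← ENNReal.mul_rpow_of_nonneg _ _ (by positivity : 0 ≤ 1 / p)]
  refine ENNReal.rpow_le_rpow ?_ (by positivity)
  simp only [Nat.sub_self, pow_zero, Finset.sum_range_one, one_pow, inv_one, one_mul]
  set N : ℕ := 2 ^ (R - r) with hN
  have hN0 : 0 < N := by positivity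
  have hcast : (2 : ℝ≥0∞) ^ (R - r) = N := by rw [hN]; push_cast; rfl
  have hscale : (N : ℝ) * 2 ^ r = 2 ^ R := by
    rw [hN]; push_cast; rw [← pow_add, Nat.sub_add_cancel hr]
  rw [hcast, ENNReal.inv_mul_le_iff (by positivity) (by finiteness)]
  let X : Fin 2 → ℕ × ℕ → ℝ≥0∞ := fun l q => ∑ k ∈ dyadicParts σ (I l),
    weightedAvg p (gridCenter a (2 ^ r) q.1 q.2) (2 ^ r) (fourierProj (dyadicInterval σ k) f) ^ 2
  let Y : Fin 2 → ℝ≥0∞ := fun l => ∑ k ∈ dyadicParts σ (I l),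
    weightedAvg p (gridCenter a (2 ^ R) 0 0) (2 ^ R) (fourierProj (dyadicInterval σ k) f) ^ 2
  have hX : ∀ l, ∑ q ∈ Finset.range N ×ˢ Finset.range N, X l q ^ (p / 2) ≤
      (C * (N : ℝ≥0∞) ^ 2) * Y l ^ (p / 2) := by
    intro l
    refine sum_rpow_sum_le (Finset.range N ×ˢ Finset.range N) (dyadicParts σ (I l))
      (fun k q => weightedAvg p (gridCenter a (2 ^ r) q.1 q.2) (2 ^ r)
        (fourierProj (dyadicInterval σ k) f) ^ 2)
      (fun k => weightedAvg p (gridCenter a (2 ^ R) 0 0) (2 ^ R)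
        (fourierProj (dyadicInterval σ k) f) ^ 2) (by linarith) fun k _ => ?_
    have hpow : ∀ c L, (weightedAvg p c L (fourierProj (dyadicInterval σ k) f) ^ 2) ^ (p / 2) =
        ∫⁻ x, ‖fourierProj (dyadicInterval σ k) f x‖ₑ ^ p ∂weightMeasure c L := by
      intro c L
      rw [← weightedAvg_rpow hp0, ← ENNReal.rpow_two, ← ENNReal.rpow_mul, mul_div_cancel₀ _ two_ne_zero]
    simp only [hpow]
    rw [Finset.sum_product]
    have h := hC a (2 ^ r) N (by positivity) hN0
      (fun x => ‖fourierProj (dyadicInterval σ k) f x‖ₑ ^ p)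
      ((continuous_fourierProj hf σ k).measurable.enorm.pow_const p)
    rwa [hscale] at h
  have hprod : ∀ c L, localProd p p f I σ c L =
      (∑ k ∈ dyadicParts σ (I 0), weightedAvg p c L (fourierProj (dyadicInterval σ k) f) ^ 2)
          ^ (p / 2 / 2) *
        (∑ k ∈ dyadicParts σ (I 1), weightedAvg p c L (fourierProj (dyadicInterval σ k) f) ^ 2)
          ^ (p / 2 / 2) := by
    intro c L
    rw [localProd, Fin.prod_univ_two, div_div]
    norm_num
  rw [← Finset.sum_product' (f := fun i j =>
    localProd p p f I σ (gridCenter a (2 ^ r) i j) (2 ^ r))]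
  simp only [hprod]
  refine (sum_mul_le_sqrt _ (X 0) (X 1)).trans ?_
  refine (mul_le_mul' (ENNReal.rpow_le_rpow (hX 0) (by norm_num))
    (ENNReal.rpow_le_rpow (hX 1) (by norm_num))).trans_eq ?_
  rw [mul_sqrt_mul_mul_sqrt, mul_comm (C : ℝ≥0∞), mul_assoc]

/-! ### The steps of the two-scale inequality -/

/-- Each square of side 2^(2m) is a grid of 2^m × 2^m squares of side 2^m, the geometry of
`exists_ball_inflation` with N = 2^m; the results are averaged over the large squares. -/
theorem exists_multiscaleM_inflation {p : ℝ} (hp : 4 ≤ p) {c : ℝ} (hc : 0 < c) : ∃ C : ℝ≥0,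
    ∀ I : Fin 2 → Set ℝ, (∀ x ∈ I 0, ∀ y ∈ I 1, c ≤ dist x y) → ∀ (m R : ℕ), 2 * m ≤ R →
    ∀ (a : Plane) (f : Plane → ℂ), Integrable f →
    (∀ ξ, f ξ ≠ 0 → ξ ∈ parabolaNhd ((4 : ℝ) ^ m)⁻¹) →
      multiscaleM I a R f p (p / 2) m m ≤ C * multiscaleM I a R f p (p / 2) (2 * m) m := by
  classical
  obtain ⟨C, hC⟩ := exists_ball_inflation hp hc
  have hp0 : 0 < p := by linarith
  refine ⟨C ^ (1 / p), fun I hI m R hR a f hf hsupp => ?_⟩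
  rw [multiscaleM_eq, multiscaleM_eq, ENNReal.coe_rpow_of_nonneg _ (by positivity),
    ← ENNReal.mul_rpow_of_nonneg _ _ (by positivity : 0 ≤ 1 / p)]
  refine ENNReal.rpow_le_rpow ?_ (by positivity)
  set A : ℕ := 2 ^ (R - 2 * m) with hA
  set N : ℕ := 2 ^ m with hN
  have hAN : 2 ^ (R - m) = A * N := by
    rw [hA, hN, ← pow_add]; congr 1; omega
  have hcA : (2 : ℝ≥0∞) ^ (R - 2 * m) = A := by rw [hA]; push_cast; rfl
  have hcAN : (2 : ℝ≥0∞) ^ (R - m) = (A : ℝ≥0∞) * N := by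
    rw [← Nat.cast_mul, ← hAN]; push_cast; rfl
  have hNr : (N : ℝ) = 2 ^ m := by rw [hN]; push_cast; rfl
  have hNN : (N : ℝ) * N = 2 ^ (2 * m) := by rw [hNr, ← pow_add, two_mul]
  have hN0 : 0 < N := by positivity
  have hA0 : 0 < A := by positivity
  rw [hAN, hcAN, hcA, sum_sum_range_mul_eq]
  -- Left endpoints belong to their intervals, so they inherit the separation of I₁ and I₂.
  let α : ℕ → ℝ := fun k => (k : ℝ) / 2 ^ m
  have hαmem : ∀ k, α k ∈ dyadicInterval m k := fun k =>
    ⟨le_rfl, div_le_div_of_nonneg_right (by linarith) (by positivity)⟩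
  have hpart : ∀ {J : Set ℝ} {k : ℕ}, k ∈ dyadicParts m J → k < 2 ^ m ∧ dyadicInterval m k ⊆ J := by
    intro J k hk
    rw [dyadicParts, Finset.mem_filter, Finset.mem_range] at hk
    exact hk
  let g : ℕ → Plane → ℂ := fun k => indicator (strip m k) f
  have hproj : ∀ k, 𝓕⁻ (g k) = fourierProj (dyadicInterval m k) f := fun k =>
    (fourierProj_eq_strip (Filter.EventuallyEq.refl _ f) m k).symm
  have hsq : ∀ i j, ∑ i' ∈ Finset.range N, ∑ j' ∈ Finset.range N,
      localProd p (p / 2) f I m (gridCenter a (2 ^ m) (i * N + i') (j * N + j')) (2 ^ m) ≤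
      C * (N : ℝ≥0∞) ^ 2 * localProd p (p / 2) f I m (gridCenter a (2 ^ (2 * m)) i j)
        (2 ^ (2 * m)) := by
    intro i j
    have h := hC N (fun l => dyadicParts m (I l)) α hN0
      (fun l k hk => by
        have h1 : ((k : ℝ)) ≤ 2 ^ m := by exact_mod_cast (hpart hk).1.le
        exact ⟨by positivity, (div_le_one (by positivity)).2 h1⟩)
      (fun k hk k' hk' => by
        rw [← Real.dist_eq]
        exact hI _ ((hpart hk).2 (hαmem k)) _ ((hpart hk').2 (hαmem k')))
      !₂[a 0 + N * N * i, a 1 + N * N * j] g (fun k => hf.indicator (measurableSet_strip _ _))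
      (fun k ξ hξ => by
        have h1 : ξ ∈ strip m k := by
          by_contra hne
          exact hξ (indicator_of_notMem hne _)
        have h2 : f ξ ≠ 0 := by
          intro h0
          exact hξ (by simp only [g, indicator_of_mem h1, h0])
        have h3 := (hsupp ξ h2).2
        have h4 : (4 : ℝ) ^ m = (N : ℝ) ^ 2 := by
          rw [hNr, ← pow_mul, mul_comm, pow_mul]; norm_num
        rw [h4] at h3
        refine ⟨⟨h1.1, h1.2.le.trans_eq ?_⟩, h3⟩
        rw [hNr, add_div, one_div])
    have hc1 : ∀ i' j' : ℕ, gridCenter !₂[a 0 + N * N * i, a 1 + N * N * j] N i' j' =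
        gridCenter a (2 ^ m) (i * N + i') (j * N + j') := by
      intro i' j'
      rw [← hNr]
      ext l
      fin_cases l
      · simp [gridCenter]; ring
      · simp [gridCenter]; ring
    have hc2 : gridCenter !₂[a 0 + N * N * i, a 1 + N * N * j] (N * N) 0 0 =
        gridCenter a (2 ^ (2 * m)) i j := by
      rw [← hNN]
      ext l
      fin_cases l
      · simp [gridCenter]; ring
      · simp [gridCenter]; ring
    simp only [hc1, hc2, hproj] at h
    simp only [hNN] at h
    simp only [hNr] at h
    exact h
  have hAtop : (A : ℝ≥0∞) ≠ ∞ := ENNReal.natCast_ne_top A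
  have hA0' : (A : ℝ≥0∞) ≠ 0 := by exact_mod_cast hA0.ne'
  have hNtop : (N : ℝ≥0∞) ≠ ∞ := ENNReal.natCast_ne_top N
  have hN0' : (N : ℝ≥0∞) ≠ 0 := by exact_mod_cast hN0.ne'
  refine (mul_le_mul_right (Finset.sum_le_sum fun i _ => Finset.sum_le_sum fun j _ => hsq i j)
    _).trans_eq ?_
  simp only [← Finset.mul_sum]
  have hcancel : (((A : ℝ≥0∞) * N) ^ 2)⁻¹ * (N : ℝ≥0∞) ^ 2 = ((A : ℝ≥0∞) ^ 2)⁻¹ := by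
    rw [mul_pow, ENNReal.mul_inv (Or.inl (pow_ne_zero 2 hA0')) (Or.inl (ENNReal.pow_ne_top hAtop)),
      mul_assoc, ENNReal.inv_mul_cancel (pow_ne_zero 2 hN0') (ENNReal.pow_ne_top hNtop), mul_one]
  rw [← hcancel]
  ring

theorem sq_sqrt_coe (C : ℝ≥0) : (((NNReal.sqrt C : ℝ≥0) : ℝ≥0∞)) ^ 2 = C := by
  rw [← ENNReal.coe_pow, NNReal.sq_sqrt]

theorem exists_multiscaleM_orthogonality {p : ℝ} (hp : 0 < p) : ∃ C : ℝ≥0, ∀ (I : Fin 2 → Set ℝ)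
    (a : Plane) (R : ℕ) (f : Plane → ℂ), Integrable f → ∀ m,
      multiscaleM I a R f p 2 (2 * m) m ≤ C * multiscaleM I a R f p 2 (2 * m) (2 * m) := by
  obtain ⟨C, hC⟩ := exists_local_orthogonality
  refine ⟨NNReal.sqrt C, fun I a R f hf m => ?_⟩
  rw [two_mul]
  refine multiscaleM_le_mul I a R f hp fun c i => ?_
  rw [sq_sqrt_coe]
  exact hC m f hf (I i) c

theorem exists_multiscaleM_mono {p q q' : ℝ} (hp : 0 < p) (hq : 0 < q) (hqq' : q ≤ q') :
    ∃ C : ℝ≥0, ∀ (I : Fin 2 → Set ℝ) (a : Plane) (R : ℕ) (f : Plane → ℂ), Integrable f → ∀ r σ,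
      multiscaleM I a R f p q r σ ≤ C * multiscaleM I a R f p q' r σ := by
  obtain ⟨C, hC⟩ := exists_weightedAvg_mono hq hqq'
  refine ⟨C, fun I a R f hf r σ => multiscaleM_le_mul I a R f hp fun c i => ?_⟩
  rw [Finset.mul_sum]
  refine Finset.sum_le_sum fun k _ => ?_
  rw [← mul_pow]
  exact pow_le_pow_left' (hC c _ (by positivity) _ (continuous_fourierProj hf σ k)) 2

/-- Squares of side 2^(2(m+n)) = 4^(m+n) are those on which a weight blurs frequencies only by the
thickness of the parabola neighbourhood, so `exists_weighted_decoupling` applies on each. -/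
theorem exists_multiscaleM_decoupling {p : ℝ} (hp : 1 ≤ p) : ∃ C : ℝ≥0, ∀ (I : Fin 2 → Set ℝ)
    (a : Plane) (R m n : ℕ) (f : Plane → ℂ), Integrable f →
    (∀ ξ, f ξ ≠ 0 → ξ ∈ parabolaNhd ((4 : ℝ) ^ (m + n))⁻¹) →
      multiscaleM I a R f p p (2 * (m + n)) m ≤
        C * (decouplingConst n p * multiscaleM I a R f p p (2 * (m + n)) (m + n)) := by
  obtain ⟨C, hC⟩ := exists_weighted_decoupling hp
  have hp0 : 0 < p := by linarith
  refine ⟨C, fun I a R m n f hf hsupp => ?_⟩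
  have h4 : (4 : ℝ) ^ (m + n) = 2 ^ (2 * (m + n)) := by rw [pow_mul]; norm_num
  have hbound : ∀ D : {D | IsDecouplingBound n p D}, multiscaleM I a R f p p (2 * (m + n)) m ≤
      (D : ℝ≥0∞) * (C * multiscaleM I a R f p p (2 * (m + n)) (m + n)) := by
    rintro ⟨D, hD⟩
    rw [← mul_assoc]
    refine multiscaleM_le_mul I a R f hp0 fun c i => ?_
    refine le_trans ?_ (mul_le_mul_right (sum_dyadicParts_le m n (I i) _) _)
    rw [Finset.mul_sum]
    refine Finset.sum_le_sum fun k _ => ?_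
    have h := pow_le_pow_left' (hC n D hD m k f hf hsupp c) 2
    rw [h4, ← mul_assoc, mul_pow, ← ENNReal.rpow_natCast (_ ^ (1 / 2 : ℝ)) 2, ← ENNReal.rpow_mul,
      Nat.cast_two, one_div_mul_cancel two_ne_zero, ENNReal.rpow_one, mul_comm (C : ℝ≥0∞)] at h
    exact h
  -- Passing to the infimum under the product is legitimate because the other factor is finite and
  -- admissible constants exist.
  rw [decouplingConst_eq, sInf_eq_iInf', mul_left_comm, ENNReal.iInf_mul']
  · exact le_iInf hbound
  · intro h
    exact absurd h (ENNReal.mul_ne_top ENNReal.coe_ne_top (multiscaleM_ne_top I a R f hp0 _ _))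
  · exact fun _ => ⟨⟨2 ^ n, isDecouplingBound_two_pow n hp⟩⟩

theorem exists_two_scale {p : ℝ} (hp : 4 ≤ p) {c : ℝ} (hc : 0 < c) : ∃ C : ℝ≥0,
    ∀ I : Fin 2 → Set ℝ, (∀ x ∈ I 0, ∀ y ∈ I 1, c ≤ dist x y) → ∀ (m R : ℕ), 2 * m ≤ R →
    ∀ (a : Plane) (f : Plane → ℂ), Integrable f →
    (∀ ξ, f ξ ≠ 0 → ξ ∈ parabolaNhd ((4 : ℝ) ^ m)⁻¹) →
      multiscaleM I a R f p 2 m m ≤ C * (multiscaleM I a R f p 2 (2 * m) (2 * m) ^ (1 - kappa p) *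
        multiscaleM I a R f p p R m ^ kappa p) := by
  have hp0 : 0 < p := by linarith
  obtain ⟨C₁, h₁⟩ := exists_multiscaleM_mono hp0 two_pos (by linarith : 2 ≤ p / 2)
  obtain ⟨C₂, h₂⟩ := exists_multiscaleM_inflation hp hc
  obtain ⟨C₃, h₃⟩ := exists_multiscaleM_orthogonality hp0
  obtain ⟨C₄, h₄⟩ := exists_multiscaleM_le_coarse hp
  have hk0 := kappa_nonneg hp
  have hk1 := sub_nonneg.2 (kappa_le_one hp)
  refine ⟨C₁ * (C₂ * (C₃ ^ (1 - kappa p) * C₄ ^ kappa p)), fun I hI m R hR a f hf hsupp => ?_⟩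
  calc multiscaleM I a R f p 2 m m
      ≤ C₁ * multiscaleM I a R f p (p / 2) m m := h₁ I a R f hf m m
    _ ≤ C₁ * (C₂ * multiscaleM I a R f p (p / 2) (2 * m) m) :=
        mul_le_mul_right (h₂ I hI m R hR a f hf hsupp) _
    _ ≤ C₁ * (C₂ * (multiscaleM I a R f p 2 (2 * m) m ^ (1 - kappa p) *
          multiscaleM I a R f p p (2 * m) m ^ kappa p)) :=
        mul_le_mul_right (mul_le_mul_right (multiscaleM_interpolation hp I a R hf _ _) _) _
    _ ≤ C₁ * (C₂ * ((C₃ * multiscaleM I a R f p 2 (2 * m) (2 * m)) ^ (1 - kappa p) *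
          (C₄ * multiscaleM I a R f p p R m) ^ kappa p)) :=
        mul_le_mul_right (mul_le_mul_right (mul_le_mul'
          (ENNReal.rpow_le_rpow (h₃ I a R f hf m) hk1)
          (ENNReal.rpow_le_rpow (h₄ I a R f hf _ m hR) hk0)) _) _
    _ = _ := by
        rw [ENNReal.mul_rpow_of_nonneg _ _ hk1, ENNReal.mul_rpow_of_nonneg _ _ hk0]
        push_cast [ENNReal.coe_rpow_of_nonneg _ hk1, ENNReal.coe_rpow_of_nonneg _ hk0]
        ring

/-! ### The multiscale inequality -/

theorem parabolaNhd_mono {δ δ' : ℝ} (h : δ ≤ δ') : parabolaNhd δ ⊆ parabolaNhd δ' :=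
  fun _ hξ => ⟨hξ.1, hξ.2.1, hξ.2.2.trans h⟩

theorem exists_multiscale {p : ℝ} (hp : 4 ≤ p) {c : ℝ} (hc : 0 < c) (s : ℕ) : ∃ C : ℝ≥0,
    ∀ I : Fin 2 → Set ℝ, (∀ x ∈ I 0, ∀ y ∈ I 1, c ≤ dist x y) → ∀ (n u : ℕ), n = 2 ^ u → s ≤ u →
    ∀ (a : Plane) (f : Plane → ℂ), Integrable f →
    (∀ ξ, f ξ ≠ 0 → ξ ∈ parabolaNhd ((4 : ℝ) ^ n)⁻¹) →
      multiscaleM I a (2 * n) f p 2 (n / 2 ^ s) (n / 2 ^ s) ≤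
        C * (multiscaleM I a (2 * n) f p p (2 * n) n *
          ∏ l ∈ Finset.Icc 1 s, decouplingConst (n - n / 2 ^ l) p
            ^ (kappa p * (1 - kappa p) ^ (s - l))) := by
  have hp0 : 0 < p := by linarith
  have hk0 := kappa_nonneg hp
  have hk1 := sub_nonneg.2 (kappa_le_one hp)
  induction s with
  | zero =>
    obtain ⟨C₁, h₁⟩ := exists_multiscaleM_mono hp0 two_pos (by linarith : 2 ≤ p)
    obtain ⟨C₂, h₂⟩ := exists_multiscaleM_le_coarse hp
    refine ⟨C₁ * C₂, fun I _ n u _ _ a f hf _ => ?_⟩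
    simp only [pow_zero, Nat.div_one, Finset.Icc_eq_empty_of_lt zero_lt_one, Finset.prod_empty,
      mul_one, ENNReal.coe_mul, mul_assoc]
    exact (h₁ I a _ f hf n n).trans (mul_le_mul_right (h₂ I a _ f hf n n (by omega)) _)
  | succ s ih =>
    obtain ⟨C, hC⟩ := ih
    obtain ⟨C₁, h₁⟩ := exists_two_scale hp hc
    obtain ⟨C₂, h₂⟩ := exists_multiscaleM_decoupling (p := p) (by linarith)
    refine ⟨C₁ * (C ^ (1 - kappa p) * C₂ ^ kappa p), fun I hI n u hn hs a f hf hsupp => ?_⟩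
    -- As n is a power of 2 with exponent at least s + 1, both divisions are exact and n / 2^s = 2m:
    -- the L² factor of the two-scale step is the left side of the induction hypothesis.
    obtain ⟨v, rfl⟩ : ∃ v, u = v + (s + 1) := ⟨u - (s + 1), by omega⟩
    set m : ℕ := n / 2 ^ (s + 1) with hm
    have hm1 : m = 2 ^ v := by
      rw [hm, hn, pow_add, Nat.mul_div_cancel _ (by positivity)]
    have hm2 : n / 2 ^ s = 2 * m := by
      have h2 : 2 ^ (v + (s + 1)) = 2 * 2 ^ v * 2 ^ s := by ring
      rw [hm1, hn, h2, Nat.mul_div_cancel _ (by positivity)]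
    have hmn : m ≤ n := Nat.div_le_self _ _
    have hstep := h₁ I hI m (2 * n) (by omega) a f hf fun ξ hξ =>
      parabolaNhd_mono (inv_anti₀ (by positivity) (pow_le_pow_right₀ (by norm_num) hmn))
        (hsupp ξ hξ)
    have hprev := hC I hI n (v + (s + 1)) hn (by omega) a f hf hsupp
    rw [hm2] at hprev
    have hdec := h₂ I a (2 * n) m (n - m) f hf (by rwa [Nat.add_sub_cancel' hmn])
    rw [Nat.add_sub_cancel' hmn] at hdec
    set M := multiscaleM I a (2 * n) f p p (2 * n) n with hM
    rw [Finset.prod_Icc_succ_top (by omega), Nat.sub_self, pow_zero, mul_one]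
    -- The power 1-κ of the two-scale step raises each earlier exponent by one; the new factor l = s
    -- + 1 enters with exponent κ.
    have hprod : (∏ l ∈ Finset.Icc 1 s, decouplingConst (n - n / 2 ^ l) p
        ^ (kappa p * (1 - kappa p) ^ (s - l))) ^ (1 - kappa p) =
        ∏ l ∈ Finset.Icc 1 s, decouplingConst (n - n / 2 ^ l) p
          ^ (kappa p * (1 - kappa p) ^ (s + 1 - l)) := by
      rw [← ENNReal.prod_rpow_of_nonneg hk1]
      refine Finset.prod_congr rfl fun l hl => ?_
      rw [← ENNReal.rpow_mul, mul_assoc, ← pow_succ,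
        Nat.succ_sub (Finset.mem_Icc.1 hl).2]
    have hMM : M ^ (1 - kappa p) * M ^ kappa p = M := by
      rw [← ENNReal.rpow_add_of_nonneg _ _ hk1 hk0, sub_add_cancel, ENNReal.rpow_one]
    refine hstep.trans ((mul_le_mul_right (mul_le_mul' (ENNReal.rpow_le_rpow hprev hk1)
      (ENNReal.rpow_le_rpow hdec hk0)) _).trans_eq ?_)
    rw [ENNReal.mul_rpow_of_nonneg _ _ hk1, ENNReal.mul_rpow_of_nonneg _ _ hk1,
      ENNReal.mul_rpow_of_nonneg _ _ hk0, ENNReal.mul_rpow_of_nonneg _ _ hk0, hprod]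
    push_cast [ENNReal.coe_rpow_of_nonneg _ hk1, ENNReal.coe_rpow_of_nonneg _ hk0]
    nth_rewrite 3 [← hMM]
    ring

/-- The intermediate estimates use pointwise supports; the transform may be changed on a null set
without affecting the multiscale quantities. -/
theorem exists_pointwise_support {F f : Plane → ℂ} {δ : ℝ} (hF : HasFourierTransform F f)
    (hf : SupportedIn f (parabolaNhd δ)) : ∃ g : Plane → ℂ, Integrable g ∧ f =ᵐ[volume] g ∧
      ∀ ξ, g ξ ≠ 0 → ξ ∈ parabolaNhd δ := by
  refine ⟨indicator (parabolaNhd δ) f, hF.1.indicator (measurableSet_parabolaNhd δ), ?_, fun ξ hξ =>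
    by_contra fun hne => hξ (indicator_of_notMem hne _)⟩
  filter_upwards [hf] with ξ hξ
  by_cases h : ξ ∈ parabolaNhd δ
  · rw [indicator_of_mem h]
  · rw [indicator_of_notMem h, hξ h]

theorem one_le_two_rpow {t : ℝ} (ht : 0 ≤ t) : (1 : ℝ≥0∞) ≤ 2 ^ t := by
  have h := ENNReal.rpow_le_rpow (one_le_two : (1 : ℝ≥0∞) ≤ 2) ht
  rwa [ENNReal.one_rpow] at h

end Decoupling

end

/-! ### Conclusion -/

theorem mainTheorem6 (p : ℝ) (hp : 4 ≤ p) (c : ℝ) (hc : 0 < c) (ε : ℝ) (hε : 0 < ε) :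
    -- the two-scale inequality
    (∃ C : ℝ≥0, ∀ I : Fin 2 → Set ℝ, (∀ i, Decoupling.IsDyadic (I i)) →
      (∀ x ∈ I 0, ∀ y ∈ I 1, c ≤ dist x y) →
      ∀ (m r : ℕ), m ≤ r →
      ∀ (a : Decoupling.Plane) (F Fhat : Decoupling.Plane → ℂ),
        Decoupling.HasFourierTransform F Fhat →
        Decoupling.SupportedIn Fhat (Decoupling.parabolaNhd ((4 : ℝ) ^ m)⁻¹) →
        Decoupling.multiscaleM I a (2 * r) Fhat p 2 m m ≤
          C * (2 : ℝ≥0∞) ^ ((m : ℝ) * ε) *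
            Decoupling.multiscaleM I a (2 * r) Fhat p 2 (2 * m) (2 * m)
              ^ (1 - Decoupling.kappa p) *
            Decoupling.multiscaleM I a (2 * r) Fhat p p (2 * r) m ^ Decoupling.kappa p) ∧
    -- the multiscale inequality
    (∀ s : ℕ, ∃ C : ℝ≥0, ∀ I : Fin 2 → Set ℝ, (∀ i, Decoupling.IsDyadic (I i)) →
      (∀ x ∈ I 0, ∀ y ∈ I 1, c ≤ dist x y) →
      ∀ (n u : ℕ), n = 2 ^ u → s ≤ u →
      ∀ (a : Decoupling.Plane) (F Fhat : Decoupling.Plane → ℂ),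
        Decoupling.HasFourierTransform F Fhat →
        Decoupling.SupportedIn Fhat (Decoupling.parabolaNhd ((4 : ℝ) ^ n)⁻¹) →
        Decoupling.multiscaleM I a (2 * n) Fhat p 2 (n / 2 ^ s) (n / 2 ^ s) ≤
          C * (2 : ℝ≥0∞) ^ ((s : ℝ) * (n : ℝ) * ε) *
            Decoupling.multiscaleM I a (2 * n) Fhat p p (2 * n) n *
            ∏ l ∈ Finset.Icc 1 s,
              Decoupling.decouplingConst (n - n / 2 ^ l) p
                ^ (Decoupling.kappa p * (1 - Decoupling.kappa p) ^ (s - l))) := by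
  constructor
  · obtain ⟨C, hC⟩ := Decoupling.exists_two_scale hp hc
    refine ⟨C, fun I _ hI m r hmr a F Fhat hF hsupp => ?_⟩
    obtain ⟨g, hg, hFg, hgs⟩ := Decoupling.exists_pointwise_support hF hsupp
    simp only [Decoupling.multiscaleM_congr hFg]
    refine (hC I hI m (2 * r) (by omega) a g hg hgs).trans ?_
    rw [mul_assoc ((C : ℝ≥0∞) * _)]
    -- The bound holds without loss; the factor 2^(mε) ≥ 1 only weakens it.
    exact mul_le_mul_left (le_mul_of_one_le_right' (Decoupling.one_le_two_rpow (by positivity))) _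
  · intro s
    obtain ⟨C, hC⟩ := Decoupling.exists_multiscale hp hc s
    refine ⟨C, fun I _ hI n u hn hs a F Fhat hF hsupp => ?_⟩
    obtain ⟨g, hg, hFg, hgs⟩ := Decoupling.exists_pointwise_support hF hsupp
    simp only [Decoupling.multiscaleM_congr hFg]
    refine (hC I hI n u hn hs a g hg hgs).trans ?_
    rw [mul_assoc ((C : ℝ≥0∞) * _)]
    exact mul_le_mul_left (le_mul_of_one_le_right' (Decoupling.one_le_two_rpow (by positivity))) _
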